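/- **Definitions.** A *Label Cover* instance $G$ consists of a bipartite graph $(A,B,E)$ (the supergraph), alphabets $\Sigma_A,\Sigma_B$, and a nonempty relation $\pi_e\subseteq\Sigma_A\times\Sigma_B$ for every edge $e\in E$. A labeling $(\gamma_A:A\to\Sigma_A,\ \gamma_B:B\to\Sigma_B)$ satisfies $e=(a,b)$ if $(\gamma_A(a),\gamma_B(b))\in\pi_e$. The associated *Min-Rep* instance is the graph on $(A\times\Sigma_A)\cup(B\times\Sigma_B)$ in which $(a,x)$ and $(b,y)$ are adjacent iff $(a,b)\in E$ and $(x,y)\in\pi_{(a,b)}$. A *REP-cover* is a set $C$ of its vertices such that for every $(a,b)\in E$ there are adjacent vertices $(a,x),(b,y)\in C$. The *supergirth* is the length of a shortest cycle of $(A,B,E)$. Throughout, $n=|A|+|B|$ and logarithms are to base 2. For $S\subseteq E$ let $G'_{S}$ be the instance obtained from $G$ by keeping only the edges in $S$ and then deleting every edge that lies on a cycle of length at most $k$ of the graph $(A,B,S)$. Parameters $(d,|\Sigma_A|,|\Sigma_B|,k,s,\alpha)$, where $d,|\Sigma_A|,|\Sigma_B|,k$ are natural numbers and $s,\alpha$ are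 reals, are *admissible* for $n$ if $|\Sigma_A|\ge 2$, $|\Sigma_A|\ge|\Sigma_B|$, $k\ge1$, $s>0$ and $$18\log n\ \le\ \alpha\ \le\ \min\{1/s,\ d^{1/k}/\log|\Sigma_A|\}.$$ An instance is *regular with these parameters* if $|A|=|B|=n/2$, every vertex of $(A,B,E)$ has degree $d$, and the alphabets have the given sizes. Two sets of instances $Y,N$ are *distinguishable in randomized polynomial time* if some randomized algorithm, running on every instance in time polynomial in the size of the instance (whose vertices, alphabets and relations are listed explicitly), accepts every instance in $Y$ with probability at least $2/3$ and every instance in $N$ with probability at most $1/3$, for all instances with $n$ sufficiently large. **Theorem.** There is an absolute constant $c>0$ such that the following hold. 1. For all sufficiently large $n$, all admissible parameters, and every regular Label Cover instance $G$ with these parameters: (a) for every $S\subseteq E$, $G'_S$ has supergirth larger than $k$; (b) if some labeling satisfies all edges of $G$, then for every $S\subseteq E$ the Min-Rep instance of $G'_S$ has a REP-cover of size at most $n$; (c) if every labeling satisfies at most an $s$ fraction of the edges of $G$, and $S$ contains each edge of $G$ independently with probability $\alpha\log|\Sigma_A|/d$, then with probability at least $2/3$ every REP-cover of the Min-Rep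 instance of $G'_S$ has size at least $n\sqrt\alpha/c$. 2. Let $d,|\Sigma_A|,|\Sigma_B|,k,s,\alpha$ be functions of $n$ that are admissible for all sufficiently large even $n$, and suppose that some integer-valued function that is within $1$ of $\alpha(n)$ for all sufficiently large even $n$ is computable in time polynomial in $n$. Suppose that the regular Label Cover instances in which all edges are satisfiable cannot be distinguished in randomized polynomial time from the regular Label Cover instances in which at most an $s$ fraction of the edges is satisfiable. Then the Min-Rep instances of supergirth larger than $k$ that have a REP-cover of size at most $n$ cannot be distinguished in randomized polynomial time from the Min-Rep instances of supergirth larger than $k$ in which the smallest REP-cover has size at least $n\sqrt{\alpha}/c$. This remains true when the former are restricted to instances of the form $G'_S$ with $G$ a regular, fully satisfiable instance, and the latter to instances of the form $G'_S$ with $G$ a regular instance in which at most an $s$ fraction of the edges is satisfiable. -/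

import Mathlib

open Filter

/-! ### Label Cover and Min-Rep instances -/

/-- An instance of Label Cover.  The two sides are `A = Fin nA` and `B = Fin nB`, the alphabets are
`Fin qA` and `Fin qB`, and `rel a b` is (the indicator of) the relation `π_(a,b) ⊆ Σ_A × Σ_B`.
Relations of edges are nonempty, so `(a, b)` is an edge exactly when `rel a b` is nonempty.
The same data are the adjacency matrix of the Min-Rep graph together with its partition into groups,
so an instance of Min-Rep is a value of this type, too. -/
structure LabelCover where
  nA : ℕ
  nB : ℕ
  qA : ℕ
  qB : ℕ
  rel : Fin nA → Fin nB → Fin qA → Fin qB → Bool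

namespace LabelCover

/-- The number of supervertices, `|A| + |B|`. -/
def order (I : LabelCover) : ℕ := I.nA + I.nB

/-- `(a, b)` is an edge of the Label Cover instance (a superedge). -/
def Edge (I : LabelCover) (a : Fin I.nA) (b : Fin I.nB) : Prop :=
  ∃ x y, I.rel a b x y = true

instance (I : LabelCover) (a : Fin I.nA) (b : Fin I.nB) : Decidable (I.Edge a b) :=
  inferInstanceAs (Decidable (∃ x y, I.rel a b x y = true))

/-- The set `E` of superedges. -/
def edges (I : LabelCover) : Finset (Fin I.nA × Fin I.nB) :=
  Finset.univ.filter fun e => I.Edge e.1 e.2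

/-- The supergraph `(A, B, E)`. -/
def supergraph (I : LabelCover) : SimpleGraph (Fin I.nA ⊕ Fin I.nB) where
  Adj u v := match u, v with
    | .inl a, .inr b => I.Edge a b
    | .inr b, .inl a => I.Edge a b
    | _, _ => False
  symm := ⟨by rintro (a | b) (a' | b') h <;> exact h⟩
  loopless := ⟨by rintro (a | b) h <;> exact h⟩

/-- The Min-Rep graph, with vertex set `(A × Σ_A) ∪ (B × Σ_B)`. -/
def minRepGraph (I : LabelCover) :
    SimpleGraph ((Fin I.nA × Fin I.qA) ⊕ (Fin I.nB × Fin I.qB)) where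
  Adj u v := match u, v with
    | .inl (a, x), .inr (b, y) => I.rel a b x y = true
    | .inr (b, y), .inl (a, x) => I.rel a b x y = true
    | _, _ => False
  symm := ⟨by rintro (⟨a, x⟩ | ⟨b, y⟩) (⟨a', x'⟩ | ⟨b', y'⟩) h <;> exact h⟩
  loopless := ⟨by rintro (⟨a, x⟩ | ⟨b, y⟩) h <;> exact h⟩

/-- The supergirth: the length of a shortest cycle of the supergraph (`⊤` if there is none). -/
noncomputable def supergirth (I : LabelCover) : ℕ∞ := I.supergraph.egirth

/-- The edges satisfied by the labeling `(f, g)`. -/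
def satisfied (I : LabelCover) (f : Fin I.nA → Fin I.qA) (g : Fin I.nB → Fin I.qB) :
    Finset (Fin I.nA × Fin I.nB) :=
  I.edges.filter fun e => I.rel e.1 e.2 (f e.1) (g e.2) = true

/-- Some labeling satisfies all edges. -/
def FullySatisfiable (I : LabelCover) : Prop :=
  ∃ f g, I.satisfied f g = I.edges

/-- Every labeling satisfies at most an `s` fraction of the edges. -/
def AtMostSatisfiable (I : LabelCover) (s : ℝ) : Prop :=
  ∀ f g, ((I.satisfied f g).card : ℝ) ≤ s * (I.edges.card : ℝ)

/-- `C` is a REP-cover: for every superedge `(a, b)` there are vertices `(a, x)` and `(b, y)` in `C`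
that are joined by an edge of the Min-Rep graph. -/
def IsRepCover (I : LabelCover) (C : Finset ((Fin I.nA × Fin I.qA) ⊕ (Fin I.nB × Fin I.qB))) :
    Prop :=
  ∀ a b, I.Edge a b →
    ∃ x y, Sum.inl (a, x) ∈ C ∧ Sum.inr (b, y) ∈ C ∧
      I.minRepGraph.Adj (Sum.inl (a, x)) (Sum.inr (b, y))

/-- The smallest REP-cover has size at most `t`. -/
def RepCoverAtMost (I : LabelCover) (t : ℝ) : Prop :=
  ∃ C, I.IsRepCover C ∧ (C.card : ℝ) ≤ t

/-- The smallest REP-cover has size at least `t`. -/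
def RepCoverAtLeast (I : LabelCover) (t : ℝ) : Prop :=
  ∀ C, I.IsRepCover C → t ≤ (C.card : ℝ)

/-! ### Subsampling the edges and deleting short cycles -/

/-- The instance that keeps only the edges in `S` (with their relations). -/
def restrict (I : LabelCover) (S : Finset (Fin I.nA × Fin I.nB)) : LabelCover where
  nA := I.nA
  nB := I.nB
  qA := I.qA
  qB := I.qB
  rel a b x y := I.rel a b x y && decide ((a, b) ∈ S)

/-- `(a, b)` lies on a cycle of length at most `k` of the supergraph. -/
def OnShortCycle (I : LabelCover) (k : ℕ) (a : Fin I.nA) (b : Fin I.nB) : Prop :=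
  ∃ (v : Fin I.nA ⊕ Fin I.nB) (w : I.supergraph.Walk v v),
    w.IsCycle ∧ w.length ≤ k ∧ s(Sum.inl a, Sum.inr b) ∈ w.edges

open Classical in
/-- Remove, simultaneously, every edge that lies on a cycle of length at most `k`. -/
noncomputable def removeShortCycles (I : LabelCover) (k : ℕ) : LabelCover :=
  I.restrict (I.edges.filter fun e => ¬ I.OnShortCycle k e.1 e.2)

/-- The instance obtained by keeping the edges in `S` and then removing those that lie
on a cycle of length at most `k` among the kept ones. -/
noncomputable def sparsify (I : LabelCover) (k : ℕ) (S : Finset (Fin I.nA × Fin I.nB)) :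
    LabelCover :=
  (I.restrict S).removeShortCycles k

/-- Label Cover instances with `|A| = |B| = n/2`, all degrees `d` and alphabet sizes `qA`, `qB`. -/
structure IsRegular (I : LabelCover) (n d qA qB : ℕ) : Prop where
  sizeA : 2 * I.nA = n
  sizeB : 2 * I.nB = n
  alphabetA : I.qA = qA
  alphabetB : I.qB = qB
  degree : ∀ v, (I.supergraph.neighborSet v).ncard = d

end LabelCover

open Classical in
/-- The probability that a random subset `S` of `E`, containing each element of `E` independently
with probability `p`, has property `P`. -/
noncomputable def subsampleProb {V : Type*} (E : Finset V) (p : ℝ) (P : Finset V → Prop) : ℝ :=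
  ∑ S ∈ E.powerset.filter P, p ^ S.card * (1 - p) ^ (E \ S).card

/-- The conditions on the parameters at size `n`, all logarithms being to base 2:
`|Σ_A| ≥ 2`, `|Σ_A| ≥ |Σ_B|` and `18 log n ≤ α ≤ min {1/s, d^(1/k) / log |Σ_A|}`. -/
structure AdmissibleParams (n d qA qB k : ℕ) (s α : ℝ) : Prop where
  two_le_qA : 2 ≤ qA
  qB_le_qA : qB ≤ qA
  one_le_k : 1 ≤ k
  s_pos : 0 < s
  log_le : 18 * Real.logb 2 n ≤ α
  le_inv : α ≤ 1 / s
  le_root : α ≤ (d : ℝ) ^ ((1 : ℝ) / k) / Real.logb 2 qA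

/-! ### Randomized polynomial time

The machine model is the WHILE language on binary trees (Lisp data; polynomially equivalent to
Turing machines), with an instruction that tosses a fair coin.  A step applies one primitive
operation, evaluates one test, or unfolds one sequencing. -/

/-- Binary trees, the data of the programs. -/
inductive BinTree : Type
  | nil : BinTree
  | cons : BinTree → BinTree → BinTree

namespace BinTree

/-- The number of `cons` cells. -/
def size : BinTree → ℕ
  | nil => 0
  | cons l r => l.size + r.size + 1

/-- First component. -/
def hd : BinTree → BinTree
  | nil => nil
  | cons l _ => l

/-- Second component. -/
def tl : BinTree → BinTree
  | nil => nil
  | cons _ r => r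

/-- Truth values. -/
def ofBool : Bool → BinTree
  | false => nil
  | true => cons nil nil

/-- Nonempty trees count as true. -/
def toBool : BinTree → Bool
  | nil => false
  | cons _ _ => true

/-- Lists. -/
def ofList : List BinTree → BinTree
  | [] => nil
  | t :: l => cons t (ofList l)

/-- Natural numbers in unary. -/
def ofNat (n : ℕ) : BinTree := ofList (List.replicate n nil)

/-- The table of the values of a function on `Fin n`. -/
def ofTable {n : ℕ} (f : Fin n → BinTree) : BinTree := ofList (List.ofFn f)

end BinTree

/-- Programs; the variables are numbered by `ℕ`. -/
inductive Prog : Type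
  | setNil (x : ℕ) : Prog                      -- x := nil
  | copy (x y : ℕ) : Prog                      -- x := y
  | cons (x y z : ℕ) : Prog                    -- x := cons y z
  | hd (x y : ℕ) : Prog                        -- x := hd y
  | tl (x y : ℕ) : Prog                        -- x := tl y
  | toss (x : ℕ) : Prog                        -- x := a fair random bit
  | seq (c₁ c₂ : Prog) : Prog                  -- c₁; c₂
  | branch (x : ℕ) (c₁ c₂ : Prog) : Prog       -- if x is not nil then c₁ else c₂
  | loop (x : ℕ) (c : Prog) : Prog             -- while x is not nil do c

namespace Prog

/-- A configuration: the programs still to be executed, and the values of the variables. -/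
structure Config : Type where
  todo : List Prog
  store : ℕ → BinTree

/-- One step of the computation; a configuration with nothing left to do has halted. -/
noncomputable def step : Config → PMF Config
  | ⟨[], σ⟩ => PMF.pure ⟨[], σ⟩
  | ⟨setNil x :: K, σ⟩ => PMF.pure ⟨K, Function.update σ x .nil⟩
  | ⟨copy x y :: K, σ⟩ => PMF.pure ⟨K, Function.update σ x (σ y)⟩
  | ⟨cons x y z :: K, σ⟩ => PMF.pure ⟨K, Function.update σ x (.cons (σ y) (σ z))⟩
  | ⟨hd x y :: K, σ⟩ => PMF.pure ⟨K, Function.update σ x (σ y).hd⟩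
  | ⟨tl x y :: K, σ⟩ => PMF.pure ⟨K, Function.update σ x (σ y).tl⟩
  | ⟨toss x :: K, σ⟩ =>
      (PMF.uniformOfFintype Bool).map fun b => ⟨K, Function.update σ x (.ofBool b)⟩
  | ⟨seq c₁ c₂ :: K, σ⟩ => PMF.pure ⟨c₁ :: c₂ :: K, σ⟩
  | ⟨branch x c₁ c₂ :: K, σ⟩ => PMF.pure ⟨(if (σ x).toBool then c₁ else c₂) :: K, σ⟩
  | ⟨loop x c :: K, σ⟩ => PMF.pure ⟨if (σ x).toBool then c :: loop x c :: K else K, σ⟩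

/-- The distribution of the configuration after `t` steps. -/
noncomputable def steps : ℕ → Config → PMF Config
  | 0, γ => PMF.pure γ
  | t + 1, γ => (step γ).bind (steps t)

/-- The initial configuration: the input is in variable `0`, all other variables are `nil`. -/
def init (c : Prog) (input : BinTree) : Config :=
  ⟨[c], Function.update (fun _ => .nil) 0 input⟩

/-- For every outcome of the coin tosses, `c` halts on `input` within `t` steps. -/
def HaltsWithin (c : Prog) (input : BinTree) (t : ℕ) : Prop :=
  ∀ γ ∈ (steps t (init c input)).support, γ.todo = []

/-- The probability that, after `t` steps on `input`, variable `0` is not `nil`. -/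
noncomputable def acceptProb (c : Prog) (input : BinTree) (t : ℕ) : ENNReal :=
  ((steps t (init c input)).map fun γ => (γ.store 0).toBool) true

end Prog

/-- The function `f` is computable in time polynomial in `n` (numbers are written in unary). -/
def PolyTimeComputable (f : ℕ → ℕ) : Prop :=
  ∃ (c : Prog) (p : Polynomial ℕ), ∀ n,
    c.HaltsWithin (.ofNat n) (p.eval n) ∧
    ∀ γ ∈ (Prog.steps (p.eval n) (c.init (.ofNat n))).support, γ.store 0 = .ofNat (f n)

/-- The input tree of an instance: the four sizes in unary, and the table of the relations. -/
def LabelCover.encode (I : LabelCover) : BinTree :=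
  .ofList [.ofNat I.nA, .ofNat I.nB, .ofNat I.qA, .ofNat I.qB,
    .ofTable fun a => .ofTable fun b => .ofTable fun x => .ofTable fun y =>
      .ofBool (I.rel a b x y)]

/-- Some randomized polynomial-time algorithm distinguishes `Yes` from `No`: it runs in time
polynomial in the size of the instance and, on all instances with sufficiently many supervertices,
it accepts those in `Yes` with probability at least `2/3`, and those in `No` with probability at most
`1/3`. -/
def RandPolyDistinguishable (Yes No : Set LabelCover) : Prop :=
  ∃ (c : Prog) (p : Polynomial ℕ) (n₁ : ℕ), ∀ I : LabelCover,
    c.HaltsWithin I.encode (p.eval I.encode.size) ∧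
    (n₁ ≤ I.order → I ∈ Yes → 2 / 3 ≤ c.acceptProb I.encode (p.eval I.encode.size)) ∧
    (n₁ ≤ I.order → I ∈ No → c.acceptProb I.encode (p.eval I.encode.size) ≤ 1 / 3)

/-! ### The two promise problems; all parameters are functions of the number `n` of supervertices -/

/-- Regular Label Cover instances in which all edges are satisfiable. -/
def labelCoverYes (d qA qB : ℕ → ℕ) : Set LabelCover :=
  {G | G.IsRegular G.order (d G.order) (qA G.order) (qB G.order) ∧ G.FullySatisfiable}

/-- Regular Label Cover instances in which at most an `s` fraction of the edges is satisfiable. -/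
def labelCoverNo (d qA qB : ℕ → ℕ) (s : ℕ → ℝ) : Set LabelCover :=
  {G | G.IsRegular G.order (d G.order) (qA G.order) (qB G.order) ∧ G.AtMostSatisfiable (s G.order)}

/-- Min-Rep instances of supergirth larger than `k` with a REP-cover of size at most `n`. -/
def minRepYes (k : ℕ → ℕ) : Set LabelCover :=
  {H | (k H.order : ℕ∞) < H.supergirth ∧ H.RepCoverAtMost H.order}

/-- Min-Rep instances of supergirth larger than `k` in which the smallest REP-cover has size at least
`n √α / c`. -/
def minRepNo (k : ℕ → ℕ) (α : ℕ → ℝ) (c : ℝ) : Set LabelCover :=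
  {H | (k H.order : ℕ∞) < H.supergirth ∧
    H.RepCoverAtLeast (H.order * Real.sqrt (α H.order) / c)}

/-- The instances that arise from those in `X` by keeping some of the edges and then removing those
on cycles of length at most `k`. -/
def sparsified (k : ℕ → ℕ) (X : Set LabelCover) : Set LabelCover :=
  {H | ∃ G ∈ X, ∃ S ⊆ G.edges, H = G.sparsify (k G.order) S}

/-! ### Outcomes of programs -/

/-! Completeness is immediate: a satisfying labeling, read as n vertices of the Min-Rep graph, still
covers every edge that survives.

Soundness. Let C consist of at most n√α/1024 vertices of the Min-Rep graph. At most n/512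
supervertices carry more than √α/2 labels of C, and they meet at most nd/512 of the nd/2 edges.
Between the other supervertices, labels drawn at random from the lists given by C satisfy each
covered edge with probability at least 4/α, so at most an αs/4 ≤ 1/4 fraction of the edges is
covered there. Hence C misses at least half of all edges (`card_covered_le`). Now keep edges with
probability p and put D = pd. An edge and a path of length l that closes a cycle are all kept with
probability p^(l+1), and at most d^l walks of length l start at a vertex; as D^k ≤ d, the expected
number of edges on short cycles is at most n (`subsampleExp_removed_le`). On the other hand, the
sample contains at most nD/16 of the at least nd/4 edges missed by C only with probability
exponentially small in nD, which beats the number exp(nD/32) of candidates C. A cover of the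
sparsified instance can miss only removed edges of the sample, so with probability 19/20 there is no
small one (`le_subsampleProb_repCoverAtLeast`).

Hardness. A distinguisher for Min-Rep is run on a random sparsification of the Label Cover instance.
The functions d, k and s need not be computable. The degree is read off the instance; from an
integer a close to α the program forms D₀ = (a - 1)⌊log |Σ_A|⌋, samples with a rate 2⁻ᵗ such that
D₀/4 ≤ 2⁻ᵗd ≤ D₀, and removes cycles of length up to ⌊log d / log D₀⌋, which is at least k
(`coins_cycleBound`). Removing longer cycles is no loss: the outcome is also the sparsification for
k of its own edge set (`sparsify_eq_sparsify`). A majority of three runs lowers the error 1/3 to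
7/27, which leaves room for the failure probability 1/20 of the sampling.

Running time. The functions in `PolyTree` are closed under composition, pairing, case distinction
and folds whose state grows additively, so the deterministic part of the reduction is polynomial by
the shape of its definition. Randomness is treated by `Samples`, which quantifies over the
continuation of the program, so that sequencing becomes associativity of `PMF.bind`. Subprograms do
not interfere because their variables lie in different residue classes modulo 8. -/

theorem PMF.bind_congr_support {α β : Type*} (μ : PMF α) {f g : α → PMF β}
    (h : ∀ a ∈ μ.support, f a = g a) : μ.bind f = μ.bind g := by
  ext b
  rw [PMF.bind_apply, PMF.bind_apply]
  refine tsum_congr fun a => ?_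
  by_cases ha : μ a = 0
  · simp [ha]
  · rw [h a ((PMF.mem_support_iff _ _).2 ha)]

namespace Prog

/-- The values of the variables. -/
abbrev Store := ℕ → BinTree

/-- Every outcome of `n` steps has halted, with a store that satisfies `Q`. -/
def Ends (n : ℕ) (γ : Config) (Q : Store → Prop) : Prop :=
  ∀ γ' ∈ (steps n γ).support, γ'.todo = [] ∧ Q γ'.store

theorem ends_zero {γ : Config} {Q : Store → Prop} :
    Ends 0 γ Q ↔ γ.todo = [] ∧ Q γ.store := by
  simp [Ends, steps]

theorem ends_succ {n : ℕ} {γ : Config} {Q : Store → Prop} :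
    Ends (n + 1) γ Q ↔ ∀ γ' ∈ (step γ).support, Ends n γ' Q := by
  simp only [Ends, steps, PMF.mem_support_bind_iff]
  exact ⟨fun h γ' h1 γ'' h2 => h γ'' ⟨γ', h1, h2⟩, fun h γ'' ⟨γ', h1, h2⟩ => h γ' h1 γ'' h2⟩

theorem steps_halted (n : ℕ) (σ : Store) : steps n ⟨[], σ⟩ = PMF.pure ⟨[], σ⟩ := by
  induction n with
  | zero => rfl
  | succ n ih => rw [steps, step, PMF.pure_bind, ih]

theorem ends_halted {n : ℕ} {σ : Store} {Q : Store → Prop} : Ends n ⟨[], σ⟩ Q ↔ Q σ := by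
  simp [Ends, steps_halted]

theorem steps_add (n m : ℕ) (γ : Config) : steps (n + m) γ = (steps n γ).bind (steps m) := by
  induction n generalizing γ with
  | zero => simp [steps]
  | succ n ih =>
    rw [Nat.add_right_comm, steps, steps, PMF.bind_bind]
    congr 1
    funext γ'
    exact ih γ'

/-- A halted configuration is a fixed point of `step`, so extra time changes nothing; this is what
allows all time bounds to be rounded up. -/
theorem Ends.steps_eq {n m : ℕ} {γ : Config} {Q : Store → Prop} (h : Ends n γ Q) (hnm : n ≤ m) :
    steps m γ = steps n γ := by
  obtain ⟨k, rfl⟩ := Nat.exists_eq_add_of_le hnm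
  rw [steps_add, PMF.bind_congr_support (g := PMF.pure), PMF.bind_pure]
  rintro ⟨L, σ⟩ hγ
  obtain rfl : L = [] := (h _ hγ).1
  exact steps_halted k σ

theorem Ends.mono_time {n m : ℕ} {γ : Config} {Q : Store → Prop} (h : Ends n γ Q) (hnm : n ≤ m) :
    Ends m γ Q := by
  rw [Ends, h.steps_eq hnm]
  exact h

theorem Ends.mono {n : ℕ} {γ : Config} {Q R : Store → Prop} (h : Ends n γ Q)
    (hQ : ∀ σ, Q σ → R σ) : Ends n γ R :=
  fun γ' h' => ⟨(h γ' h').1, hQ _ (h γ' h').2⟩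

/-- The configuration with further programs to be executed afterwards. -/
def Config.append (K : List Prog) (γ : Config) : Config := ⟨γ.todo ++ K, γ.store⟩

/-- A step looks only at the first program of the list, so whatever is scheduled behind it is
carried along unchanged. -/
theorem step_append (c : Prog) (L K : List Prog) (σ : Store) :
    step ⟨c :: L ++ K, σ⟩ = (step ⟨c :: L, σ⟩).map (Config.append K) := by
  cases c with
  | branch x c₁ c₂ => simp [step, Config.append, PMF.pure_map]
  | loop x c =>
    simp only [step, Config.append, PMF.pure_map, List.cons_append]
    split <;> simp
  | toss x =>
    simp only [step, PMF.map_comp, List.cons_append]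
    rfl
  | _ => simp [step, Config.append, PMF.pure_map]

/-- `n` steps suffice to halt, and the truth value of variable `0` is then distributed as `ν`. -/
def Yields (n : ℕ) (γ : Config) (ν : PMF Bool) : Prop :=
  Ends n γ (fun _ => True) ∧ (steps n γ).map (fun γ' => (γ'.store 0).toBool) = ν

theorem Yields.mono_time {n m : ℕ} {γ : Config} {ν : PMF Bool} (h : Yields n γ ν) (hnm : n ≤ m) :
    Yields m γ ν :=
  ⟨h.1.mono_time hnm, by rw [h.1.steps_eq hnm]; exact h.2⟩

theorem Yields.of_step {n : ℕ} {γ : Config} {ν : Config → PMF Bool}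
    (h : ∀ γ' ∈ (step γ).support, Yields n γ' (ν γ')) : Yields (n + 1) γ ((step γ).bind ν) := by
  refine ⟨ends_succ.2 fun γ' h' => (h γ' h').1, ?_⟩
  rw [steps, PMF.map_bind]
  exact PMF.bind_congr_support _ fun γ' h' => (h γ' h').2

/-- Executing first `γ` and then `K`, when the final distribution of `K` depends only on a statistic
`f` of the store. -/
theorem Yields.append {β : Type*} {n m : ℕ} {γ : Config} {K : List Prog} {R : Store → Prop}
    (f : Store → β) {ν : β → PMF Bool} (h : Ends n γ R)
    (hK : ∀ σ, R σ → Yields m ⟨K, σ⟩ (ν (f σ))) :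
    Yields (n + m) (γ.append K) (((steps n γ).map (fun γ' => f γ'.store)).bind ν) := by
  induction n generalizing γ with
  | zero =>
    obtain ⟨L, σ⟩ := γ
    obtain ⟨hL, hR⟩ := ends_zero.1 h
    obtain rfl : L = [] := hL
    simpa [steps, PMF.pure_map, Config.append] using hK σ hR
  | succ n ih =>
    obtain ⟨L, σ⟩ := γ
    cases L with
    | nil =>
      rw [steps_halted, PMF.pure_map, PMF.pure_bind]
      exact (hK σ (ends_halted.1 h)).mono_time (by omega)
    | cons c L =>
      rw [ends_succ] at h
      -- Here the answer is described by the remaining computation itself; the induction hypothesis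
      -- identifies it afterwards.
      have h1 : Yields (n + m + 1) (Config.append K ⟨c :: L, σ⟩)
          ((step (Config.append K ⟨c :: L, σ⟩)).bind fun γ' =>
            (steps (n + m) γ').map (fun γ' => (γ'.store 0).toBool)) := by
        refine Yields.of_step fun γ' h' => ⟨?_, rfl⟩
        change γ' ∈ (step ⟨c :: L ++ K, σ⟩).support at h'
        rw [step_append, PMF.mem_support_map_iff] at h'
        obtain ⟨γ'', h'', rfl⟩ := h'
        exact (ih (h γ'' h'')).1
      rw [Nat.add_right_comm]
      convert h1 using 1
      change _ = (step ⟨c :: L ++ K, σ⟩).bind _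
      rw [step_append, steps, PMF.map_bind, PMF.bind_bind, PMF.bind_map]
      exact PMF.bind_congr_support _ fun γ' h' => ((ih (h γ' h')).2).symm

theorem Yields.append_const {n m : ℕ} {γ : Config} {K : List Prog} {R : Store → Prop}
    {ν : PMF Bool} (h : Ends n γ R) (hK : ∀ σ, R σ → Yields m ⟨K, σ⟩ ν) :
    Yields (n + m) (γ.append K) ν := by
  simpa using Yields.append (fun _ => ()) (ν := fun _ => ν) h hK

theorem Ends.append {n m : ℕ} {γ : Config} {K : List Prog} {Q R : Store → Prop}
    (h : Ends n γ R) (hK : ∀ σ, R σ → Ends m ⟨K, σ⟩ Q) : Ends (n + m) (γ.append K) Q := by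
  induction n generalizing γ with
  | zero =>
    obtain ⟨L, σ⟩ := γ
    obtain ⟨hL, hR⟩ := ends_zero.1 h
    obtain rfl : L = [] := hL
    simpa [Config.append] using hK σ hR
  | succ n ih =>
    obtain ⟨L, σ⟩ := γ
    cases L with
    | nil => exact (hK σ (ends_halted.1 h)).mono_time (by omega)
    | cons c L =>
      rw [ends_succ] at h
      rw [Nat.add_right_comm, ends_succ]
      intro γ' h'
      change γ' ∈ (step ⟨c :: L ++ K, σ⟩).support at h'
      rw [step_append, PMF.mem_support_map_iff] at h'
      obtain ⟨γ'', h'', rfl⟩ := h'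
      exact ih (h γ'' h'')

/-! ### Renaming of variables -/

/-- The program with its variables renamed. -/
def rename (ρ : ℕ → ℕ) : Prog → Prog
  | setNil x => setNil (ρ x)
  | copy x y => copy (ρ x) (ρ y)
  | cons x y z => cons (ρ x) (ρ y) (ρ z)
  | hd x y => hd (ρ x) (ρ y)
  | tl x y => tl (ρ x) (ρ y)
  | toss x => toss (ρ x)
  | seq c₁ c₂ => seq (rename ρ c₁) (rename ρ c₂)
  | branch x c₁ c₂ => branch (ρ x) (rename ρ c₁) (rename ρ c₂)
  | loop x c => loop (ρ x) (rename ρ c)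

/-- The configuration with its variables renamed, inside the store `τ`. -/
noncomputable def Config.rename (ρ : ℕ → ℕ) (τ : Store) (γ : Config) : Config :=
  ⟨γ.todo.map (Prog.rename ρ), Function.extend ρ γ.store τ⟩

theorem update_extend {ρ : ℕ → ℕ} (hρ : Function.Injective ρ) (σ τ : Store) (x : ℕ) (v : BinTree) :
    Function.update (Function.extend ρ σ τ) (ρ x) v =
      Function.extend ρ (Function.update σ x v) τ := by
  funext i
  by_cases hi : ∃ j, ρ j = i
  · obtain ⟨j, rfl⟩ := hi
    rw [hρ.extend_apply]
    by_cases hj : j = x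
    · subst hj; simp
    · rw [Function.update_of_ne (fun h => hj (hρ h)), Function.update_of_ne hj, hρ.extend_apply]
  · rw [Function.update_of_ne (fun h => hi ⟨x, h.symm⟩), Function.extend_apply' _ _ _ hi,
      Function.extend_apply' _ _ _ hi]

/-- Injectivity keeps different variables apart, and variables outside the range of `ρ` are never
touched: they keep their values in `τ`. -/
theorem step_rename {ρ : ℕ → ℕ} (hρ : Function.Injective ρ) (τ : Store) (γ : Config) :
    step (γ.rename ρ τ) = (step γ).map (Config.rename ρ τ) := by
  obtain ⟨L, σ⟩ := γ
  cases L with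
  | nil => simp [step, Config.rename, PMF.pure_map]
  | cons c L =>
    cases c with
    | toss x =>
      simp only [step, Config.rename, PMF.map_comp, List.map_cons, rename, update_extend hρ]
      rfl
    | branch x c₁ c₂ =>
      simp only [step, Config.rename, PMF.pure_map, List.map_cons, rename, hρ.extend_apply]
      split <;> rfl
    | loop x c =>
      simp only [step, Config.rename, PMF.pure_map, List.map_cons, rename, hρ.extend_apply]
      split <;> rfl
    | _ =>
      simp only [step, Config.rename, PMF.pure_map, List.map_cons, rename, update_extend hρ,
        hρ.extend_apply]

theorem steps_rename {ρ : ℕ → ℕ} (hρ : Function.Injective ρ) (τ : Store) (n : ℕ) (γ : Config) :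
    steps n (γ.rename ρ τ) = (steps n γ).map (Config.rename ρ τ) := by
  induction n generalizing γ with
  | zero => simp [steps, PMF.pure_map]
  | succ n ih =>
    rw [steps, steps, step_rename hρ, PMF.bind_map, PMF.map_bind]
    congr 1
    funext γ'
    exact ih γ'

theorem Ends.rename {ρ : ℕ → ℕ} (hρ : Function.Injective ρ) {τ : Store} {n : ℕ} {γ : Config}
    {Q : Store → Prop} (h : Ends n γ Q) :
    Ends n (γ.rename ρ τ) (fun σ' => ∃ σ, Q σ ∧ σ' = Function.extend ρ σ τ) := by
  intro γ' h'
  rw [steps_rename hρ, PMF.mem_support_map_iff] at h'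
  obtain ⟨γ'', h'', rfl⟩ := h'
  refine ⟨?_, γ''.store, (h _ h'').2, rfl⟩
  simp [Config.rename, (h _ h'').1]

/-! ### Rules for single programs -/

/-- Every execution of `c` from `σ` halts within `n` steps in a store that satisfies `Q`. -/
def Ensures (c : Prog) (n : ℕ) (σ : Store) (Q : Store → Prop) : Prop := Ends n ⟨[c], σ⟩ Q

theorem Ensures.mono {c : Prog} {n : ℕ} {σ : Store} {Q R : Store → Prop} (h : c.Ensures n σ Q)
    (hQ : ∀ σ, Q σ → R σ) : c.Ensures n σ R :=
  Ends.mono h hQ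

theorem Ensures.mono_time {c : Prog} {n m : ℕ} {σ : Store} {Q : Store → Prop}
    (h : c.Ensures n σ Q) (hnm : n ≤ m) : c.Ensures m σ Q :=
  Ends.mono_time h hnm

theorem Ensures.rename {ρ : ℕ → ℕ} (hρ : Function.Injective ρ) {c : Prog} {n : ℕ} {τ : Store}
    {Q : Store → Prop} (h : c.Ensures n (τ ∘ ρ) Q) :
    (c.rename ρ).Ensures n τ (fun σ' => ∃ σ, Q σ ∧ σ' = Function.extend ρ σ τ) := by
  have := Ends.rename hρ (τ := τ) h
  -- Reading a store through `ρ` and writing it back restores it, so the renamed program really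
  -- starts in `τ`.
  have h1 : Function.extend ρ (τ ∘ ρ) τ = τ := by
    funext i
    by_cases hi : ∃ j, ρ j = i
    · obtain ⟨j, rfl⟩ := hi
      rw [hρ.extend_apply, Function.comp]
    · rw [Function.extend_apply' _ _ _ hi]
  simpa [Ensures, Config.rename, h1] using this

theorem Ensures.seq {c₁ c₂ : Prog} {n m : ℕ} {σ : Store} {Q R : Store → Prop}
    (h : c₁.Ensures n σ R) (hK : ∀ σ', R σ' → c₂.Ensures m σ' Q) :
    (seq c₁ c₂).Ensures (n + m + 1) σ Q := by
  rw [Ensures, ends_succ]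
  intro γ' h'
  rw [step, PMF.support_pure, Set.mem_singleton_iff] at h'
  subst h'
  exact Ends.append (γ := ⟨[c₁], σ⟩) h hK

theorem ensures_setNil {x : ℕ} {σ : Store} {Q : Store → Prop}
    (h : Q (Function.update σ x .nil)) : (setNil x).Ensures 1 σ Q := by
  simpa [Ensures, ends_succ, step, ends_zero] using h

theorem ensures_copy {x y : ℕ} {σ : Store} {Q : Store → Prop}
    (h : Q (Function.update σ x (σ y))) : (copy x y).Ensures 1 σ Q := by
  simpa [Ensures, ends_succ, step, ends_zero] using h

theorem ensures_cons {x y z : ℕ} {σ : Store} {Q : Store → Prop}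
    (h : Q (Function.update σ x (.cons (σ y) (σ z)))) : (cons x y z).Ensures 1 σ Q := by
  simpa [Ensures, ends_succ, step, ends_zero] using h

theorem ensures_hd {x y : ℕ} {σ : Store} {Q : Store → Prop}
    (h : Q (Function.update σ x (σ y).hd)) : (hd x y).Ensures 1 σ Q := by
  simpa [Ensures, ends_succ, step, ends_zero] using h

theorem ensures_tl {x y : ℕ} {σ : Store} {Q : Store → Prop}
    (h : Q (Function.update σ x (σ y).tl)) : (tl x y).Ensures 1 σ Q := by
  simpa [Ensures, ends_succ, step, ends_zero] using h

theorem ensures_branch {x n : ℕ} {c₁ c₂ : Prog} {σ : Store} {Q : Store → Prop}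
    (h : (if (σ x).toBool then c₁ else c₂).Ensures n σ Q) :
    (branch x c₁ c₂).Ensures (n + 1) σ Q := by
  rw [Ensures, ends_succ]
  intro γ' h'
  rw [step, PMF.support_pure, Set.mem_singleton_iff] at h'
  subst h'
  exact h

end Prog

/-- The number of entries of a list. -/
def BinTree.len : BinTree → ℕ
  | nil => 0
  | cons _ r => r.len + 1

namespace Prog

/-- A loop that runs through the list in variable `x`. -/
theorem ensures_loop {x n : ℕ} {c : Prog} (I : BinTree → Store → Prop)
    (hx : ∀ l σ, I l σ → σ x = l)
    (hc : ∀ e l σ, I (.cons e l) σ → c.Ensures n σ (I l)) (l : BinTree) :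
    ∀ σ, I l σ → (loop x c).Ensures (l.len * (n + 1) + 1) σ (I .nil) := by
  induction l with
  | nil =>
    intro σ h
    rw [Ensures, ends_succ]
    intro γ' h'
    rw [step, PMF.support_pure, Set.mem_singleton_iff] at h'
    subst h'
    simpa [hx _ _ h, BinTree.toBool, ends_halted] using h
  | cons e l _ ih =>
    intro σ h
    rw [Ensures, ends_succ]
    intro γ' h'
    rw [step, PMF.support_pure, Set.mem_singleton_iff] at h'
    subst h'
    have h1 := Ends.append (γ := ⟨[c], σ⟩) (K := [loop x c]) (hc e l σ h) ih
    refine Ends.mono_time (n := n + (l.len * (n + 1) + 1)) ?_ (by rw [BinTree.len]; ring_nf; omega)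
    simpa [hx _ _ h, BinTree.toBool, Config.append] using h1

end Prog

/-! ### Functions on trees that are computable in polynomial time -/

theorem Polynomial.eval_le_eval_nat (p : Polynomial ℕ) {m n : ℕ} (h : m ≤ n) :
    p.eval m ≤ p.eval n := by
  induction p using Polynomial.induction_on' with
  | add p q hp hq => simpa using add_le_add hp hq
  | monomial k a => simpa using Nat.mul_le_mul_left a (Nat.pow_le_pow_left h k)

/-- `f` is computed, in time and with output size polynomial in the size of the argument, by a program
that reads its argument from variable `0` and leaves the value there, whatever the initial values of
its other variables. -/
def PolyTree (f : BinTree → BinTree) : Prop :=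
  ∃ (c : Prog) (p : Polynomial ℕ),
    (∀ σ, c.Ensures (p.eval (σ 0).size) σ (fun σ' => σ' 0 = f (σ 0))) ∧
    ∀ x, (f x).size ≤ p.eval x.size

namespace PolyTree

open Prog

/-- Frame rule: the renamed program computes `f` in place and changes no variable outside the range
of `ρ`. It applies in any store because `PolyTree` assumes nothing about the initial values of the
other variables. -/
theorem program {f : BinTree → BinTree} (hf : PolyTree f) :
    ∃ (c : Prog) (p : Polynomial ℕ),
      (∀ ρ : ℕ → ℕ, Function.Injective ρ → ∀ σ, (c.rename ρ).Ensures (p.eval (σ (ρ 0)).size) σ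
        (fun σ' => σ' (ρ 0) = f (σ (ρ 0)) ∧ ∀ i, (∀ j, ρ j ≠ i) → σ' i = σ i)) ∧
      ∀ x, (f x).size ≤ p.eval x.size := by
  obtain ⟨c, p, hc, hs⟩ := hf
  refine ⟨c, p, fun ρ hρ σ => ?_, hs⟩
  refine (Ensures.rename hρ (hc (σ ∘ ρ))).mono ?_
  rintro _ ⟨σ', h', rfl⟩
  refine ⟨by rw [hρ.extend_apply]; exact h', fun i hi => ?_⟩
  rw [Function.extend_apply' _ _ _ (fun ⟨j, hj⟩ => hi j hj)]

theorem id : PolyTree fun x => x :=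
  ⟨copy 0 0, Polynomial.X + 1, fun σ => (ensures_copy (by simp)).mono_time (by simp),
    fun x => by simp⟩

theorem hd : PolyTree BinTree.hd :=
  ⟨Prog.hd 0 0, Polynomial.X + 1, fun σ => (ensures_hd (by simp)).mono_time (by simp),
    fun x => by cases x <;> simp [BinTree.hd, BinTree.size]; omega⟩

theorem tl : PolyTree BinTree.tl :=
  ⟨Prog.tl 0 0, Polynomial.X + 1, fun σ => (ensures_tl (by simp)).mono_time (by simp),
    fun x => by cases x <;> simp [BinTree.tl, BinTree.size]; omega⟩

theorem nil : PolyTree fun _ => .nil :=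
  ⟨setNil 0, 1, fun σ => (ensures_setNil (by simp)).mono_time (by simp),
    fun x => by simp [BinTree.size]⟩

theorem comp {f g : BinTree → BinTree} (hg : PolyTree g) (hf : PolyTree f) :
    PolyTree fun x => g (f x) := by
  obtain ⟨c, p, hc, hp⟩ := hf
  obtain ⟨d, q, hd, hq⟩ := hg
  refine ⟨seq c d, p + q.comp p + 1, fun σ => ?_, fun x => ?_⟩
  · refine (Ensures.seq (hc σ) (m := q.eval (p.eval (σ 0).size)) fun σ' h' => ?_).mono_time
      (by simp)
    have := hd σ'
    rw [h'] at this
    exact this.mono_time (q.eval_le_eval_nat (hp _))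
  · have := (hq (f x)).trans (q.eval_le_eval_nat (hp x))
    simp only [Polynomial.eval_add, Polynomial.eval_comp, Polynomial.eval_one]
    omega

theorem cons {f g : BinTree → BinTree} (hf : PolyTree f) (hg : PolyTree g) :
    PolyTree fun x => .cons (f x) (g x) := by
  obtain ⟨c, p, hc, hp⟩ := hf.program
  obtain ⟨d, q, hd, hq⟩ := hg.program
  -- The two programs live in the odd and in the positive even variables, and variable 0 keeps the
  -- argument.
  have h1 : Function.Injective fun x => 2 * x + 1 := fun x y h => by simpa using h
  have h2 : Function.Injective fun x => 2 * x + 2 := fun x y h => by simpa using h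
  refine ⟨seq (copy 1 0) (seq (copy 2 0) (seq (c.rename fun x => 2 * x + 1)
    (seq (d.rename fun x => 2 * x + 2) (Prog.cons 0 1 2)))), p + q + 7, fun σ => ?_, fun x => ?_⟩
  · refine (Ensures.seq (ensures_copy (Q := (· = _)) rfl)
      (m := 1 + (p.eval (σ 0).size + (q.eval (σ 0).size + 1 + 1) + 1) + 1) ?_).mono_time
      (by simp; omega)
    rintro _ rfl
    refine Ensures.seq (ensures_copy (Q := (· = _)) rfl) ?_
    rintro _ rfl
    have hc' := hc _ h1 (Function.update (Function.update σ 1 (σ 0)) 2 (σ 0))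
    simp only [mul_zero, zero_add, ne_eq, not_false_eq_true, OfNat.one_ne_ofNat, zero_ne_one,
      Function.update_of_ne, Function.update_self] at hc' ⊢
    refine Ensures.seq (R := _) hc' ?_
    rintro σ₁ ⟨e1, r1⟩
    have hd' := hd _ h2 σ₁
    have e2 : σ₁ 2 = σ 0 := by rw [r1 2 (by omega)]; simp
    simp only [mul_zero, zero_add, e2] at hd'
    refine Ensures.seq (R := _) hd' ?_
    rintro σ₂ ⟨e3, r2⟩
    refine ensures_cons ?_
    rw [Function.update_self, e3, r2 1 (by omega), e1]
  · have := hp x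
    have := hq x
    simp only [Polynomial.eval_add, Polynomial.eval_ofNat, BinTree.size]
    omega

theorem ite {b f g : BinTree → BinTree} (hb : PolyTree b) (hf : PolyTree f) (hg : PolyTree g) :
    PolyTree fun x => if (b x).toBool then f x else g x := by
  obtain ⟨a, r, ha, -⟩ := hb.program
  obtain ⟨c, p, hc, hp⟩ := hf
  obtain ⟨d, q, hd, hq⟩ := hg
  have h1 : Function.Injective fun x => x + 1 := fun x y h => by simpa using h
  -- The test works in the variables from 1 on and preserves the argument in variable 0. The chosen
  -- branch needs no renaming, since nothing has to survive it.
  refine ⟨seq (copy 1 0) (seq (a.rename fun x => x + 1) (branch 1 c d)), p + q + r + 4,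
    fun σ => ?_, fun x => ?_⟩
  · refine (Ensures.seq (ensures_copy (Q := (· = _)) rfl)
      (m := r.eval (σ 0).size + (p.eval (σ 0).size + q.eval (σ 0).size + 1) + 1) ?_).mono_time
      (by simp; omega)
    rintro _ rfl
    have ha' := ha _ h1 (Function.update σ 1 (σ 0))
    simp only [zero_add, Function.update_self] at ha'
    refine Ensures.seq (R := _) ha' ?_
    rintro σ₁ ⟨e1, r1⟩
    have e0 : σ₁ 0 = σ 0 := by rw [r1 0 (by omega)]; simp
    refine ensures_branch (n := p.eval (σ 0).size + q.eval (σ 0).size) ?_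
    rw [e1]
    have hc' := hc σ₁
    have hd' := hd σ₁
    rw [e0] at hc' hd'
    by_cases hx : (b (σ 0)).toBool = true
    · simp only [hx, if_true]
      exact hc'.mono_time (Nat.le_add_right _ _)
    · simp only [hx, if_false, Bool.false_eq_true]
      exact hd'.mono_time (Nat.le_add_left _ _)
  · have := hp x
    have := hq x
    simp only [Polynomial.eval_add]
    split <;> omega

end PolyTree

/-! ### Iteration along lists -/

namespace BinTree

theorem len_le_size (l : BinTree) : l.len ≤ l.size := by
  induction l with
  | nil => simp [len]
  | cons e l _ ih => rw [len, size]; omega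

/-- Iteration along a list; the function is given the remaining list, too. -/
def sfold (G : BinTree → BinTree → BinTree) : BinTree → BinTree → BinTree
  | nil, s => s
  | cons e l, s => sfold G l (G (cons e l) s)

end BinTree

namespace PolyTree

open Prog

/-- Iteration along a list, provided that the state grows by a bounded amount in each round. -/
theorem sfold {lst init : BinTree → BinTree} {G : BinTree → BinTree → BinTree → BinTree}
    (hl : PolyTree lst) (hi : PolyTree init)
    (hG : PolyTree fun z => G z.hd z.tl.hd z.tl.tl) (q : Polynomial ℕ)
    (hq : ∀ x l s, (G x l s).size ≤ s.size + q.eval (x.size + l.size)) :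
    PolyTree fun x => BinTree.sfold (G x) (lst x) (init x) := by
  obtain ⟨a, r, ha, hr⟩ := hl.program
  obtain ⟨c, p, hc, hp⟩ := hi.program
  obtain ⟨d, w, hd, -⟩ := hG.program
  -- The residues 1, 2, 3 modulo 4 serve the programs for the list, the initial state and one round.
  -- Of the multiples of 4, variable 0 holds the argument, 4 the remaining list, 8 the state, and 12
  -- is scratch.
  have h1 : Function.Injective fun x => 4 * x + 1 := fun x y h => by simpa using h
  have h2 : Function.Injective fun x => 4 * x + 2 := fun x y h => by simpa using h
  have h3 : Function.Injective fun x => 4 * x + 3 := fun x y h => by simpa using h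
  let body : Prog := seq (Prog.cons 12 4 8) (seq (Prog.cons 3 0 12)
    (seq (d.rename fun x => 4 * x + 3) (seq (copy 8 3) (Prog.tl 4 4))))
  -- A bound for the state at all times: its initial size, plus the largest possible growth in each
  -- of at most `r` rounds.
  let B : Polynomial ℕ := p + r * q.comp (Polynomial.X + r)
  let tb : Polynomial ℕ := w.comp (Polynomial.X + r + B + 2) + 8
  refine ⟨seq (copy 1 0) (seq (copy 2 0) (seq (a.rename fun x => 4 * x + 1)
    (seq (c.rename fun x => 4 * x + 2) (seq (copy 4 1) (seq (copy 8 2)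
    (seq (loop 4 body) (copy 0 8))))))), r + p + r * (tb + 1) + B + 20, fun σ => ?_, fun x => ?_⟩
  · set n := (σ 0).size with hn
    have hloop : ∀ σ', σ' 0 = σ 0 → σ' 4 = lst (σ 0) → σ' 8 = init (σ 0) →
        (loop 4 body).Ensures (r.eval n * (tb.eval n + 1) + 1) σ' (fun σ'' =>
          σ'' 8 = BinTree.sfold (G (σ 0)) (lst (σ 0)) (init (σ 0))) := by
      intro σ' e0 e4 e8
      -- The last clause charges in advance the growth in all rounds still to come, so each round
      -- pays from its own share.
      let I : BinTree → Store → Prop := fun l τ => τ 0 = σ 0 ∧ τ 4 = l ∧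
        BinTree.sfold (G (σ 0)) l (τ 8) = BinTree.sfold (G (σ 0)) (lst (σ 0)) (init (σ 0)) ∧
        l.size ≤ r.eval n ∧ (τ 8).size + l.len * q.eval (n + r.eval n) ≤ B.eval n
      have hlen : (lst (σ 0)).len ≤ r.eval n := (BinTree.len_le_size _).trans (hr _)
      have hI := ensures_loop (x := 4) (n := tb.eval n) (c := body) I
        (fun l τ h => h.2.1) (fun e l τ => ?_) (lst (σ 0)) σ' ⟨e0, e4, by rw [e8], hr _, ?_⟩
      · refine (hI.mono fun τ h => h.2.2.1).mono_time ?_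
        gcongr
      · rintro ⟨t0, t4, t8, tl, tb'⟩
        have hsz : l.size ≤ r.eval n := by rw [BinTree.size] at tl; omega
        have hB : (τ 8).size ≤ B.eval n := by omega
        refine (Ensures.seq (ensures_cons (Q := (· = _)) rfl)
          (m := 1 + (w.eval (n + r.eval n + B.eval n + 2) + (1 + 1 + 1) + 1) + 1) ?_).mono_time
          (by simp [tb]; omega)
        rintro _ rfl
        refine Ensures.seq (ensures_cons (Q := (· = _)) rfl) ?_
        rintro _ rfl
        have hd' := hd _ h3 (Function.update (Function.update τ 12 ((τ 4).cons (τ 8))) 3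
          ((σ 0).cons ((τ 4).cons (τ 8))))
        simp only [mul_zero, zero_add, Function.update_self, BinTree.hd, BinTree.tl] at hd'
        simp only [ne_eq, OfNat.zero_ne_ofNat, not_false_eq_true, Function.update_of_ne,
          Function.update_self, t0]
        refine Ensures.seq (R := _) (hd'.mono_time (w.eval_le_eval_nat ?_)) ?_
        · rw [t4]
          simp only [BinTree.size] at tl ⊢
          omega
        rintro σ₁ ⟨f3, fr⟩
        have f0 : σ₁ 0 = σ 0 := by rw [fr 0 (by omega)]; simpa using t0
        have f4 : σ₁ 4 = τ 4 := by rw [fr 4 (by omega)]; simp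
        refine Ensures.seq (n := 1) (m := 1) (ensures_copy (Q := (· = _)) rfl) ?_
        rintro _ rfl
        refine ensures_tl ⟨?_, ?_, ?_, hsz, ?_⟩
        · simpa using f0
        · simp [f4, t4, BinTree.tl]
        · rw [Function.update_of_ne (by decide), Function.update_self, f3, ← t8, t4]
          rfl
        · rw [Function.update_of_ne (by decide), Function.update_self, f3, t4]
          have h4 := hq (σ 0) (BinTree.cons e l) (τ 8)
          rw [← hn] at h4
          have h5 := q.eval_le_eval_nat (Nat.add_le_add_left tl n)
          rw [BinTree.len, add_mul, one_mul] at tb'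
          omega
      · rw [e8]
        simp only [B, Polynomial.eval_add, Polynomial.eval_mul, Polynomial.eval_comp,
          Polynomial.eval_X]
        exact add_le_add (hp _) (Nat.mul_le_mul_right _ hlen)
    refine (Ensures.seq (ensures_copy (Q := (· = _)) rfl)
      (m := 1 + (r.eval n + (p.eval n + (1 + (1 + (r.eval n * (tb.eval n + 1) + 1 + 1 + 1) + 1) + 1)
        + 1) + 1) + 1) ?_).mono_time (by simp; omega)
    rintro _ rfl
    refine Ensures.seq (ensures_copy (Q := (· = _)) rfl) ?_
    rintro _ rfl
    have ha' := ha _ h1 (Function.update (Function.update σ 1 (σ 0)) 2 (σ 0))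
    simp only [mul_zero, zero_add, ne_eq, OfNat.one_ne_ofNat, not_false_eq_true,
      Function.update_of_ne, Function.update_self] at ha'
    simp only [ne_eq, not_false_eq_true, zero_ne_one, Function.update_of_ne]
    refine Ensures.seq (R := _) ha' ?_
    rintro σ₁ ⟨e1, r1⟩
    have g0 : σ₁ 0 = σ 0 := by rw [r1 0 (by omega)]; simp
    have g2 : σ₁ 2 = σ 0 := by rw [r1 2 (by omega)]; simp
    have hc' := hc _ h2 σ₁
    simp only [mul_zero, zero_add, g2] at hc'
    refine Ensures.seq (R := _) hc' ?_
    rintro σ₂ ⟨e2, r2⟩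
    refine Ensures.seq (ensures_copy (Q := (· = _)) rfl) ?_
    rintro _ rfl
    refine Ensures.seq (ensures_copy (Q := (· = _)) rfl) ?_
    rintro _ rfl
    refine Ensures.seq (R := _) (m := 1) (hloop _ ?_ ?_ ?_) ?_
    · simp [r2 0 (by omega), g0]
    · simp [r2 1 (by omega), e1]
    · simp [e2]
    · intro σ₃ e3
      exact ensures_copy (by simpa using e3)
  · have key : ∀ l s, l.size ≤ r.eval x.size →
        (BinTree.sfold (G x) l s).size ≤ s.size + l.len * q.eval (x.size + r.eval x.size) := by
      intro l
      induction l with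
      | nil => intro s _; simp [BinTree.sfold]
      | cons e l _ ih =>
        intro s hs
        have h5 := q.eval_le_eval_nat (Nat.add_le_add_left hs x.size)
        have h4 := hq x (BinTree.cons e l) s
        have h6 := ih (G x (BinTree.cons e l) s) (by rw [BinTree.size] at hs; omega)
        rw [BinTree.sfold, BinTree.len, add_mul, one_mul]
        omega
    have h7 := key (lst x) (init x) (hr x)
    have h8 := hp x
    have h9 := Nat.mul_le_mul_right (q.eval (x.size + r.eval x.size))
      ((BinTree.len_le_size _).trans (hr x))
    simp only [B, Polynomial.eval_add, Polynomial.eval_mul, Polynomial.eval_comp,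
      Polynomial.eval_X]
    omega

end PolyTree

/-! ### Unary numbers, lists and tables -/

namespace BinTree

theorem ofNat_zero : ofNat 0 = nil := rfl

theorem ofNat_succ (n : ℕ) : ofNat (n + 1) = cons nil (ofNat n) := rfl

@[simp] theorem size_ofNat (n : ℕ) : (ofNat n).size = n := by
  induction n with
  | zero => rfl
  | succ n ih => rw [ofNat_succ, size, ih, size, zero_add]

@[simp] theorem len_ofNat (n : ℕ) : (ofNat n).len = n := by
  induction n with
  | zero => rfl
  | succ n ih => rw [ofNat_succ, len, ih]

@[simp] theorem toBool_ofBool (b : Bool) : (ofBool b).toBool = b := by cases b <;> rfl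

theorem size_ofBool_le (b : Bool) : (ofBool b).size ≤ 1 := by cases b <;> simp [ofBool, size]

@[simp] theorem toBool_ofNat (n : ℕ) : (ofNat n).toBool = decide (0 < n) := by
  cases n <;> simp [ofNat_zero, ofNat_succ, toBool]

/-- The entry with number `i` of a list (`nil` beyond the end). -/
def get (t : BinTree) (i : ℕ) : BinTree := (tl^[i] t).hd

theorem size_tl_le (t : BinTree) : t.tl.size ≤ t.size := by
  cases t <;> simp [tl, size]; omega

theorem get_ofList (L : List BinTree) (i : ℕ) : (ofList L).get i = L.getD i nil := by
  induction L generalizing i with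
  | nil =>
    have : ∀ i, tl^[i] nil = nil := fun i => Function.iterate_fixed rfl i
    simp [get, ofList, this, hd]
  | cons a L ih =>
    cases i with
    | zero => simp [get, ofList, hd]
    | succ i => simpa [get, ofList, tl] using ih i

theorem get_ofTable {n : ℕ} (f : Fin n → BinTree) (i : Fin n) : (ofTable f).get i = f i := by
  rw [ofTable, get_ofList]
  simp [List.getD_eq_getElem?_getD]

/-- The list `f 0, …, f (m - 1)`. -/
def tabulate (m : ℕ) (f : ℕ → BinTree) : BinTree := ofList ((List.range m).map f)

theorem tabulate_eq_ofTable (m : ℕ) (f : ℕ → BinTree) :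
    tabulate m f = ofTable fun i : Fin m => f i := by
  rw [tabulate, ofTable]
  congr 1
  apply List.ext_getElem <;> simp

theorem get_tabulate {m i : ℕ} (f : ℕ → BinTree) (hi : i < m) : (tabulate m f).get i = f i := by
  rw [tabulate_eq_ofTable, get_ofTable _ (⟨i, hi⟩ : Fin m)]

theorem size_ofList_le {L : List BinTree} {b : ℕ} (h : ∀ t ∈ L, t.size ≤ b) :
    (ofList L).size ≤ L.length * (b + 1) := by
  induction L with
  | nil => simp [ofList, size]
  | cons a L ih =>
    have h1 := h a (by simp)
    have h2 := ih fun t ht => h t (by simp [ht])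
    rw [ofList, size, List.length_cons, add_mul, one_mul]
    omega

theorem size_tabulate_le {m b : ℕ} {f : ℕ → BinTree} (h : ∀ i < m, (f i).size ≤ b) :
    (tabulate m f).size ≤ m * (b + 1) := by
  simpa [tabulate] using size_ofList_le (L := (List.range m).map f) (b := b) (by simpa using h)

/-- During a fold along unary m the length of the remaining tail runs through m - 1, …, 0. It serves
as the index, and putting entries in front yields increasing order. -/
theorem tabulate_sfold (m : ℕ) (f : ℕ → BinTree) :
    sfold (fun l s => cons (f l.tl.len) s) (ofNat m) nil = tabulate m f := by
  suffices h : ∀ L, sfold (fun l s => cons (f l.tl.len) s) (ofNat m) (ofList L) =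
      ofList ((List.range m).map f ++ L) by simpa [ofList, tabulate] using h []
  induction m with
  | zero => intro L; simp [ofNat_zero, sfold]
  | succ m ih =>
    intro L
    have := ih (f m :: L)
    rw [ofList] at this
    rw [ofNat_succ, sfold, tl, len_ofNat, this, List.range_succ]
    simp

theorem sfold_const (g : BinTree → BinTree) (l s : BinTree) :
    sfold (fun _ s => g s) l s = g^[l.len] s := by
  induction l generalizing s with
  | nil => rfl
  | cons e l _ ih => rw [sfold, ih, len, Function.iterate_succ_apply]

end BinTree

/-! ### Arithmetic and logic in polynomial time -/

open BinTree

theorem PolyTree.of_eq {f g : BinTree → BinTree} (hf : PolyTree f) (h : ∀ x, f x = g x) :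
    PolyTree g := by
  rwa [← funext h]

theorem PolyTree.size_le {f : BinTree → BinTree} (hf : PolyTree f) :
    ∃ p : Polynomial ℕ, ∀ x, (f x).size ≤ p.eval x.size :=
  let ⟨_, p, _, hp⟩ := hf
  ⟨p, hp⟩

/-- A number computable in polynomial time. -/
def PolyNat (f : BinTree → ℕ) : Prop := PolyTree fun x => ofNat (f x)

/-- A truth value computable in polynomial time. -/
def PolyBool (f : BinTree → Bool) : Prop := PolyTree fun x => ofBool (f x)

theorem PolyBool.of_eq {f g : BinTree → Bool} (hf : PolyBool f) (h : ∀ x, f x = g x) :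
    PolyBool g := by
  rwa [← funext h]

namespace PolyTree

theorem toBool {f : BinTree → BinTree} (hf : PolyTree f) : PolyBool fun x => (f x).toBool := by
  have := hf.ite (nil.cons nil) nil
  refine PolyTree.of_eq this fun x => ?_
  beta_reduce
  cases (f x).toBool <;> simp [ofBool]

theorem cond {b : BinTree → Bool} {f g : BinTree → BinTree} (hb : PolyBool b) (hf : PolyTree f)
    (hg : PolyTree g) : PolyTree fun x => bif b x then f x else g x := by
  refine PolyTree.of_eq (ite hb hf hg) fun x => ?_
  simp only [toBool_ofBool]
  cases b x <;> rfl

theorem iterate {m : BinTree → ℕ} {init : BinTree → BinTree} {G : BinTree → BinTree → BinTree}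
    (hm : PolyNat m) (hi : PolyTree init) (hG : PolyTree fun z => G z.hd z.tl)
    (q : Polynomial ℕ) (hq : ∀ x s, (G x s).size ≤ s.size + q.eval x.size) :
    PolyTree fun x => (G x)^[m x] (init x) := by
  have := sfold (G := fun x _ s => G x s) hm hi (hG.comp (hd.cons (tl.comp tl))) q
    (fun x l s => (hq x s).trans (by gcongr; exact q.eval_le_eval_nat (by omega)))
  simpa only [sfold_const, len_ofNat] using this

theorem len {f : BinTree → BinTree} (hf : PolyTree f) : PolyNat fun x => (f x).len := by
  have := sfold (G := fun _ _ s => .cons .nil s) hf nil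
    (nil.cons (tl.comp tl)) 1 (fun x l s => by simp [size])
  refine PolyTree.of_eq this fun x => ?_
  beta_reduce
  rw [sfold_const]
  generalize (f x).len = n
  induction n with
  | zero => rfl
  | succ n ih => rw [Function.iterate_succ_apply', ih, ofNat_succ]

/-- The hypothesis on `f` is computability on pairs: the first component is the environment, and the
length of the second is the index. All binders below use this convention. -/
theorem tabulate {m : BinTree → ℕ} {f : BinTree → ℕ → BinTree} (hm : PolyNat m)
    (hf : PolyTree fun z => f z.hd z.tl.len) : PolyTree fun x => .tabulate (m x) (f x) := by
  obtain ⟨p, hp⟩ := hf.size_le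
  have := sfold (G := fun x l s => .cons (f x l.tl.len) s) hm nil
    ((hf.comp (hd.cons (tl.comp (hd.comp tl)))).cons (tl.comp tl))
    (p.comp (Polynomial.X + 1) + 1) (fun x l s => ?_)
  · simpa only [tabulate_sfold] using this
  · have h1 := hp (.cons x l.tl)
    have h2 := p.eval_le_eval_nat (m := (BinTree.cons x l.tl).size) (n := x.size + l.size + 1)
      (by rw [size]; have := size_tl_le l; omega)
    change (f x l.tl.len).size ≤ _ at h1
    simp only [size, Polynomial.eval_add, Polynomial.eval_comp, Polynomial.eval_X,
      Polynomial.eval_one]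
    omega

theorem get {f : BinTree → BinTree} {i : BinTree → ℕ} (hf : PolyTree f) (hi : PolyNat i) :
    PolyTree fun x => (f x).get (i x) :=
  hd.comp (iterate (G := fun _ s => s.tl) hi hf (tl.comp tl) 0 fun x s => by simpa using size_tl_le s)

end PolyTree

namespace PolyNat

theorem comp {f : BinTree → ℕ} {g : BinTree → BinTree} (hf : PolyNat f) (hg : PolyTree g) :
    PolyNat fun x => f (g x) := PolyTree.comp hf hg

theorem le_poly {f : BinTree → ℕ} (hf : PolyNat f) :
    ∃ p : Polynomial ℕ, ∀ x, f x ≤ p.eval x.size := by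
  simpa using PolyTree.size_le hf

theorem const (k : ℕ) : PolyNat fun _ => k := by
  induction k with
  | zero => exact PolyTree.nil
  | succ k ih => exact PolyTree.nil.cons ih

theorem succ {f : BinTree → ℕ} (hf : PolyNat f) : PolyNat fun x => f x + 1 := PolyTree.nil.cons hf

theorem add {f g : BinTree → ℕ} (hf : PolyNat f) (hg : PolyNat g) : PolyNat fun x => f x + g x := by
  have := PolyTree.iterate (G := fun _ s => .cons .nil s) hg hf (PolyTree.nil.cons PolyTree.tl) 1
    (fun x s => by simp [size])
  refine PolyTree.of_eq this fun x => ?_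
  beta_reduce
  induction g x with
  | zero => rfl
  | succ n ih => rw [Function.iterate_succ_apply', ih, ← add_assoc, ofNat_succ]

theorem sub {f g : BinTree → ℕ} (hf : PolyNat f) (hg : PolyNat g) : PolyNat fun x => f x - g x := by
  have := PolyTree.iterate (G := fun _ s => s.tl) hg hf (PolyTree.tl.comp PolyTree.tl) 0
    (fun x s => by simpa using size_tl_le s)
  refine PolyTree.of_eq this fun x => ?_
  beta_reduce
  induction g x with
  | zero => rfl
  | succ n ih =>
    rw [Function.iterate_succ_apply', ih, Nat.sub_succ]
    cases f x - n <;> rfl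

theorem mul {f g : BinTree → ℕ} (hf : PolyNat f) (hg : PolyNat g) : PolyNat fun x => f x * g x := by
  obtain ⟨p, hp⟩ := hf.le_poly
  have := PolyTree.iterate (G := fun x s => ofNat (s.len + f x)) hg PolyTree.nil
    (add PolyTree.tl.len (hf.comp PolyTree.hd)) p
    (fun x s => by simpa using add_le_add (len_le_size s) (hp x))
  refine PolyTree.of_eq this fun x => ?_
  beta_reduce
  induction g x with
  | zero => rfl
  | succ n ih => rw [Function.iterate_succ_apply', ih, len_ofNat, mul_add, mul_one]

theorem lt {f g : BinTree → ℕ} (hf : PolyNat f) (hg : PolyNat g) :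
    PolyBool fun x => decide (f x < g x) := by
  simpa using PolyTree.toBool (hg.sub hf)

theorem count {m : BinTree → ℕ} {P : BinTree → ℕ → Bool} (hm : PolyNat m)
    (hP : PolyBool fun z => P z.hd z.tl.len) : PolyNat fun x => (List.range (m x)).countP (P x) := by
  have := PolyTree.sfold (G := fun x l s => bif P x l.tl.len then .cons .nil s else s) hm PolyTree.nil
    (PolyTree.cond (PolyTree.comp hP (PolyTree.hd.cons
      (PolyTree.tl.comp (PolyTree.hd.comp PolyTree.tl))))
      (PolyTree.nil.cons (PolyTree.tl.comp PolyTree.tl)) (PolyTree.tl.comp PolyTree.tl)) 1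
    (fun x l s => by cases P x l.tl.len <;> simp [size])
  refine PolyTree.of_eq this fun x => ?_
  beta_reduce
  suffices h : ∀ m k, BinTree.sfold (fun l s => bif P x l.tl.len then .cons .nil s else s) (ofNat m)
      (ofNat k) = ofNat (k + (List.range m).countP (P x)) by
    simpa [ofNat_zero] using h (m x) 0
  intro m
  induction m with
  | zero => intro k; rfl
  | succ m ih =>
    intro k
    rw [ofNat_succ, BinTree.sfold, BinTree.tl, len_ofNat, List.range_succ, List.countP_append]
    cases h : P x m
    · simp [ih k, h]
    · have := ih (k + 1)
      rw [ofNat_succ] at this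
      simp only [cond_true, this, List.countP_singleton, h, if_true]
      ring_nf

end PolyNat

namespace PolyBool

theorem and {f g : BinTree → Bool} (hf : PolyBool f) (hg : PolyBool g) :
    PolyBool fun x => f x && g x := by
  refine PolyTree.of_eq (PolyTree.cond hf hg PolyTree.nil) fun x => ?_
  beta_reduce
  cases f x <;> rfl

theorem or {f g : BinTree → Bool} (hf : PolyBool f) (hg : PolyBool g) :
    PolyBool fun x => f x || g x := by
  refine PolyTree.of_eq
    (PolyTree.cond hf (PolyTree.nil.cons PolyTree.nil) hg) fun x => ?_
  beta_reduce
  cases f x <;> rfl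

theorem not {f : BinTree → Bool} (hf : PolyBool f) : PolyBool fun x => !f x := by
  refine PolyTree.of_eq
    (PolyTree.cond hf PolyTree.nil (PolyTree.nil.cons PolyTree.nil)) fun x => ?_
  beta_reduce
  cases f x <;> rfl

theorem eq {f g : BinTree → ℕ} (hf : PolyNat f) (hg : PolyNat g) :
    PolyBool fun x => decide (f x = g x) := by
  refine PolyBool.of_eq ((hf.lt hg).not.and (hg.lt hf).not) fun x => ?_
  rw [Bool.eq_iff_iff]
  simp
  omega

theorem any {m : BinTree → ℕ} {P : BinTree → ℕ → Bool} (hm : PolyNat m)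
    (hP : PolyBool fun z => P z.hd z.tl.len) : PolyBool fun x => (List.range (m x)).any (P x) := by
  refine PolyBool.of_eq ((PolyNat.const 0).lt (PolyNat.count hm hP)) fun x => ?_
  rw [Bool.eq_iff_iff]
  simp [List.countP_pos_iff]

end PolyBool

/-- Logarithm, rounded down, by repeated multiplication. -/
def logState (b n : ℕ) : ℕ → ℕ × ℕ
  | 0 => (1, 0)
  | i + 1 =>
    let s := logState b n i
    if s.1 * b ≤ n then (s.1 * b, s.2 + 1) else s

/-- Invariant: the first component is b to the power of the second and at most n; either every round
so far has multiplied, or the next product exceeds n. -/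
theorem logState_snd {b n : ℕ} (hb : 2 ≤ b) (hn : 1 ≤ n) : (logState b n n).2 = Nat.log b n := by
  have h : ∀ i, (logState b n i).1 = b ^ (logState b n i).2 ∧ (logState b n i).1 ≤ n ∧
      ((logState b n i).2 = i ∨ n < (logState b n i).1 * b) := by
    intro i
    induction i with
    | zero => simpa [logState] using hn
    | succ i ih =>
      obtain ⟨h1, h2, h3⟩ := ih
      rw [logState]
      split_ifs with h
      · refine ⟨by simp [h1, pow_succ], h, Or.inl ?_⟩
        simp only
        rcases h3 with h3 | h3 <;> omega
      · exact ⟨h1, h2, Or.inr (by omega)⟩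
  obtain ⟨h1, h2, h3⟩ := h n
  symm
  rw [Nat.log_eq_iff (Or.inr ⟨hb, by omega⟩), pow_succ, ← h1]
  refine ⟨h2, ?_⟩
  rcases h3 with h3 | h3
  -- If all n rounds had multiplied, then bⁿ ≤ n, which is impossible; so n rounds suffice.
  · have : n < b ^ n := Nat.lt_pow_self (by omega)
    rw [h3] at h1
    omega
  · exact h3

theorem PolyNat.log {b n : BinTree → ℕ} (hb : PolyNat b) (hn : PolyNat n) :
    PolyNat fun x => (logState (b x) (n x) (n x)).2 := by
  obtain ⟨p, hp⟩ := hn.le_poly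
  have h1 : PolyNat fun z => z.tl.hd.len := (PolyTree.hd.comp PolyTree.tl).len
  have h2 : PolyNat fun z => z.tl.tl.len := (PolyTree.tl.comp PolyTree.tl).len
  have h3 := h1.mul (hb.comp PolyTree.hd)
  have := PolyTree.iterate (init := fun _ => .cons (ofNat 1) (ofNat 0)) (G := fun x s =>
      bif !decide (n x < s.hd.len * b x) then
        .cons (ofNat (s.hd.len * b x)) (ofNat (s.tl.len + 1))
      else s) hn ((PolyNat.const 1).cons (PolyNat.const 0))
    (PolyTree.cond ((hn.comp PolyTree.hd).lt h3).not (PolyTree.cons h3 h2.succ) PolyTree.tl)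
    (p + 2) (fun x s => ?_)
  · refine PolyTree.of_eq (PolyTree.tl.comp this) fun x => ?_
    beta_reduce
    suffices h : ∀ i, (fun s : BinTree => bif !decide (n x < s.hd.len * b x) then
        BinTree.cons (ofNat (s.hd.len * b x)) (ofNat (s.tl.len + 1))
      else s)^[i] (.cons (ofNat 1) (ofNat 0)) =
        .cons (ofNat (logState (b x) (n x) i).1) (ofNat (logState (b x) (n x) i).2) by
      rw [h]; rfl
    intro i
    induction i with
    | zero => rfl
    | succ i ih =>
      rw [Function.iterate_succ_apply', ih, logState]
      simp only [BinTree.hd, BinTree.tl, len_ofNat]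
      by_cases h : (logState (b x) (n x) i).1 * b x ≤ n x
      · simp [h, Nat.not_lt.2 h]
      · simp [h, Nat.not_le.1 h]
  · have h4 : s.tl.len ≤ s.size := (len_le_size _).trans (size_tl_le s)
    have := hp x
    by_cases h : n x < s.hd.len * b x
    · simp [h]
    · simp only [h, decide_false, Bool.not_false, cond_true, size, size_ofNat,
        Polynomial.eval_add, Polynomial.eval_ofNat]
      omega

/-! ### Short cycles -/

namespace SimpleGraph.Walk

variable {V : Type*} {G : SimpleGraph V}

theorem exists_eq_append_cons {u v : V} (w : G.Walk u v) {d : G.Dart} (hd : d ∈ w.darts) :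
    ∃ (p : G.Walk u d.fst) (q : G.Walk d.snd v), w = p.append (cons d.adj q) := by
  induction w with
  | nil => simp at hd
  | @cons x y z h w ih =>
    rw [darts_cons, List.mem_cons] at hd
    rcases hd with rfl | hd
    · exact ⟨nil, w, rfl⟩
    · obtain ⟨p, q, rfl⟩ := ih hd
      exact ⟨cons h p, q, rfl⟩

/-- An edge on a closed trail is bridged by the remainder of the trail. -/
theorem IsTrail.exists_walk_of_mem_edges {u a b : V} {w : G.Walk u u} (hw : w.IsTrail)
    (h : s(a, b) ∈ w.edges) : ∃ p : G.Walk a b, p.length + 1 = w.length ∧ s(a, b) ∉ p.edges := by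
  obtain ⟨d, hd, hde⟩ := List.mem_map.1 h
  obtain ⟨p, q, rfl⟩ := w.exists_eq_append_cons hd
  have h1 : s(a, b) ∉ (q.append p).edges := by
    have := hw.edges_nodup
    rw [edges_append, edges_cons, List.nodup_middle, List.nodup_cons] at this
    rw [edges_append, List.mem_append, Or.comm, ← List.mem_append, ← hde]
    exact this.1
  have h2 : (q.append p).length + 1 = (p.append (cons d.adj q)).length := by
    simp only [length_append, length_cons]; omega
  -- The trail may traverse the edge in either direction; if it goes from a to b, the remainder has
  -- to be reversed.
  rcases Sym2.eq_iff.1 (show s(d.fst, d.snd) = s(a, b) from hde) with ⟨e1, e2⟩ | ⟨e1, e2⟩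
  · subst e1 e2
    exact ⟨(q.append p).reverse, by rwa [length_reverse],
      by rwa [edges_reverse, List.mem_reverse]⟩
  · subst e1 e2
    exact ⟨q.append p, h2, h1⟩

theorem IsCycle.exists_of_le {G' : SimpleGraph V} (h : G ≤ G') {u : V} {w : G.Walk u u}
    (hw : w.IsCycle) :
    ∃ w' : G'.Walk u u, w'.IsCycle ∧ w'.length = w.length ∧ w'.edges = w.edges :=
  ⟨w.mapLe h, (isCycle_mapLe h).2 hw, by simp, by simp⟩

/-- This is the recursion carried out by one round of breadth-first search towards `s`. -/
theorem exists_length_le_succ {v s : V} {i : ℕ} :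
    (∃ w : G.Walk v s, w.length ≤ i + 1) ↔
      (∃ w : G.Walk v s, w.length ≤ i) ∨ ∃ u, G.Adj v u ∧ ∃ w : G.Walk u s, w.length ≤ i := by
  constructor
  · rintro ⟨w, hw⟩
    cases w with
    | nil => exact Or.inl ⟨nil, by simp⟩
    | cons h w => exact Or.inr ⟨_, h, w, by simpa using hw⟩
  · rintro (⟨w, hw⟩ | ⟨u, h, w, hw⟩)
    · exact ⟨w, hw.trans (Nat.le_succ i)⟩
    · exact ⟨cons h w, by simpa using hw⟩

end SimpleGraph.Walk

namespace LabelCover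

open SimpleGraph

theorem supergraph_adj_inl_inr {I : LabelCover} {a : Fin I.nA} {b : Fin I.nB} :
    I.supergraph.Adj (.inl a) (.inr b) ↔ I.Edge a b := Iff.rfl

theorem mem_edges {I : LabelCover} {e : Fin I.nA × Fin I.nB} : e ∈ I.edges ↔ I.Edge e.1 e.2 := by
  simp [edges]

/-- A short cycle through an edge amounts to a short detour between its ends. This form is used for
counting cycles: a path avoiding the edge has distinct edges, each kept independently. -/
theorem onShortCycle_iff {I : LabelCover} {k : ℕ} {a : Fin I.nA} {b : Fin I.nB} :
    I.OnShortCycle k a b ↔ I.Edge a b ∧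
      ∃ w : I.supergraph.Walk (.inl a) (.inr b), w.IsPath ∧ w.length + 1 ≤ k ∧
        s(.inl a, .inr b) ∉ w.edges := by
  classical
  constructor
  · rintro ⟨v, w, hw, hk, he⟩
    refine ⟨w.adj_of_mem_edges he, ?_⟩
    obtain ⟨p, hp, hpe⟩ := hw.isTrail.exists_walk_of_mem_edges he
    refine ⟨p.bypass, p.bypass_isPath, ?_, fun h => hpe (p.edges_bypass_subset_edges h)⟩
    have := p.length_bypass_le_length
    omega
  · rintro ⟨h, w, hw, hk, he⟩
    refine ⟨.inr b, .cons (show I.supergraph.Adj (.inr b) (.inl a) from h) w,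
      Path.cons_isCycle ⟨w, hw⟩ _ (by rwa [Sym2.eq_swap]), by simpa using hk, ?_⟩
    rw [Walk.edges_cons, Sym2.eq_swap]
    exact List.mem_cons_self

/-- The form used by the algorithm: only a distance in the graph without the edge has to be tested,
and a walk can be shortened to a path. -/
theorem onShortCycle_iff_deleteEdges {I : LabelCover} {k : ℕ} {a : Fin I.nA} {b : Fin I.nB} :
    I.OnShortCycle k a b ↔ I.Edge a b ∧
      ∃ w : (I.supergraph.deleteEdges {s(.inl a, .inr b)}).Walk (.inl a) (.inr b),
        w.length ≤ k - 1 := by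
  classical
  rw [onShortCycle_iff]
  refine and_congr_right fun _ => ⟨?_, ?_⟩
  · rintro ⟨w, -, hk, he⟩
    refine ⟨w.toDeleteEdges _ fun e h h' => he (by rwa [Set.mem_singleton_iff.1 h'] at h), ?_⟩
    simp
    omega
  · rintro ⟨w, hw⟩
    have hle := deleteEdges_le (G := I.supergraph) {s(Sum.inl a, Sum.inr b)}
    -- The ends lie on different sides, so the walk is not empty. This excludes the truncated values
    -- of `k - 1` and gives `length + 1 ≤ k`.
    have h0 : w.length ≠ 0 := fun h => by simpa using Walk.eq_of_length_eq_zero h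
    have := w.length_bypass_le_length
    refine ⟨w.bypass.mapLe hle, (Walk.isPath_mapLe hle).2 w.bypass_isPath, ?_, ?_⟩
    · rw [Walk.length_mapLe]
      omega
    · rw [Walk.edges_mapLe_eq_edges]
      intro h
      simpa using Walk.edges_subset_edgeSet _ h

/-! ### Restrictions -/

theorem restrict_edge {I : LabelCover} {S : Finset (Fin I.nA × Fin I.nB)} {a : Fin I.nA}
    {b : Fin I.nB} : (I.restrict S).Edge a b ↔ I.Edge a b ∧ (a, b) ∈ S := by
  simp [Edge, restrict]

theorem restrict_supergraph_le (I : LabelCover) (S : Finset (Fin I.nA × Fin I.nB)) :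
    (I.restrict S).supergraph ≤ I.supergraph := by
  intro u v h
  rcases u with a | b <;> rcases v with a' | b'
  · exact h
  · exact (restrict_edge.1 h).1
  · exact (restrict_edge.1 h).1
  · exact h

/-- Supergirth larger than `k` means that no edge lies on a cycle of length at most `k`. -/
theorem lt_supergirth_iff {I : LabelCover} {k : ℕ} :
    (k : ℕ∞) < I.supergirth ↔ ∀ a b, ¬ I.OnShortCycle k a b := by
  constructor
  · rintro h a b ⟨v, w, hw, hk, -⟩
    have h1 := I.supergraph.egirth_le_length hw
    have h2 : (w.length : ℕ∞) ≤ k := by exact_mod_cast hk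
    exact absurd (h.trans_le (h1.trans h2)) (lt_irrefl _)
  · intro h
    rw [← not_le]
    intro h1
    have h2 : ¬ I.supergraph.IsAcyclic := by
      intro h2
      rw [supergirth, egirth_eq_top.2 h2] at h1
      simp at h1
    obtain ⟨v, w, hw, hl⟩ := exists_egirth_eq_length.2 h2
    have h3 : w.length ≤ k := by
      rw [supergirth, hl] at h1
      exact_mod_cast h1
    -- The first edge of a shortest cycle is an edge on a short cycle.
    cases w with
    | nil => exact hw.ne_nil rfl
    | @cons _ x _ h4 p =>
      rcases v with a | b <;> rcases x with a' | b'
      · exact h4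
      · exact h a b' ⟨_, _, hw, h3, by simp⟩
      · exact h a' b ⟨_, _, hw, h3, by simp [Sym2.eq_swap]⟩
      · exact h4

theorem OnShortCycle.mono {I : LabelCover} {S : Finset (Fin I.nA × Fin I.nB)} {k : ℕ}
    {a : Fin I.nA} {b : Fin I.nB} (h : (I.restrict S).OnShortCycle k a b) :
    I.OnShortCycle k a b := by
  obtain ⟨v, w, hw, hk, he⟩ := h
  obtain ⟨w', h1, h2, h3⟩ := Walk.IsCycle.exists_of_le (V := Fin I.nA ⊕ Fin I.nB)
    (I.restrict_supergraph_le S) hw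
  exact ⟨v, w', h1, h2.trans_le hk, h3 ▸ he⟩

theorem OnShortCycle.edge {I : LabelCover} {k : ℕ} {a : Fin I.nA} {b : Fin I.nB}
    (h : I.OnShortCycle k a b) : I.Edge a b := (onShortCycle_iff.1 h).1

theorem sparsify_rel {I : LabelCover} {k : ℕ} {S : Finset (Fin I.nA × Fin I.nB)} {a : Fin I.nA}
    {b : Fin I.nB} {x : Fin I.qA} {y : Fin I.qB} : (I.sparsify k S).rel a b x y = true ↔
      I.rel a b x y = true ∧ (a, b) ∈ S ∧ ¬ (I.restrict S).OnShortCycle k a b := by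
  classical
  have h1 : (I.sparsify k S).rel a b x y = true ↔ (I.rel a b x y && decide ((a, b) ∈ S)) = true ∧
      ((I.restrict S).Edge a b ∧ ¬ (I.restrict S).OnShortCycle k a b) := by
    refine (Bool.and_eq_true _ _).to_iff.trans (and_congr_right fun _ => ?_)
    exact decide_eq_true_iff.trans (Finset.mem_filter.trans (and_congr_left' mem_edges))
  rw [h1, Bool.and_eq_true, decide_eq_true_iff, restrict_edge]
  refine ⟨fun h => ⟨h.1.1, h.1.2, h.2.2⟩, fun h => ⟨⟨h.1, h.2.1⟩, ⟨⟨x, y, h.1⟩, h.2.1⟩, h.2.2⟩⟩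

theorem sparsify_edge {I : LabelCover} {k : ℕ} {S : Finset (Fin I.nA × Fin I.nB)} {a : Fin I.nA}
    {b : Fin I.nB} : (I.sparsify k S).Edge a b ↔
      I.Edge a b ∧ (a, b) ∈ S ∧ ¬ (I.restrict S).OnShortCycle k a b :=
  ⟨fun ⟨x, y, h⟩ => ⟨⟨x, y, (sparsify_rel.1 h).1⟩, (sparsify_rel.1 h).2⟩,
    fun ⟨⟨x, y, h⟩, h'⟩ => ⟨x, y, sparsify_rel.2 ⟨h, h'⟩⟩⟩

/-- A short cycle that survived would already be a short cycle before the removal, so its edges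
would have been removed. -/
theorem lt_supergirth_sparsify (I : LabelCover) (k : ℕ) (S : Finset (Fin I.nA × Fin I.nB)) :
    (k : ℕ∞) < (I.sparsify k S).supergirth :=
  lt_supergirth_iff.2 fun _ _ h => (sparsify_edge.1 h.edge).2.2 (OnShortCycle.mono h)

theorem sparsify_eq_restrict {I : LabelCover} {k : ℕ} {S T : Finset (Fin I.nA × Fin I.nB)}
    (h : ∀ a b, I.Edge a b → ((a, b) ∈ T ↔ (a, b) ∈ S ∧ ¬ (I.restrict S).OnShortCycle k a b)) :
    I.sparsify k S = I.restrict T := by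
  have h1 : ∀ (a : Fin I.nA) (b : Fin I.nB) (x : Fin I.qA) (y : Fin I.qB),
      (I.sparsify k S).rel a b x y = (I.restrict T).rel a b x y := by
    intro a b x y
    rw [Bool.eq_iff_iff, sparsify_rel]
    simp only [restrict, Bool.and_eq_true, decide_eq_true_iff]
    exact and_congr_right fun h2 => (h a b ⟨x, y, h2⟩).symm
  have h2 : (I.sparsify k S).rel = (I.restrict T).rel := by
    funext a b x y
    exact h1 a b x y
  exact congrArg (LabelCover.mk I.nA I.nB I.qA I.qB) h2

/-- Removing more cycles is a sparsification, too. -/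
theorem sparsify_eq_sparsify {I : LabelCover} {k l : ℕ} (hkl : k ≤ l)
    (S : Finset (Fin I.nA × Fin I.nB)) :
    I.sparsify l S = I.sparsify k (I.sparsify l S).edges := by
  have h1 : I.sparsify l S = I.restrict (I.sparsify l S).edges := by
    refine sparsify_eq_restrict fun a b h => ?_
    exact (mem_edges.trans sparsify_edge).trans ⟨fun h1 => h1.2, fun h1 => ⟨h, h1⟩⟩
  refine h1.trans (sparsify_eq_restrict fun a b _ => ⟨fun h2 => ⟨h2, ?_⟩, fun h2 => h2.1⟩).symm
  -- The result has supergirth larger than l ≥ k, so sparsifying it for k removes nothing.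
  have h3 := (Nat.cast_le.2 hkl).trans_lt (I.lt_supergirth_sparsify l S)
  generalize (I.sparsify l S).edges = T at h1
  rw [h1] at h3
  exact lt_supergirth_iff.1 h3 a b

theorem sparsify_edges_subset (I : LabelCover) (k : ℕ) (S : Finset (Fin I.nA × Fin I.nB)) :
    (I.sparsify k S).edges ⊆ I.edges := fun _ h =>
  mem_edges.2 (sparsify_edge.1 (mem_edges.1 h)).1

/-- A labeling that satisfies all edges is a REP-cover of every restriction. -/
theorem FullySatisfiable.repCoverAtMost {I : LabelCover} (h : I.FullySatisfiable) (k : ℕ)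
    (S : Finset (Fin I.nA × Fin I.nB)) : (I.sparsify k S).RepCoverAtMost I.order := by
  classical
  obtain ⟨f, g, hfg⟩ := h
  refine ⟨(Finset.univ.image fun a => Sum.inl (a, f a)) ∪
    (Finset.univ.image fun b => Sum.inr (b, g b)), ?_, ?_⟩
  · intro a b hab
    refine ⟨f a, g b, by simp, by simp, ?_⟩
    obtain ⟨h1, h2, h3⟩ := sparsify_edge.1 hab
    have h4 : (a, b) ∈ I.satisfied f g := by rw [hfg]; exact mem_edges.2 h1
    exact sparsify_rel.2 ⟨(Finset.mem_filter.1 h4).2, h2, h3⟩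
  · have h1 := Finset.card_union_le
      ((Finset.univ : Finset (Fin I.nA)).image fun a => (Sum.inl (a, f a) :
        (Fin I.nA × Fin I.qA) ⊕ (Fin I.nB × Fin I.qB)))
      ((Finset.univ : Finset (Fin I.nB)).image fun b => (Sum.inr (b, g b)))
    have h2 : ((Finset.univ : Finset (Fin I.nA)).image fun a => (Sum.inl (a, f a) :
        (Fin I.nA × Fin I.qA) ⊕ (Fin I.nB × Fin I.qB))).card ≤ I.nA := by
      simpa using Finset.card_image_le (s := (Finset.univ : Finset (Fin I.nA)))
    have h3 : ((Finset.univ : Finset (Fin I.nB)).image fun b => (Sum.inr (b, g b) :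
        (Fin I.nA × Fin I.qA) ⊕ (Fin I.nB × Fin I.qB))).card ≤ I.nB := by
      simpa using Finset.card_image_le (s := (Finset.univ : Finset (Fin I.nB)))
    rw [order]
    exact_mod_cast h1.trans (add_le_add h2 h3)

end LabelCover

/-! ### Random subsets -/

section Subsample

variable {V : Type*} [DecidableEq V] {F : Finset V} {p : ℝ}

/-- The expectation of `f S` for a random subset `S` of `F`. -/
noncomputable def subsampleExp (F : Finset V) (p : ℝ) (f : Finset V → ℝ) : ℝ :=
  ∑ S ∈ F.powerset, p ^ S.card * (1 - p) ^ (F \ S).card * f S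

/-- Independence: the expectation of a product over the elements factorizes, by expanding the
product of sums over all subsets. -/
theorem subsampleExp_prod (F : Finset V) (p : ℝ) (x y : V → ℝ) :
    subsampleExp F p (fun S => (∏ i ∈ S, x i) * ∏ i ∈ F \ S, y i) =
      ∏ i ∈ F, (p * x i + (1 - p) * y i) := by
  rw [Finset.prod_add, subsampleExp]
  refine Finset.sum_congr rfl fun S _ => ?_
  simp only [Finset.prod_mul_distrib, Finset.prod_const]
  ring

theorem subsampleExp_one (F : Finset V) (p : ℝ) : subsampleExp F p (fun _ => 1) = 1 := by
  simpa using subsampleExp_prod F p 1 1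

theorem subsampleExp_const_mul (c : ℝ) (f : Finset V → ℝ) :
    subsampleExp F p (fun S => c * f S) = c * subsampleExp F p f := by
  rw [subsampleExp, subsampleExp, Finset.mul_sum]
  exact Finset.sum_congr rfl fun S _ => by ring

theorem subsampleExp_add (f g : Finset V → ℝ) :
    subsampleExp F p (fun S => f S + g S) = subsampleExp F p f + subsampleExp F p g := by
  simp only [subsampleExp, mul_add, Finset.sum_add_distrib]

theorem subsampleExp_sum {ι : Type*} (s : Finset ι) (f : ι → Finset V → ℝ) :
    subsampleExp F p (fun S => ∑ i ∈ s, f i S) = ∑ i ∈ s, subsampleExp F p (f i) := by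
  simp only [subsampleExp, Finset.mul_sum]
  exact Finset.sum_comm

theorem subsampleExp_mono (h0 : 0 ≤ p) (h1 : p ≤ 1) {f g : Finset V → ℝ}
    (h : ∀ S ⊆ F, f S ≤ g S) : subsampleExp F p f ≤ subsampleExp F p g :=
  Finset.sum_le_sum fun S hS => mul_le_mul_of_nonneg_left (h S (Finset.mem_powerset.1 hS))
    (mul_nonneg (pow_nonneg h0 _) (pow_nonneg (sub_nonneg.2 h1) _))

theorem subsampleProb_eq_exp (P : Finset V → Prop) [DecidablePred P] :
    subsampleProb F p P = subsampleExp F p (fun S => if P S then 1 else 0) := by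
  rw [subsampleProb, subsampleExp, Finset.sum_filter]
  refine Finset.sum_congr (by ext; simp) fun S _ => ?_
  by_cases h : P S
  · simp only [h, if_true, mul_one]
    congr!
  · simp [h]

/-- The set contains `T` with probability `p ^ |T|`. -/
theorem subsampleExp_subset {T : Finset V} (hT : T ⊆ F) :
    subsampleExp F p (fun S => if T ⊆ S then 1 else 0) = p ^ T.card := by
  -- The factor 0 for an element of `T` that is not chosen turns the product into the indicator of
  -- `T ⊆ S`.
  have h := subsampleExp_prod F p 1 (fun i => if i ∈ T then 0 else 1)
  have h2 : ∏ i ∈ F, (p * (1 : V → ℝ) i + (1 - p) * if i ∈ T then (0 : ℝ) else 1) =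
      ∏ i ∈ F, if i ∈ T then p else 1 :=
    Finset.prod_congr rfl fun i _ => by split_ifs <;> simp
  rw [h2, Finset.prod_ite_mem, Finset.inter_eq_right.2 hT, Finset.prod_const] at h
  rw [← h, subsampleExp, subsampleExp]
  refine Finset.sum_congr rfl fun S _ => ?_
  congr 1
  by_cases hS : T ⊆ S
  · have : ∏ i ∈ F \ S, (if i ∈ T then (0 : ℝ) else 1) = 1 :=
      Finset.prod_eq_one fun i hi => if_neg fun hiT => (Finset.mem_sdiff.1 hi).2 (hS hiT)
    simp [hS, this]
  · obtain ⟨i, hi, hiS⟩ := Finset.not_subset.1 hS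
    have : ∏ i ∈ F \ S, (if i ∈ T then (0 : ℝ) else 1) = 0 :=
      Finset.prod_eq_zero (Finset.mem_sdiff.2 ⟨hT hi, hiS⟩) (if_pos hi)
    simp [hS, this]

/-- The exponential moment used for lower tails. -/
theorem subsampleExp_half_pow {U : Finset V} (hU : U ⊆ F) (h1 : p ≤ 1) :
    subsampleExp F p (fun S => (1 / 2) ^ (S ∩ U).card) ≤ Real.exp (-(p * U.card / 2)) := by
  have h := subsampleExp_prod F p (fun i => if i ∈ U then 1 / 2 else 1) 1
  have h2 : ∏ i ∈ F, (p * (if i ∈ U then (1 / 2 : ℝ) else 1) + (1 - p) * (1 : V → ℝ) i) =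
      ∏ i ∈ F, if i ∈ U then 1 - p / 2 else 1 :=
    Finset.prod_congr rfl fun i _ => by split_ifs <;> (simp; try ring)
  rw [h2, Finset.prod_ite_mem, Finset.inter_eq_right.2 hU, Finset.prod_const] at h
  have h3 : subsampleExp F p (fun S => (1 / 2) ^ (S ∩ U).card) = (1 - p / 2) ^ U.card := by
    rw [← h, subsampleExp, subsampleExp]
    refine Finset.sum_congr rfl fun S _ => ?_
    rw [Finset.prod_ite_mem, Finset.prod_const]
    simp
  rw [h3]
  calc (1 - p / 2) ^ U.card ≤ Real.exp (-(p / 2)) ^ U.card :=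
        pow_le_pow_left₀ (by linarith) (Real.one_sub_le_exp_neg _) _
    _ = Real.exp (-(p * U.card / 2)) := by
        rw [← Real.exp_nat_mul]; congr 1; ring

/-- Markov's inequality. -/
theorem one_sub_le_subsampleProb (h0 : 0 ≤ p) (h1 : p ≤ 1) {P : Finset V → Prop}
    {f : Finset V → ℝ} (hf : ∀ S ⊆ F, 0 ≤ f S) (hP : ∀ S ⊆ F, ¬ P S → 1 ≤ f S) :
    1 - subsampleExp F p f ≤ subsampleProb F p P := by
  classical
  rw [subsampleProb_eq_exp, sub_le_iff_le_add, ← subsampleExp_add]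
  refine (subsampleExp_one F p).symm.trans_le (subsampleExp_mono h0 h1 fun S hS => ?_)
  by_cases h : P S
  · simpa [h] using hf S hS
  · simpa [h] using hP S hS h

end Subsample

/-- The number of subsets of bounded size of a finite set. -/
theorem card_filter_card_le {W : Type*} [Fintype W] {q m : ℝ} (hq : 1 ≤ q) :
    ((Finset.univ.filter fun C : Finset W => (C.card : ℝ) ≤ m).card : ℝ) ≤
      q ^ m * Real.exp (Fintype.card W / q) := by
  classical
  have hq0 : 0 < q := by linarith
  -- Give C the weight q^(-|C|). The total weight is (1 + 1/q)^|W|, and each counted set has weight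
  -- at least q^(-m).
  have h := Finset.prod_add (fun _ : W => q⁻¹) (fun _ => (1 : ℝ)) Finset.univ
  simp only [Finset.prod_const, one_pow, mul_one, Finset.powerset_univ, Finset.card_univ] at h
  have h2 : (q⁻¹ + 1) ^ Fintype.card W ≤ Real.exp (Fintype.card W / q) := by
    calc (q⁻¹ + 1) ^ Fintype.card W ≤ Real.exp q⁻¹ ^ Fintype.card W :=
          pow_le_pow_left₀ (by positivity) (Real.add_one_le_exp _) _
      _ = _ := by rw [← Real.exp_nat_mul]; congr 1
  rw [h] at h2
  rw [Finset.card_eq_sum_ones, Nat.cast_sum]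
  calc ∑ C ∈ Finset.univ.filter (fun C : Finset W => (C.card : ℝ) ≤ m), ((1 : ℕ) : ℝ)
      ≤ ∑ C ∈ Finset.univ.filter (fun C : Finset W => (C.card : ℝ) ≤ m), q ^ m * q⁻¹ ^ C.card := by
        refine Finset.sum_le_sum fun C hC => ?_
        rw [Finset.mem_filter] at hC
        rw [← Real.rpow_natCast, Real.inv_rpow hq0.le, ← Real.rpow_neg hq0.le,
          ← Real.rpow_add hq0, Nat.cast_one]
        exact Real.one_le_rpow hq (by linarith [hC.2])
    _ ≤ ∑ C : Finset W, q ^ m * q⁻¹ ^ C.card :=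
        Finset.sum_le_sum_of_subset_of_nonneg (Finset.filter_subset _ _)
          fun _ _ _ => by positivity
    _ = q ^ m * ∑ C : Finset W, q⁻¹ ^ C.card := by rw [Finset.mul_sum]
    _ ≤ _ := mul_le_mul_of_nonneg_left h2 (by positivity)

/-! ### The expected number of edges on short cycles -/

namespace SimpleGraph.Walk

variable {V : Type*} {G : SimpleGraph V}

theorem IsPath.exists_of_le {G' : SimpleGraph V} (h : G ≤ G') {u v : V} {w : G.Walk u v}
    (hw : w.IsPath) :
    ∃ w' : G'.Walk u v, w'.IsPath ∧ w'.length = w.length ∧ w'.edges = w.edges :=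
  ⟨w.mapLe h, (isPath_mapLe h).2 hw, by simp, by simp⟩

end SimpleGraph.Walk

/-- Each step has at most d continuations. Summing over all endpoints is essential: a bound for each
endpoint separately would cost a factor n. -/
theorem SimpleGraph.sum_card_finsetWalkLength_le {V : Type*} [Fintype V] [DecidableEq V]
    (G : SimpleGraph V) [DecidableRel G.Adj] {d : ℕ} (hd : ∀ v, G.degree v ≤ d) (l : ℕ) (u : V) :
    ∑ v, (G.finsetWalkLength l u v).card ≤ d ^ l := by
  induction l generalizing u with
  | zero =>
    have h : ∀ v, (G.finsetWalkLength 0 u v).card = if u = v then 1 else 0 := by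
      intro v
      by_cases h : u = v
      · subst h; simp [finsetWalkLength]
      · simp [finsetWalkLength, h]
    simp [h]
  | succ l ih =>
    calc ∑ v, (G.finsetWalkLength (l + 1) u v).card
        ≤ ∑ v, ∑ w : G.neighborSet u, (G.finsetWalkLength l w v).card := by
          refine Finset.sum_le_sum fun v _ => ?_
          rw [finsetWalkLength]
          refine Finset.card_biUnion_le.trans (le_of_eq ?_)
          simp
      _ = ∑ w : G.neighborSet u, ∑ v, (G.finsetWalkLength l w v).card := Finset.sum_comm
      _ ≤ ∑ _w : G.neighborSet u, d ^ l := Finset.sum_le_sum fun w _ => ih w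
      _ = G.degree u * d ^ l := by
          rw [Finset.sum_const, Finset.card_univ, smul_eq_mul, card_neighborSet_eq_degree]
      _ ≤ d ^ (l + 1) := by rw [pow_succ']; exact Nat.mul_le_mul_right _ (hd u)

namespace LabelCover

open SimpleGraph

/-- The pairs that form the edges in a list. -/
def pairs {m n : ℕ} (L : List (Sym2 (Fin m ⊕ Fin n))) : Finset (Fin m × Fin n) :=
  Finset.univ.filter fun e => s(.inl e.1, .inr e.2) ∈ L

/-- Every edge of the bipartite supergraph comes from exactly one pair, so distinct edges of a cycle
are distinct elements of the random set. -/
theorem card_pairs (I : LabelCover) {L : List (Sym2 (Fin I.nA ⊕ Fin I.nB))} (hL : L.Nodup)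
    (h : ∀ e ∈ L, e ∈ I.supergraph.edgeSet) : (pairs L).card = L.length := by
  have hinj : Function.Injective fun e : Fin I.nA × Fin I.nB =>
      (s(.inl e.1, .inr e.2) : Sym2 (Fin I.nA ⊕ Fin I.nB)) := by
    rintro ⟨a, b⟩ ⟨a', b'⟩ h
    simpa using h
  rw [← List.toFinset_card_of_nodup hL, ← Finset.card_image_of_injective _ hinj]
  congr 1
  ext e
  simp only [Finset.mem_image, pairs, Finset.mem_filter, Finset.mem_univ, true_and,
    List.mem_toFinset]
  refine ⟨?_, fun he => ?_⟩
  · rintro ⟨x, hx, rfl⟩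
    exact hx
  · have := h e he
    induction e with
    | h u v =>
      rcases u with a | b <;> rcases v with a' | b'
      · exact this.elim
      · exact ⟨(a, b'), he, rfl⟩
      · exact ⟨(a', b), by rwa [Sym2.eq_swap], Sym2.eq_swap⟩
      · exact this.elim

theorem pairs_subset_edges (I : LabelCover) {L : List (Sym2 (Fin I.nA ⊕ Fin I.nB))}
    (h : ∀ e ∈ L, e ∈ I.supergraph.edgeSet) : pairs L ⊆ I.edges := by
  intro e he
  rw [pairs, Finset.mem_filter] at he
  exact mem_edges.2 (h _ he.2)

open Classical in
/-- The edges in `S` that lie on short cycles. -/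
noncomputable def removed (I : LabelCover) (k : ℕ) (S : Finset (Fin I.nA × Fin I.nB)) :
    Finset (Fin I.nA × Fin I.nB) :=
  I.edges.filter fun e => e ∈ S ∧ (I.restrict S).OnShortCycle k e.1 e.2

theorem exists_walk_of_onShortCycle {I : LabelCover} {k : ℕ} {S : Finset (Fin I.nA × Fin I.nB)}
    {a : Fin I.nA} {b : Fin I.nB} (h : (I.restrict S).OnShortCycle k a b) :
    ∃ w : I.supergraph.Walk (.inl a) (.inr b), w.IsPath ∧ w.length + 1 ≤ k ∧
      s(.inl a, .inr b) ∉ w.edges ∧ pairs (s(.inl a, .inr b) :: w.edges) ⊆ S := by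
  obtain ⟨he, w, hw, hk, hn⟩ := onShortCycle_iff.1 h
  obtain ⟨w', h1, h2, h3⟩ := Walk.IsPath.exists_of_le (V := Fin I.nA ⊕ Fin I.nB)
    (I.restrict_supergraph_le S) hw
  refine ⟨w', h1, le_of_eq_of_le (congrArg (· + 1) h2) hk, h3 ▸ hn, ?_⟩
  rintro ⟨a', b'⟩ h'
  rw [pairs, Finset.mem_filter, List.mem_cons] at h'
  rcases h'.2 with h' | h'
  · obtain ⟨rfl, rfl⟩ : a' = a ∧ b' = b := by simpa using h'
    exact (restrict_edge.1 he).2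
  · have h4 : (I.restrict S).supergraph.Adj (.inl a') (.inr b') :=
      w.adj_of_mem_edges (h3 ▸ h')
    exact (restrict_edge.1 (supergraph_adj_inl_inr.1 h4)).2

-- Each removed edge is witnessed by at least one path whose edges, together with the edge itself,
-- all lie in `S`; the sum counts all such witnesses.
open Classical in
theorem card_removed_le (I : LabelCover) (k : ℕ) (S : Finset (Fin I.nA × Fin I.nB)) :
    ((I.removed k S).card : ℝ) ≤ ∑ e ∈ I.edges, ∑ l ∈ Finset.range k,
      ∑ w ∈ (I.supergraph.finsetWalkLength l (.inl e.1) (.inr e.2)).filter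
        (fun w => w.IsPath ∧ s(.inl e.1, .inr e.2) ∉ w.edges),
        if pairs (s(.inl e.1, .inr e.2) :: w.edges) ⊆ S then 1 else 0 := by
  rw [removed, Finset.card_filter, Nat.cast_sum]
  refine Finset.sum_le_sum ?_
  rintro ⟨a, b⟩ hab
  have hnn : (0 : ℝ) ≤ ∑ l ∈ Finset.range k,
      ∑ w ∈ (I.supergraph.finsetWalkLength l (.inl a) (.inr b)).filter
        (fun w => w.IsPath ∧ s(.inl a, .inr b) ∉ w.edges),
        if pairs (s(.inl a, .inr b) :: w.edges) ⊆ S then 1 else 0 :=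
    Finset.sum_nonneg fun _ _ => Finset.sum_nonneg fun _ _ => by split_ifs <;> norm_num
  split_ifs with h
  · obtain ⟨w, hw, hk, hn, hsub⟩ := exists_walk_of_onShortCycle h.2
    rw [Nat.cast_one]
    have hl : w.length ∈ Finset.range k := Finset.mem_range.2 hk
    refine le_trans ?_ (Finset.single_le_sum (fun _ _ => Finset.sum_nonneg fun _ _ => ?_) hl)
    · refine le_trans ?_ (Finset.single_le_sum (a := w) (fun _ _ => ?_) ?_)
      · rw [if_pos hsub]
      · split_ifs <;> norm_num
      · rw [Finset.mem_filter, mem_finsetWalkLength_iff]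
        exact ⟨rfl, hw, hn⟩
    · split_ifs <;> norm_num
  · simpa using hnn

theorem card_edges {I : LabelCover} {d : ℕ} (hd : ∀ v, (I.supergraph.neighborSet v).ncard = d) :
    I.edges.card = I.nA * d := by
  classical
  have h : ∀ a, (Finset.univ.filter fun b => I.Edge a b).card = d := by
    intro a
    have h1 : I.supergraph.neighborSet (.inl a) = Sum.inr '' {b | I.Edge a b} := by
      ext (a' | b)
      · simp [supergraph]
      · simp [supergraph]
    rw [← hd (.inl a), h1, Set.ncard_image_of_injective _ Sum.inr_injective,
      Set.ncard_eq_toFinset_card']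
    congr 1
    ext
    simp
  rw [edges, Finset.card_filter, Fintype.sum_prod_type]
  simp only [← Finset.card_filter, h]
  simp

-- First moment of the number of witnesses. From each of the |A| starting points there are at most
-- d^l walks, each completed to a cycle and kept with probability p^(l+1); the geometric sum is
-- dominated by (pd)^k / d ≤ 1.
open Classical in
theorem subsampleExp_removed_le {I : LabelCover} {d k : ℕ} {p : ℝ}
    (hd : ∀ v, (I.supergraph.neighborSet v).ncard = d) (h0 : 0 ≤ p) (h1 : p ≤ 1)
    {F : Finset (Fin I.nA × Fin I.nB)} (hF : I.edges ⊆ F) (h2 : 2 ≤ p * d)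
    (hk : (p * d) ^ k ≤ d) :
    subsampleExp F p (fun S => ((I.removed k S).card : ℝ)) ≤ 2 * I.nA := by
  have hdeg : ∀ v, I.supergraph.degree v ≤ d := by
    intro v
    rw [← hd v, Set.ncard_eq_toFinset_card', ← card_neighborFinset_eq_degree, neighborFinset]
  have hd0 : (0 : ℝ) < d := by
    rcases Nat.eq_zero_or_pos d with h | h
    · rw [h, Nat.cast_zero, mul_zero] at h2; linarith
    · exact_mod_cast h
  -- Since pd ≥ 2, the last term dominates up to a factor 2.
  have hgeom : ∀ k : ℕ, ∑ l ∈ Finset.range k, (p * d) ^ (l + 1) ≤ 2 * (p * d) ^ k := by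
    intro k
    induction k with
    | zero => simp
    | succ k ih =>
      rw [Finset.sum_range_succ, pow_succ]
      have : 0 ≤ (p * d) ^ k := by positivity
      nlinarith
  calc subsampleExp F p (fun S => ((I.removed k S).card : ℝ))
      ≤ _ := subsampleExp_mono h0 h1 fun S _ => I.card_removed_le k S
    _ = ∑ e ∈ I.edges, ∑ l ∈ Finset.range k,
      ∑ w ∈ (I.supergraph.finsetWalkLength l (.inl e.1) (.inr e.2)).filter
        (fun w => w.IsPath ∧ s(.inl e.1, .inr e.2) ∉ w.edges), p ^ (l + 1) := by
        rw [subsampleExp_sum]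
        refine Finset.sum_congr rfl fun e he => ?_
        rw [subsampleExp_sum]
        refine Finset.sum_congr rfl fun l _ => ?_
        rw [subsampleExp_sum]
        refine Finset.sum_congr rfl fun w hw => ?_
        rw [Finset.mem_filter, mem_finsetWalkLength_iff] at hw
        have h3 : ∀ e' ∈ s(.inl e.1, .inr e.2) :: w.edges, e' ∈ I.supergraph.edgeSet := by
          intro e' he'
          rcases List.mem_cons.1 he' with rfl | he'
          · exact mem_edges.1 he
          · exact w.edges_subset_edgeSet he'
        rw [subsampleExp_subset ((I.pairs_subset_edges h3).trans hF),
          I.card_pairs (List.nodup_cons.2 ⟨hw.2.2, hw.2.1.isTrail.edges_nodup⟩) h3,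
          List.length_cons, Walk.length_edges, hw.1]
    _ ≤ ∑ e ∈ I.edges, ∑ l ∈ Finset.range k,
        ((I.supergraph.finsetWalkLength l (.inl e.1) (.inr e.2)).card : ℝ) * p ^ (l + 1) := by
        refine Finset.sum_le_sum fun e _ => Finset.sum_le_sum fun l _ => ?_
        rw [Finset.sum_const, nsmul_eq_mul]
        gcongr
        exact Finset.filter_subset _ _
    -- Passing from edges to all pairs makes the sum over the second end free, so that walks can be
    -- counted by their starting point alone.
    _ ≤ ∑ e : Fin I.nA × Fin I.nB, ∑ l ∈ Finset.range k,
        ((I.supergraph.finsetWalkLength l (.inl e.1) (.inr e.2)).card : ℝ) * p ^ (l + 1) :=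
        Finset.sum_le_sum_of_subset_of_nonneg (Finset.subset_univ _) fun _ _ _ =>
          Finset.sum_nonneg fun _ _ => by positivity
    _ = ∑ a : Fin I.nA, ∑ l ∈ Finset.range k, (∑ b : Fin I.nB,
        ((I.supergraph.finsetWalkLength l (.inl a) (.inr b)).card : ℝ)) * p ^ (l + 1) := by
        rw [Fintype.sum_prod_type]
        refine Finset.sum_congr rfl fun a _ => ?_
        rw [Finset.sum_comm]
        refine Finset.sum_congr rfl fun l _ => ?_
        rw [Finset.sum_mul]
    _ ≤ ∑ a : Fin I.nA, ∑ l ∈ Finset.range k, (d : ℝ) ^ l * p ^ (l + 1) := by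
        refine Finset.sum_le_sum fun a _ => Finset.sum_le_sum fun l _ => ?_
        gcongr
        have := I.supergraph.sum_card_finsetWalkLength_le hdeg l (.inl a)
        rw [Fintype.sum_sum_type] at this
        exact_mod_cast (Nat.le_add_left _ _).trans this
    _ = I.nA * ((∑ l ∈ Finset.range k, (p * d) ^ (l + 1)) / d) := by
        rw [Finset.sum_const, Finset.card_univ, Fintype.card_fin, nsmul_eq_mul, Finset.sum_div]
        congr 1
        refine Finset.sum_congr rfl fun l _ => ?_
        rw [mul_pow, pow_succ (d : ℝ)]
        field_simp
    _ ≤ I.nA * 2 := by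
        gcongr
        rw [div_le_iff₀ hd0]
        exact (hgeom k).trans (by gcongr)
    _ = 2 * I.nA := mul_comm _ _

end LabelCover

/-! ### Soundness of the sparsification -/

/-- In probabilistic terms: a uniformly random choice from the lists takes the value x at i with
probability 1/|t i|. -/
theorem Fintype.card_filter_piFinset_eq_mul_card {ι κ : Type*} [Fintype ι] [DecidableEq ι]
    [DecidableEq κ] (t : ι → Finset κ) {i : ι} {x : κ} (hx : x ∈ t i) :
    ((Fintype.piFinset t).filter fun f => f i = x).card * (t i).card =
      (Fintype.piFinset t).card := by
  rw [Fintype.card_filter_piFinset_eq_of_mem _ _ hx, Fintype.card_piFinset, mul_comm,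
    Finset.mul_prod_erase _ (fun j => (t j).card) (Finset.mem_univ i)]

namespace LabelCover

open Classical in
/-- The edges covered by `C`. -/
noncomputable def covered (I : LabelCover)
    (C : Finset ((Fin I.nA × Fin I.qA) ⊕ (Fin I.nB × Fin I.qB))) : Finset (Fin I.nA × Fin I.nB) :=
  I.edges.filter fun e => ∃ x y, Sum.inl (e.1, x) ∈ C ∧ Sum.inr (e.2, y) ∈ C ∧
    I.rel e.1 e.2 x y = true

open Classical in
/-- If only few labelings per vertex are listed, then few edges are satisfied by the lists. -/
theorem card_satisfiable_by_lists_le {I : LabelCover} {s θ : ℝ} (hs : I.AtMostSatisfiable s)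
    (hθ : 0 ≤ θ) (tA : Fin I.nA → Finset (Fin I.qA)) (tB : Fin I.nB → Finset (Fin I.qB))
    (hA : ∀ a, (tA a).Nonempty) (hB : ∀ b, (tB b).Nonempty) (T : Finset (Fin I.nA × Fin I.nB))
    (hT : ∀ e ∈ T, ((tA e.1).card : ℝ) ≤ θ ∧ ((tB e.2).card : ℝ) ≤ θ ∧
      ∃ x ∈ tA e.1, ∃ y ∈ tB e.2, I.rel e.1 e.2 x y = true) :
    (T.card : ℝ) ≤ θ ^ 2 * s * I.edges.card := by
  set PA := Fintype.piFinset tA with hPA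
  set PB := Fintype.piFinset tB with hPB
  have hPA0 : (0 : ℝ) < PA.card := by
    rw [Nat.cast_pos, Finset.card_pos]
    exact Fintype.piFinset_nonempty.2 hA
  have hPB0 : (0 : ℝ) < PB.card := by
    rw [Nat.cast_pos, Finset.card_pos]
    exact Fintype.piFinset_nonempty.2 hB
  have h1 : ∑ q ∈ PA ×ˢ PB, ((I.satisfied q.1 q.2).card : ℝ) ≤
      PA.card * PB.card * (s * I.edges.card) := by
    refine (Finset.sum_le_sum fun q _ => hs q.1 q.2).trans (le_of_eq ?_)
    rw [Finset.sum_const, Finset.card_product, nsmul_eq_mul, Nat.cast_mul]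
  -- A random pair of labelings from the lists satisfies e with probability at least 1/θ², as the
  -- two endpoints choose independently.
  have h2 : ∀ e ∈ T, (PA.card * PB.card : ℝ) ≤
      θ ^ 2 * (((PA ×ˢ PB).filter fun q => e ∈ I.satisfied q.1 q.2).card : ℝ) := by
    intro e he
    obtain ⟨ha, hb, x, hx, y, hy, hr⟩ := hT e he
    have hsub : (PA.filter fun f => f e.1 = x) ×ˢ (PB.filter fun g => g e.2 = y) ⊆
        (PA ×ˢ PB).filter fun q => e ∈ I.satisfied q.1 q.2 := by
      rintro ⟨f, g⟩ hq
      simp only [Finset.mem_product, Finset.mem_filter] at hq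
      rw [Finset.mem_filter, Finset.mem_product, satisfied, Finset.mem_filter, mem_edges]
      refine ⟨⟨hq.1.1, hq.2.1⟩, ⟨x, y, hr⟩, ?_⟩
      simp only [hq.1.2, hq.2.2, hr]
    have h3 := Finset.card_le_card hsub
    rw [Finset.card_product] at h3
    have h4 := Fintype.card_filter_piFinset_eq_mul_card tA hx
    have h5 := Fintype.card_filter_piFinset_eq_mul_card tB hy
    rw [← hPA] at h4
    rw [← hPB] at h5
    rw [← h4, ← h5]
    push_cast
    have h6 : ((PA.filter fun f => f e.1 = x).card : ℝ) * ((PB.filter fun g => g e.2 = y).card : ℝ) ≤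
        (((PA ×ˢ PB).filter fun q => e ∈ I.satisfied q.1 q.2).card : ℝ) := by exact_mod_cast h3
    calc _ = (((tA e.1).card : ℝ) * (tB e.2).card) *
        (((PA.filter fun f => f e.1 = x).card : ℝ) * ((PB.filter fun g => g e.2 = y).card : ℝ)) := by
          ring
      _ ≤ (θ * θ) * (((PA ×ˢ PB).filter fun q => e ∈ I.satisfied q.1 q.2).card : ℝ) := by gcongr
      _ = _ := by ring
  -- Double counting of the pairs of an edge in `T` and a labeling that satisfies it.
  have h3 : ∑ e ∈ T, (((PA ×ˢ PB).filter fun q => e ∈ I.satisfied q.1 q.2).card : ℝ) ≤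
      ∑ q ∈ PA ×ˢ PB, ((I.satisfied q.1 q.2).card : ℝ) := by
    have : ∑ e ∈ T, ((PA ×ˢ PB).filter fun q => e ∈ I.satisfied q.1 q.2).card =
        ∑ q ∈ PA ×ˢ PB, (T.filter fun e => e ∈ I.satisfied q.1 q.2).card := by
      simp only [Finset.card_filter]
      exact Finset.sum_comm
    rw [← Nat.cast_sum, this, ← Nat.cast_sum, Nat.cast_le]
    refine Finset.sum_le_sum fun q _ => Finset.card_le_card fun e he => ?_
    exact (Finset.mem_filter.1 he).2
  have h4 : (T.card : ℝ) * (PA.card * PB.card) ≤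
      θ ^ 2 * (PA.card * PB.card * (s * I.edges.card)) := by
    calc (T.card : ℝ) * (PA.card * PB.card) = ∑ _e ∈ T, (PA.card * PB.card : ℝ) := by
          rw [Finset.sum_const, nsmul_eq_mul]
      _ ≤ _ := Finset.sum_le_sum h2
      _ = θ ^ 2 * _ := by rw [Finset.mul_sum]
      _ ≤ _ := mul_le_mul_of_nonneg_left (h3.trans h1) (sq_nonneg θ)
  refine le_of_mul_le_mul_right (h4.trans (le_of_eq ?_)) (mul_pos hPA0 hPB0)
  ring

theorem card_filter_lt_mul_le {ι : Type*} [Fintype ι] (f : ι → ℕ) {θ : ℝ} :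
    ((Finset.univ.filter fun i => θ < f i).card : ℝ) * θ ≤ ∑ i, (f i : ℝ) := by
  calc ((Finset.univ.filter fun i => θ < f i).card : ℝ) * θ
      = ∑ i ∈ Finset.univ.filter (fun i => θ < f i), θ := by rw [Finset.sum_const, nsmul_eq_mul]
    _ ≤ ∑ i ∈ Finset.univ.filter (fun i => θ < f i), (f i : ℝ) :=
        Finset.sum_le_sum fun i hi => (Finset.mem_filter.1 hi).2.le
    _ ≤ _ := Finset.sum_le_sum_of_subset_of_nonneg (Finset.filter_subset _ _)
        fun _ _ _ => Nat.cast_nonneg _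

open Classical in
theorem card_filter_fst_edges {I : LabelCover} (a : Fin I.nA) :
    (I.edges.filter fun e => e.1 = a).card = (I.supergraph.neighborSet (.inl a)).ncard := by
  rw [Set.ncard_eq_toFinset_card']
  refine Finset.card_bij (fun e _ => Sum.inr e.2) ?_ ?_ ?_
  · rintro ⟨a', b⟩ h
    obtain ⟨h1, rfl⟩ := Finset.mem_filter.1 h
    exact Set.mem_toFinset.2 (mem_edges.1 h1)
  · rintro ⟨a', b⟩ h ⟨a'', b'⟩ h' hh
    simp only [Finset.mem_filter] at h h'
    simpa [h.2, h'.2] using hh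
  · rintro (a' | b) h
    · exact (Set.mem_toFinset.1 h).elim
    · have h1 : I.supergraph.Adj (.inl a) (.inr b) := by
        simpa only [Set.mem_toFinset, SimpleGraph.mem_neighborSet] using h
      exact ⟨(a, b), Finset.mem_filter.2 ⟨mem_edges.2 h1, rfl⟩, rfl⟩

open Classical in
theorem card_filter_snd_edges {I : LabelCover} (b : Fin I.nB) :
    (I.edges.filter fun e => e.2 = b).card = (I.supergraph.neighborSet (.inr b)).ncard := by
  rw [Set.ncard_eq_toFinset_card']
  refine Finset.card_bij (fun e _ => Sum.inl e.1) ?_ ?_ ?_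
  · rintro ⟨a, b'⟩ h
    obtain ⟨h1, rfl⟩ := Finset.mem_filter.1 h
    exact Set.mem_toFinset.2 (mem_edges.1 h1)
  · rintro ⟨a', b⟩ h ⟨a'', b'⟩ h' hh
    simp only [Finset.mem_filter] at h h'
    simpa [h.2, h'.2] using hh
  · rintro (a | b') h
    · have h1 : I.supergraph.Adj (.inr b) (.inl a) := by
        simpa only [Set.mem_toFinset, SimpleGraph.mem_neighborSet] using h
      exact ⟨(a, b), Finset.mem_filter.2 ⟨mem_edges.2 h1, rfl⟩, rfl⟩
    · exact (Set.mem_toFinset.1 h).elim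

open Classical in
/-- A small set of vertices of the Min-Rep graph covers at most half of the edges. -/
theorem card_covered_le {I : LabelCover} {n d : ℕ} {s α : ℝ} (hA : 2 * I.nA = n)
    (hd : ∀ v, (I.supergraph.neighborSet v).ncard = d) (hs0 : 0 < s) (hs : I.AtMostSatisfiable s)
    (hα : 0 < α) (hαs : α ≤ 1 / s) {C : Finset ((Fin I.nA × Fin I.qA) ⊕ (Fin I.nB × Fin I.qB))}
    (hC : (C.card : ℝ) ≤ n * √α / 1024) :
    ((I.covered C).card : ℝ) ≤ I.edges.card / 2 := by
  rcases I.edges.eq_empty_or_nonempty with h0 | ⟨⟨a₀, b₀⟩, h0⟩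
  · have : I.covered C = ∅ := by rw [covered, h0, Finset.filter_empty]
    simp [this, h0]
  obtain ⟨x₀, y₀, -⟩ := mem_edges.1 h0
  let CA : Fin I.nA → Finset (Fin I.qA) := fun a => Finset.univ.filter fun x => Sum.inl (a, x) ∈ C
  let CB : Fin I.nB → Finset (Fin I.qB) := fun b => Finset.univ.filter fun y => Sum.inr (b, y) ∈ C
  have hsum : ∑ a, ((CA a).card : ℝ) + ∑ b, ((CB b).card : ℝ) = C.card := by
    have h1 : ∑ a, (CA a).card = (C.toLeft).card := by
      rw [← Finset.card_sigma]
      refine Finset.card_bij (fun q _ => (q.1, q.2)) ?_ ?_ ?_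
      · rintro ⟨a, x⟩ h; simpa [CA] using h
      · rintro ⟨a, x⟩ _ ⟨a', x'⟩ _ h; simpa using h
      · rintro ⟨a, x⟩ h; exact ⟨⟨a, x⟩, by simpa [CA] using h, rfl⟩
    have h2 : ∑ b, (CB b).card = (C.toRight).card := by
      rw [← Finset.card_sigma]
      refine Finset.card_bij (fun q _ => (q.1, q.2)) ?_ ?_ ?_
      · rintro ⟨a, x⟩ h; simpa [CB] using h
      · rintro ⟨a, x⟩ _ ⟨a', x'⟩ _ h; simpa using h
      · rintro ⟨a, x⟩ h; exact ⟨⟨a, x⟩, by simpa [CB] using h, rfl⟩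
    have h3 := C.card_toLeft_add_card_toRight
    rw [← h1, ← h2] at h3
    exact_mod_cast h3
  -- The threshold for long lists: it makes θ²s ≤ 1/4, while at most |C|/θ ≤ n/512 vertices exceed
  -- it.
  set θ := √α / 2 with hθ
  have hα' : 0 < √α := Real.sqrt_pos.2 hα
  have hθ0 : 0 < θ := by positivity
  set badA := Finset.univ.filter fun a => θ < (CA a).card
  set badB := Finset.univ.filter fun b => θ < (CB b).card
  have hbad : ((badA.card : ℝ) + badB.card) * θ ≤ C.card := by
    rw [add_mul, ← hsum]
    exact add_le_add (card_filter_lt_mul_le _) (card_filter_lt_mul_le _)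
  have hbad2 : (badA.card : ℝ) + badB.card ≤ n / 512 := by
    rw [hθ] at hbad
    have h1 : ((badA.card : ℝ) + badB.card) * √α ≤ (n / 512) * √α := by linarith
    exact le_of_mul_le_mul_right h1 hα'
  have hE : (I.edges.card : ℝ) = n * d / 2 := by
    rw [card_edges hd, ← hA]; push_cast; ring
  set T := (I.covered C).filter fun e => e.1 ∉ badA ∧ e.2 ∉ badB
  have hT : (T.card : ℝ) ≤ θ ^ 2 * s * I.edges.card := by
    -- Empty lists are replaced by the full alphabet, nonempty because an edge exists; no edge of
    -- `T` ends at such a vertex.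
    let DA : Fin I.nA → Finset (Fin I.qA) := fun a => if (CA a).Nonempty then CA a else Finset.univ
    let DB : Fin I.nB → Finset (Fin I.qB) := fun b => if (CB b).Nonempty then CB b else Finset.univ
    have hDA : ∀ a, (CA a).Nonempty → DA a = CA a := fun a h => if_pos h
    have hDB : ∀ b, (CB b).Nonempty → DB b = CB b := fun b h => if_pos h
    refine card_satisfiable_by_lists_le hs hθ0.le DA DB (fun a => ?_) (fun b => ?_) T ?_
    · by_cases h : (CA a).Nonempty
      · rwa [hDA a h]
      · exact ⟨x₀, by simp [DA, h]⟩
    · by_cases h : (CB b).Nonempty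
      · rwa [hDB b h]
      · exact ⟨y₀, by simp [DB, h]⟩
    · rintro ⟨a, b⟩ he
      simp only [T, covered, Finset.mem_filter, badA, badB, Finset.mem_univ, true_and, not_lt] at he
      obtain ⟨⟨-, x, y, hx, hy, hr⟩, h1, h2⟩ := he
      have hx' : x ∈ CA a := by simpa [CA] using hx
      have hy' : y ∈ CB b := by simpa [CB] using hy
      rw [hDA a ⟨x, hx'⟩, hDB b ⟨y, hy'⟩]
      exact ⟨h1, h2, x, hx', y, hy', hr⟩
  have hcov : I.covered C ⊆ T ∪ (badA.biUnion (fun a => I.edges.filter fun e => e.1 = a) ∪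
      badB.biUnion (fun b => I.edges.filter fun e => e.2 = b)) := by
    intro e he
    have heE : e ∈ I.edges := (Finset.mem_filter.1 he).1
    by_cases ha : e.1 ∈ badA
    · exact Finset.mem_union_right _ (Finset.mem_union_left _
        (Finset.mem_biUnion.2 ⟨e.1, ha, Finset.mem_filter.2 ⟨heE, rfl⟩⟩))
    by_cases hb : e.2 ∈ badB
    · exact Finset.mem_union_right _ (Finset.mem_union_right _
        (Finset.mem_biUnion.2 ⟨e.2, hb, Finset.mem_filter.2 ⟨heE, rfl⟩⟩))
    · exact Finset.mem_union_left _ (Finset.mem_filter.2 ⟨he, ha, hb⟩)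
  have h1 : (I.covered C).card ≤ T.card + (badA.card * d + badB.card * d) := by
    refine (Finset.card_le_card hcov).trans ((Finset.card_union_le _ _).trans ?_)
    refine Nat.add_le_add_left ((Finset.card_union_le _ _).trans (add_le_add ?_ ?_)) _
    · exact Finset.card_biUnion_le_card_mul _ _ _ fun a _ => ((card_filter_fst_edges a).trans (hd _)).le
    · exact Finset.card_biUnion_le_card_mul _ _ _ fun b _ => ((card_filter_snd_edges b).trans (hd _)).le
  have h2 : ((I.covered C).card : ℝ) ≤ T.card + ((badA.card : ℝ) + badB.card) * d := by
    rw [add_mul]; exact_mod_cast h1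
  have h3 : ((badA.card : ℝ) + badB.card) * d ≤ n / 512 * d := by gcongr
  have h4 : θ ^ 2 * s ≤ 1 / 4 := by
    rw [hθ, div_pow, Real.sq_sqrt hα.le]
    rw [le_div_iff₀ hs0] at hαs
    linarith
  have h5 : θ ^ 2 * s * I.edges.card ≤ 1 / 4 * I.edges.card := by gcongr
  have h6 : (0 : ℝ) ≤ n * d := by positivity
  -- With |E| = nd/2 the total is at most nd/8 + nd/512, below nd/4.
  rw [hE] at h5 hT ⊢
  linarith

/-- What a cover of a sparsified instance misses has been removed. -/
theorem inter_sdiff_covered_subset {I : LabelCover} {k : ℕ} {S : Finset (Fin I.nA × Fin I.nB)}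
    {C : Finset ((Fin I.nA × Fin I.qA) ⊕ (Fin I.nB × Fin I.qB))}
    (hC : (I.sparsify k S).IsRepCover C) : S ∩ (I.edges \ I.covered C) ⊆ I.removed k S := by
  classical
  rintro ⟨a, b⟩ he
  rw [Finset.mem_inter, Finset.mem_sdiff] at he
  obtain ⟨hS, hE, hn⟩ := he
  rw [removed, Finset.mem_filter]
  refine ⟨hE, hS, ?_⟩
  by_contra hc
  obtain ⟨x, y, hx, hy, hr⟩ := hC a b (sparsify_edge.2 ⟨mem_edges.1 hE, hS, hc⟩)
  rw [covered, Finset.mem_filter] at hn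
  exact hn ⟨hE, x, y, hx, hy, (sparsify_rel.1 hr).1⟩

theorem exp_neg_thirtytwo_le : Real.exp (-32) ≤ 1 / 40 := by
  rw [Real.exp_neg, one_div]
  refine inv_anti₀ (by norm_num) ?_
  have h1 : (40 : ℝ) ≤ 2 ^ 32 := by norm_num
  have h2 : (2 : ℝ) ≤ Real.exp 1 := by have := Real.add_one_le_exp 1; linarith
  calc (40 : ℝ) ≤ 2 ^ 32 := h1
    _ ≤ Real.exp 1 ^ 32 := pow_le_pow_left₀ (by norm_num) h2 32
    _ = Real.exp 32 := by rw [← Real.exp_nat_mul]; norm_num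

set_option maxHeartbeats 600000 in
theorem le_subsampleProb_repCoverAtLeast {I : LabelCover} {n d qA qB k : ℕ} {s α p : ℝ}
    (hn : 600 ≤ Real.logb 2 n) (hI : I.IsRegular n d qA qB) (hqA : 2 ≤ qA) (hq : qB ≤ qA)
    (hα : 18 * Real.logb 2 n ≤ α) (hs0 : 0 < s) (hαs : α ≤ 1 / s) (h0 : 0 ≤ p) (h1 : p ≤ 1)
    (hD : α * Real.logb 2 qA / 16 ≤ p * d) (hk : (p * d) ^ k ≤ d) (hs : I.AtMostSatisfiable s)
    {F : Finset (Fin I.nA × Fin I.nB)} (hF : I.edges ⊆ F) :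
    19 / 20 ≤ subsampleProb F p fun S => (I.sparsify k S).RepCoverAtLeast (n * √α / 1024) := by
  classical
  have hn1 : (1 : ℝ) ≤ n := by
    rcases Nat.eq_zero_or_pos n with h | h
    · rw [h] at hn; norm_num at hn
    · exact_mod_cast h
  have hqA1 : (1 : ℝ) ≤ qA := by exact_mod_cast (by omega : 1 ≤ qA)
  have hlog : 1 ≤ Real.logb 2 qA := by
    rw [Real.le_logb_iff_rpow_le (by norm_num) (by linarith), Real.rpow_one]
    exact_mod_cast hqA
  have hα1 : 10800 ≤ α := by linarith
  set D := p * d with hDdef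
  -- Indeed α ≥ 18 · 600 and log |Σ_A| ≥ 1 give D ≥ 10800/16 = 675.
  have hD1 : 640 ≤ D := by nlinarith
  have hsq : √α ≤ α := by
    rw [Real.sqrt_le_left (by linarith)]
    nlinarith
  have hdeg := hI.degree
  have hE : (I.edges.card : ℝ) = n * d / 2 := by
    rw [card_edges hdeg, ← hI.sizeA]; push_cast; ring
  set m := n * √α / 1024 with hm
  -- The cutoff lies far above the expectation n of the number of removed edges, and at a quarter of
  -- nD/4, the lower bound for the expected number of missed edges in the sample.
  set t := n * D / 16 with ht
  have ht0 : 0 < t := by positivity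
  set U := fun C : Finset ((Fin I.nA × Fin I.qA) ⊕ (Fin I.nB × Fin I.qB)) => I.edges \ I.covered C
  set Cs := Finset.univ.filter fun C : Finset ((Fin I.nA × Fin I.qA) ⊕ (Fin I.nB × Fin I.qB)) =>
    (C.card : ℝ) ≤ m
  have hU : ∀ C ∈ Cs, subsampleExp F p (fun S => (1 / 2) ^ (S ∩ U C).card) ≤
      Real.exp (-(n * D / 8)) := by
    intro C hC
    refine (subsampleExp_half_pow (Finset.sdiff_subset.trans hF) h1).trans (Real.exp_le_exp.2 ?_)
    have h2 := card_covered_le hI.sizeA hdeg hs0 hs (by linarith) hαs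
      (Finset.mem_filter.1 hC).2
    have h3 : ((U C).card : ℝ) = I.edges.card - (I.covered C).card := by
      have h4 : I.covered C ⊆ I.edges := Finset.filter_subset _ _
      rw [← Nat.cast_sub (Finset.card_le_card h4), ← Finset.card_sdiff_of_subset h4]
    have h4 : (n * d / 4 : ℝ) ≤ (U C).card := by rw [h3]; linarith
    have h5 := mul_le_mul_of_nonneg_left h4 h0
    rw [hDdef]
    nlinarith
  -- With weight 1/|Σ_A| the number is at most exp(m log |Σ_A| + n), since there are at most n|Σ_A|
  -- vertices. Both summands are at most nD/64.
  have hCs : (Cs.card : ℝ) ≤ Real.exp (n * D / 32) := by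
    refine (card_filter_card_le hqA1).trans ?_
    rw [Real.rpow_def_of_pos (by linarith), ← Real.exp_add]
    refine Real.exp_le_exp.2 ?_
    have h2 : Real.log qA ≤ Real.logb 2 qA := by
      rw [Real.logb, le_div_iff₀ (Real.log_pos (by norm_num))]
      have : Real.log 2 ≤ 1 := by have := Real.log_two_lt_d9; linarith
      have h3 : 0 ≤ Real.log qA := Real.log_nonneg hqA1
      nlinarith
    have h3 : Real.log qA * m ≤ n * D / 64 := by
      calc Real.log qA * m ≤ Real.logb 2 qA * (n * α / 1024) := by
            rw [hm]; gcongr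
        _ = n * (α * Real.logb 2 qA / 16) / 64 := by ring
        _ ≤ n * D / 64 := by gcongr
    have h4 : (Fintype.card ((Fin I.nA × Fin I.qA) ⊕ (Fin I.nB × Fin I.qB)) : ℝ) / qA ≤ n := by
      rw [div_le_iff₀ (by linarith)]
      simp only [Fintype.card_sum, Fintype.card_prod, Fintype.card_fin]
      rw [hI.alphabetA, hI.alphabetB]
      have : I.nA * qA + I.nB * qB ≤ n * qA := by
        have h5 := Nat.mul_le_mul_left I.nB hq
        have h6 := hI.sizeA
        have h7 := hI.sizeB
        have h8 : n = I.nA + I.nB := by omega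
        rw [h8, add_mul]
        omega
      exact_mod_cast this
    nlinarith
  have hexp : subsampleExp F p (fun S => 1 / t * ((I.removed k S).card : ℝ) +
      (2 : ℝ) ^ t * ∑ C ∈ Cs, (1 / 2) ^ (S ∩ U C).card) ≤ 1 / 20 := by
    rw [subsampleExp_add, subsampleExp_const_mul, subsampleExp_const_mul, subsampleExp_sum]
    have h2 := subsampleExp_removed_le hdeg h0 h1 hF (by linarith) hk
    have h3 : (2 * I.nA : ℝ) = n := by exact_mod_cast hI.sizeA
    rw [h3] at h2
    have h4 : 1 / t * subsampleExp F p (fun S => ((I.removed k S).card : ℝ)) ≤ 1 / 40 := by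
      calc _ ≤ 1 / t * n := by gcongr
        _ ≤ 1 / 40 := by
          rw [one_div_mul_eq_div, div_le_iff₀ ht0, ht]
          nlinarith
    have h5 : (2 : ℝ) ^ t ≤ Real.exp (7 / 160 * (n * D)) := by
      rw [Real.rpow_def_of_pos (by norm_num)]
      refine Real.exp_le_exp.2 ?_
      have := Real.log_two_lt_d9
      have h6 : Real.log 2 * t ≤ 0.7 * t := by gcongr; linarith
      rw [ht] at h6 ⊢
      linarith
    -- The exponents add up to (7 + 5 - 20)/160 = -1/20 times nD, and nD/20 ≥ 32.
    have h6 : (2 : ℝ) ^ t * ∑ C ∈ Cs, subsampleExp F p (fun S => (1 / 2) ^ (S ∩ U C).card) ≤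
        1 / 40 := by
      calc _ ≤ Real.exp (7 / 160 * (n * D)) * (Cs.card * Real.exp (-(n * D / 8))) := by
            refine mul_le_mul h5 ((Finset.sum_le_sum hU).trans (le_of_eq ?_)) ?_ (by positivity)
            · rw [Finset.sum_const, nsmul_eq_mul]
            · refine Finset.sum_nonneg fun C _ => Finset.sum_nonneg fun S _ => ?_
              have : 0 ≤ 1 - p := by linarith
              positivity
        _ ≤ Real.exp (7 / 160 * (n * D)) * (Real.exp (n * D / 32) * Real.exp (-(n * D / 8))) := by
            gcongr
        _ = Real.exp (-(n * D / 20)) := by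
            rw [← Real.exp_add, ← Real.exp_add]; congr 1; ring
        _ ≤ Real.exp (-32) := Real.exp_le_exp.2 (by nlinarith)
        _ ≤ 1 / 40 := exp_neg_thirtytwo_le
    linarith
  refine le_trans (by linarith) (one_sub_le_subsampleProb h0 h1 (f := fun S =>
    1 / t * ((I.removed k S).card : ℝ) + (2 : ℝ) ^ t * ∑ C ∈ Cs, (1 / 2) ^ (S ∩ U C).card) ?_ ?_)
  · intro S _
    have : 0 ≤ ∑ C ∈ Cs, (1 / 2 : ℝ) ^ (S ∩ U C).card := Finset.sum_nonneg fun _ _ => by positivity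
    positivity
  · intro S _ hS
    rw [RepCoverAtLeast] at hS
    push Not at hS
    obtain ⟨C, hC, hCm⟩ := hS
    have hCs' : C ∈ Cs := Finset.mem_filter.2 ⟨Finset.mem_univ _, hCm.le⟩
    have h2 := Finset.card_le_card (inter_sdiff_covered_subset hC)
    -- The sampled edges missed by C were all removed: either at least t edges were removed, or C
    -- makes the second term at least 1.
    rcases le_or_gt t (I.removed k S).card with h3 | h3
    · have h4 : 1 ≤ 1 / t * ((I.removed k S).card : ℝ) := by
        rwa [one_div_mul_eq_div, le_div_iff₀ ht0, one_mul]
      have : 0 ≤ ∑ C ∈ Cs, (1 / 2 : ℝ) ^ (S ∩ U C).card :=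
        Finset.sum_nonneg fun _ _ => by positivity
      have : 0 ≤ (2 : ℝ) ^ t * ∑ C ∈ Cs, (1 / 2 : ℝ) ^ (S ∩ U C).card := by positivity
      linarith
    · have h4 : ((S ∩ U C).card : ℝ) ≤ t := by
        have : ((S ∩ U C).card : ℝ) ≤ (I.removed k S).card := by exact_mod_cast h2
        linarith
      have h5 : 1 ≤ (2 : ℝ) ^ t * (1 / 2) ^ (S ∩ U C).card := by
        rw [one_div, inv_pow, ← div_eq_mul_inv, le_div_iff₀ (by positivity), one_mul,
          ← Real.rpow_natCast]
        exact Real.rpow_le_rpow_of_exponent_le (by norm_num) h4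
      have h6 : (1 / 2 : ℝ) ^ (S ∩ U C).card ≤ ∑ C ∈ Cs, (1 / 2 : ℝ) ^ (S ∩ U C).card :=
        Finset.single_le_sum (f := fun C => (1 / 2 : ℝ) ^ (S ∩ U C).card)
          (fun _ _ => by positivity) hCs'
      have h7 : (0 : ℝ) ≤ 1 / t * ((I.removed k S).card : ℝ) := by positivity
      have h8 := mul_le_mul_of_nonneg_left h6 (by positivity : (0 : ℝ) ≤ 2 ^ t)
      exact h5.trans (h8.trans (le_add_of_nonneg_left h7))

end LabelCover

/-! ### The reduction as a function on trees -/

namespace PolyTree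

/-- Weakening: under a further binder the environment is the first component, so an outer index is
reached by one more `lift`. -/
theorem lift {f : BinTree → BinTree} (hf : PolyTree f) : PolyTree fun z => f z.hd := hf.comp hd

end PolyTree

namespace PolyNat

theorem lift {f : BinTree → ℕ} (hf : PolyNat f) : PolyNat fun z => f z.hd := hf.comp PolyTree.hd

theorem index : PolyNat fun z => z.tl.len := PolyTree.tl.len

end PolyNat

namespace BinTree

/-- The number of vertices on the first side of an encoded instance. -/
def sizeA (t : BinTree) : ℕ := (t.get 0).len

/-- The number of vertices on the second side of an encoded instance. -/
def sizeB (t : BinTree) : ℕ := (t.get 1).len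

/-- The size of the first alphabet of an encoded instance. -/
def alphA (t : BinTree) : ℕ := (t.get 2).len

/-- The size of the second alphabet of an encoded instance. -/
def alphB (t : BinTree) : ℕ := (t.get 3).len

/-- An entry of the table of an encoded instance. -/
def entry (t : BinTree) (a b x y : ℕ) : Bool := (((((t.get 4).get a).get b).get x).get y).toBool

/-- The superedges of an encoded instance. -/
def isEdge (t : BinTree) (a b : ℕ) : Bool :=
  (List.range t.alphA).any fun x => (List.range t.alphB).any fun y => t.entry a b x y

/-- The degree of the first vertex of an encoded instance. -/
def deg (t : BinTree) : ℕ := (List.range t.sizeB).countP fun b => t.isEdge 0 b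

/-- The logarithm to base `b`, rounded down. -/
def log (b n : ℕ) : ℕ := (logState b n n).2

/-- An approximation of the average degree of the subsampled instance. -/
def base (t : BinTree) (a : ℕ) : ℕ := (a - 1) * log 2 t.alphA

/-- The length up to which cycles are removed. -/
def cycleBound (t : BinTree) (a : ℕ) : ℕ := log (t.base a) t.deg

/-- The number of coin tosses for each edge. -/
def coins (t : BinTree) (a : ℕ) : ℕ := log 2 t.deg - log 2 (t.base a) + 1

/-- The edges that are kept by the list `w` of truth values. -/
def isKept (t w : BinTree) (a b : ℕ) : Bool := t.isEdge a b && (w.get (b + t.sizeB * a)).toBool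

/-- The kept edges other than `(a, b)`; the vertices of the second side are numbered after those of
the first. -/
def isArc (t w : BinTree) (a b u v : ℕ) : Bool :=
  decide (u < t.sizeA) && !decide (v < t.sizeA) && t.isKept w u (v - t.sizeA) &&
    !(decide (u = a) && decide (v - t.sizeA = b))

/-- One round of breadth-first search. -/
def expand (t w : BinTree) (a b : ℕ) (s : BinTree) : BinTree :=
  tabulate (t.sizeA + t.sizeB) fun v => ofBool ((s.get v).toBool ||
    (List.range (t.sizeA + t.sizeB)).any fun u =>
      (t.isArc w a b v u || t.isArc w a b u v) && (s.get u).toBool)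

/-- The vertices from which `b` can be reached in at most `k` steps without using `(a, b)`. -/
def reachable (t w : BinTree) (a b k : ℕ) : BinTree :=
  (t.expand w a b)^[k] (tabulate (t.sizeA + t.sizeB) fun v => ofBool (decide (v = t.sizeA + b)))

/-- The edges that survive. -/
def survives (t w : BinTree) (k a b : ℕ) : Bool :=
  t.isKept w a b && !((t.reachable w a b (k - 1)).get a).toBool

/-- The encoding of the sparsified instance. -/
def sparsify (t w : BinTree) (k : ℕ) : BinTree :=
  ofList [ofNat t.sizeA, ofNat t.sizeB, ofNat t.alphA, ofNat t.alphB,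
    tabulate t.sizeA fun a => tabulate t.sizeB fun b => tabulate t.alphA fun x =>
      tabulate t.alphB fun y => ofBool (t.entry a b x y && t.survives w k a b)]

end BinTree

/-! ### Polynomial-time computability of the reduction -/

section Complexity

open BinTree

variable {t w : BinTree → BinTree} {a b u v x y k : BinTree → ℕ}

theorem PolyTree.sizeA (ht : PolyTree t) : PolyNat fun z => (t z).sizeA :=
  (ht.get (PolyNat.const 0)).len

theorem PolyTree.sizeB (ht : PolyTree t) : PolyNat fun z => (t z).sizeB :=
  (ht.get (PolyNat.const 1)).len

theorem PolyTree.alphA (ht : PolyTree t) : PolyNat fun z => (t z).alphA :=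
  (ht.get (PolyNat.const 2)).len

theorem PolyTree.alphB (ht : PolyTree t) : PolyNat fun z => (t z).alphB :=
  (ht.get (PolyNat.const 3)).len

theorem PolyTree.entry (ht : PolyTree t) (ha : PolyNat a) (hb : PolyNat b) (hx : PolyNat x)
    (hy : PolyNat y) : PolyBool fun z => (t z).entry (a z) (b z) (x z) (y z) :=
  (((((ht.get (PolyNat.const 4)).get ha).get hb).get hx).get hy).toBool

theorem PolyTree.isEdge (ht : PolyTree t) (ha : PolyNat a) (hb : PolyNat b) :
    PolyBool fun z => (t z).isEdge (a z) (b z) :=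
  PolyBool.any ht.alphA (PolyBool.any ht.lift.alphB
    (ht.lift.lift.entry ha.lift.lift hb.lift.lift PolyNat.index.lift PolyNat.index))

theorem PolyTree.deg (ht : PolyTree t) : PolyNat fun z => (t z).deg :=
  PolyNat.count ht.sizeB (ht.lift.isEdge (PolyNat.const 0) PolyNat.index)

theorem PolyTree.base (ht : PolyTree t) (ha : PolyNat a) : PolyNat fun z => (t z).base (a z) :=
  (ha.sub (PolyNat.const 1)).mul ((PolyNat.const 2).log ht.alphA)

theorem PolyTree.cycleBound (ht : PolyTree t) (ha : PolyNat a) :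
    PolyNat fun z => (t z).cycleBound (a z) :=
  (ht.base ha).log ht.deg

theorem PolyTree.coins (ht : PolyTree t) (ha : PolyNat a) : PolyNat fun z => (t z).coins (a z) :=
  (((PolyNat.const 2).log ht.deg).sub ((PolyNat.const 2).log (ht.base ha))).succ

theorem PolyTree.isKept (ht : PolyTree t) (hw : PolyTree w) (ha : PolyNat a) (hb : PolyNat b) :
    PolyBool fun z => (t z).isKept (w z) (a z) (b z) :=
  (ht.isEdge ha hb).and (hw.get (hb.add (ht.sizeB.mul ha))).toBool

theorem PolyTree.isArc (ht : PolyTree t) (hw : PolyTree w) (ha : PolyNat a) (hb : PolyNat b)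
    (hu : PolyNat u) (hv : PolyNat v) :
    PolyBool fun z => (t z).isArc (w z) (a z) (b z) (u z) (v z) :=
  (((hu.lt ht.sizeA).and (hv.lt ht.sizeA).not).and (ht.isKept hw hu (hv.sub ht.sizeA))).and
    ((PolyBool.eq hu ha).and (PolyBool.eq (hv.sub ht.sizeA) hb)).not

theorem PolyTree.expand {s : BinTree → BinTree} (ht : PolyTree t) (hw : PolyTree w) (ha : PolyNat a)
    (hb : PolyNat b) (hs : PolyTree s) :
    PolyTree fun z => (t z).expand (w z) (a z) (b z) (s z) :=
  PolyTree.tabulate (ht.sizeA.add ht.sizeB) (PolyBool.or (hs.lift.get PolyNat.index).toBool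
    (PolyBool.any (ht.sizeA.add ht.sizeB).lift
      (((ht.lift.lift.isArc hw.lift.lift ha.lift.lift hb.lift.lift PolyNat.index.lift
        PolyNat.index).or (ht.lift.lift.isArc hw.lift.lift ha.lift.lift hb.lift.lift PolyNat.index
        PolyNat.index.lift)).and (hs.lift.lift.get PolyNat.index).toBool)))

theorem PolyTree.reachable (ht : PolyTree t) (hw : PolyTree w) (ha : PolyNat a) (hb : PolyNat b)
    (hk : PolyNat k) : PolyTree fun z => (t z).reachable (w z) (a z) (b z) (k z) := by
  obtain ⟨p, hp⟩ := (ht.sizeA.add ht.sizeB).le_poly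
  refine PolyTree.iterate (G := fun z s => (t z).expand (w z) (a z) (b z) s) hk
    (PolyTree.tabulate (ht.sizeA.add ht.sizeB)
      (PolyBool.eq PolyNat.index (ht.lift.sizeA.add hb.lift)))
    (ht.lift.expand hw.lift ha.lift hb.lift PolyTree.tl) (2 * p) fun z s => ?_
  -- The table is rebuilt in each round, so its size is bounded regardless of the previous state.
  have h1 : ((t z).expand (w z) (a z) (b z) s).size ≤ ((t z).sizeA + (t z).sizeB) * (1 + 1) :=
    size_tabulate_le fun i _ => size_ofBool_le _
  have h2 := hp z
  simp only [Polynomial.eval_mul, Polynomial.eval_ofNat]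
  omega

theorem PolyTree.survives (ht : PolyTree t) (hw : PolyTree w) (hk : PolyNat k) (ha : PolyNat a)
    (hb : PolyNat b) : PolyBool fun z => (t z).survives (w z) (k z) (a z) (b z) :=
  (ht.isKept hw ha hb).and
    ((ht.reachable hw ha hb (hk.sub (PolyNat.const 1))).get ha).toBool.not

theorem PolyTree.sparsify (ht : PolyTree t) (hw : PolyTree w) (hk : PolyNat k) :
    PolyTree fun z => (t z).sparsify (w z) (k z) :=
  PolyTree.cons ht.sizeA (PolyTree.cons ht.sizeB (PolyTree.cons ht.alphA (PolyTree.cons ht.alphB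
    (PolyTree.cons (PolyTree.tabulate ht.sizeA (PolyTree.tabulate ht.lift.sizeB
      (PolyTree.tabulate ht.lift.lift.alphA (PolyTree.tabulate ht.lift.lift.lift.alphB
        ((ht.lift.lift.lift.lift.entry PolyNat.index.lift.lift.lift PolyNat.index.lift.lift
          PolyNat.index.lift PolyNat.index).and
        (ht.lift.lift.lift.lift.survives hw.lift.lift.lift.lift hk.lift.lift.lift.lift
          PolyNat.index.lift.lift.lift PolyNat.index.lift.lift)))))) PolyTree.nil))))

end Complexity

/-! ### Its meaning for encoded instances -/

namespace LabelCover

open BinTree SimpleGraph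

variable (I : LabelCover)

@[simp] theorem sizeA_encode : I.encode.sizeA = I.nA := by simp [sizeA, encode, get_ofList]

@[simp] theorem sizeB_encode : I.encode.sizeB = I.nB := by simp [sizeB, encode, get_ofList]

@[simp] theorem alphA_encode : I.encode.alphA = I.qA := by simp [alphA, encode, get_ofList]

@[simp] theorem alphB_encode : I.encode.alphB = I.qB := by simp [alphB, encode, get_ofList]

@[simp] theorem entry_encode (a : Fin I.nA) (b : Fin I.nB) (x : Fin I.qA) (y : Fin I.qB) :
    I.encode.entry a b x y = I.rel a b x y := by
  simp [entry, encode, get_ofList, get_ofTable]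

@[simp] theorem isEdge_encode (a : Fin I.nA) (b : Fin I.nB) :
    I.encode.isEdge a b = decide (I.Edge a b) := by
  rw [Bool.eq_iff_iff, decide_eq_true_iff]
  simp only [isEdge, List.any_eq_true, List.mem_range, alphA_encode, alphB_encode]
  constructor
  · rintro ⟨x, hx, y, hy, h⟩
    exact ⟨⟨x, hx⟩, ⟨y, hy⟩, by rw [← entry_encode]; exact h⟩
  · rintro ⟨x, y, h⟩
    exact ⟨x, x.2, y, y.2, by rw [entry_encode]; exact h⟩

theorem deg_encode {d : ℕ} (hd : ∀ v, (I.supergraph.neighborSet v).ncard = d) (h : 0 < I.nA) :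
    I.encode.deg = d := by
  classical
  rw [← hd (.inl ⟨0, h⟩), ← card_filter_fst_edges, deg, sizeB_encode, List.countP_eq_length_filter,
    ← List.toFinset_card_of_nodup (List.nodup_range.filter _)]
  symm
  refine Finset.card_bij (fun e _ => (e.2 : ℕ)) ?_ ?_ ?_
  · rintro ⟨a, b⟩ h'
    obtain ⟨h1, rfl⟩ := Finset.mem_filter.1 h'
    have h2 := I.isEdge_encode ⟨0, h⟩ b
    simp only at h2
    simp [h2, mem_edges.1 h1]
  · rintro ⟨a, b⟩ h1 ⟨a', b'⟩ h2 h3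
    rw [Finset.mem_filter] at h1 h2
    obtain ⟨-, rfl⟩ := h1
    obtain ⟨-, rfl⟩ := h2
    rw [Fin.ext (show (b : ℕ) = b' from h3)]
  · intro b hb
    simp only [List.mem_toFinset, List.mem_filter, List.mem_range] at hb
    have h2 := I.isEdge_encode ⟨0, h⟩ ⟨b, hb.1⟩
    simp only at h2
    rw [h2, decide_eq_true_iff] at hb
    exact ⟨(⟨0, h⟩, ⟨b, hb.1⟩), Finset.mem_filter.2 ⟨mem_edges.2 hb.2, rfl⟩, rfl⟩

/-- The set of pairs described by a list of truth values. -/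
def selected (w : BinTree) : Finset (Fin I.nA × Fin I.nB) :=
  Finset.univ.filter fun e => (w.get (e.2 + I.nB * e.1)).toBool

variable {I}

theorem isKept_encode {w : BinTree} (a : Fin I.nA) (b : Fin I.nB) :
    I.encode.isKept w a b = true ↔ (I.restrict (I.selected w)).Edge a b := by
  rw [restrict_edge]
  simp [isKept, selected]

/-- The numbers of the vertices. -/
def number : Fin I.nA ⊕ Fin I.nB → ℕ
  | .inl a => a
  | .inr b => I.nA + b

theorem number_lt (v : Fin I.nA ⊕ Fin I.nB) : number v < I.nA + I.nB := by
  rcases v with a | b <;> simp only [number] <;> omega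

theorem number_injective : Function.Injective (number (I := I)) := by
  rintro (a | b) (a' | b') h <;> simp only [number] at h
  · rw [Fin.ext h]
  · omega
  · omega
  · rw [Fin.ext (Nat.add_left_cancel h)]

theorem exists_number_eq {i : ℕ} (hi : i < I.nA + I.nB) :
    ∃ v : Fin I.nA ⊕ Fin I.nB, number v = i := by
  rcases lt_or_ge i I.nA with h | h
  · exact ⟨.inl ⟨i, h⟩, rfl⟩
  · exact ⟨.inr ⟨i - I.nA, by omega⟩, by simp only [number]; omega⟩

/-- The kept edges other than `(a, b)`. -/
def keptGraph (I : LabelCover) (S : Finset (Fin I.nA × Fin I.nB)) (a : Fin I.nA) (b : Fin I.nB) :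
    SimpleGraph (Fin I.nA ⊕ Fin I.nB) :=
  (I.restrict S).supergraph.deleteEdges {s(.inl a, .inr b)}

theorem keptGraph_adj {S : Finset (Fin I.nA × Fin I.nB)} {a a' : Fin I.nA} {b b' : Fin I.nB} :
    (I.keptGraph S a b).Adj (.inl a') (.inr b') ↔
      (I.restrict S).Edge a' b' ∧ ¬ (a' = a ∧ b' = b) := by
  have h : s(.inl a', .inr b') ∈ ({s(.inl a, .inr b)} : Set (Sym2 (Fin I.nA ⊕ Fin I.nB))) ↔
      a' = a ∧ b' = b := by simp
  exact deleteEdges_adj.trans (and_congr Iff.rfl (not_congr h))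

theorem isArc_encode {w : BinTree} {a : Fin I.nA} {b : Fin I.nB} (u v : Fin I.nA ⊕ Fin I.nB) :
    (I.encode.isArc w a b (number u) (number v) || I.encode.isArc w a b (number v) (number u)) =
      true ↔ (I.keptGraph (I.selected w) a b).Adj u v := by
  have key : ∀ (a' : Fin I.nA) (b' : Fin I.nB),
      (I.encode.isKept w a' b' && !(decide ((a' : ℕ) = a) && decide ((b' : ℕ) = b))) = true ↔
      (I.restrict (I.selected w)).Edge a' b' ∧ ¬ (a' = a ∧ b' = b) := by
    intro a' b'
    rw [Bool.and_eq_true, isKept_encode]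
    refine and_congr Iff.rfl ?_
    simp only [Bool.not_eq_true', Bool.and_eq_false_iff, decide_eq_false_iff_not, Fin.ext_iff]
    tauto
  rcases u with a' | b' <;> rcases v with a'' | b''
  · simp only [isArc, number, sizeA_encode, a'.2, a''.2, decide_true, Bool.not_true, Bool.and_false,
      Bool.false_and, Bool.or_self, Bool.false_eq_true, false_iff, keptGraph]
    exact fun h => h.1
  · simp only [isArc, number, sizeA_encode, a'.2, decide_true, Bool.true_and,
      Nat.not_lt.2 (Nat.le_add_right I.nA b''), decide_false, Bool.not_false,
      Nat.add_sub_cancel_left, Bool.false_and, Bool.or_false]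
    refine Iff.trans (key a' b'') ?_
    exact keptGraph_adj.symm
  · simp only [isArc, number, sizeA_encode, a''.2, decide_true, Bool.true_and,
      Nat.not_lt.2 (Nat.le_add_right I.nA b'), decide_false, Bool.not_false,
      Nat.add_sub_cancel_left, Bool.false_and, Bool.false_or]
    refine Iff.trans (key a'' b') ?_
    exact keptGraph_adj.symm.trans (adj_comm _ _ _)
  · simp only [isArc, number, sizeA_encode, Nat.not_lt.2 (Nat.le_add_right I.nA b''),
      Nat.not_lt.2 (Nat.le_add_right I.nA b'), decide_false, Bool.false_and, Bool.or_self,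
      Bool.false_eq_true, false_iff, keptGraph]
    exact fun h => h.1

/-- The search runs backwards from b; each round is one application of `Walk.exists_length_le_succ`.
-/
theorem reachable_encode {w : BinTree} {a : Fin I.nA} {b : Fin I.nB} (k : ℕ)
    (v : Fin I.nA ⊕ Fin I.nB) :
    ((I.encode.reachable w a b k).get (number v)).toBool = true ↔
      ∃ p : (I.keptGraph (I.selected w) a b).Walk v (.inr b), p.length ≤ k := by
  have hlt : ∀ v : Fin I.nA ⊕ Fin I.nB, number v < I.encode.sizeA + I.encode.sizeB := by
    simpa using number_lt
  induction k generalizing v with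
  | zero =>
    rw [reachable, Function.iterate_zero, id, get_tabulate _ (hlt v), toBool_ofBool,
      decide_eq_true_iff, sizeA_encode]
    constructor
    · intro h
      obtain rfl : v = .inr b := number_injective h
      exact ⟨.nil, le_rfl⟩
    · rintro ⟨p, hp⟩
      rw [Walk.eq_of_length_eq_zero (Nat.le_zero.1 hp)]
      rfl
  | succ k ih =>
    rw [reachable, Function.iterate_succ_apply', ← reachable, expand, get_tabulate _ (hlt v),
      toBool_ofBool, Bool.or_eq_true, Walk.exists_length_le_succ]
    refine or_congr (ih v) ?_
    simp only [List.any_eq_true, List.mem_range, Bool.and_eq_true]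
    constructor
    · rintro ⟨i, hi, h1, h2⟩
      rw [sizeA_encode, sizeB_encode] at hi
      obtain ⟨u, rfl⟩ := exists_number_eq hi
      exact ⟨u, (isArc_encode v u).1 h1, (ih u).1 h2⟩
    · rintro ⟨u, h1, h2⟩
      exact ⟨number u, hlt u, (isArc_encode v u).2 h1, (ih u).2 h2⟩

theorem survives_encode {w : BinTree} {k : ℕ} (a : Fin I.nA) (b : Fin I.nB) :
    I.encode.survives w k a b = true ↔ I.Edge a b ∧ (a, b) ∈ I.selected w ∧
      ¬ (I.restrict (I.selected w)).OnShortCycle k a b := by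
  have h1 : (I.restrict (I.selected w)).OnShortCycle k a b ↔
      (I.restrict (I.selected w)).Edge a b ∧
        ∃ p : (I.keptGraph (I.selected w) a b).Walk (.inl a) (.inr b), p.length ≤ k - 1 :=
    onShortCycle_iff_deleteEdges
  have h2 := reachable_encode (w := w) (a := a) (b := b) (k - 1) (.inl a)
  change ((I.encode.reachable w a b (k - 1)).get a).toBool = true ↔ _ at h2
  rw [survives, Bool.and_eq_true, isKept_encode, Bool.not_eq_true', ← Bool.not_eq_true, h2, h1,
    restrict_edge]
  tauto

/-- Links the two sides of the reduction: what the program computes on trees encodes exactly the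
sparsified instance analysed above. -/
theorem sparsify_encode (w : BinTree) (k : ℕ) :
    I.encode.sparsify w k = (I.sparsify k (I.selected w)).encode := by
  have h : ∀ (a : Fin I.nA) (b : Fin I.nB) (x : Fin I.qA) (y : Fin I.qB),
      (I.encode.entry a b x y && I.encode.survives w k a b) =
        (I.sparsify k (I.selected w)).rel a b x y := by
    intro a b x y
    rw [Bool.eq_iff_iff, sparsify_rel, Bool.and_eq_true, survives_encode, entry_encode]
    exact ⟨fun h => ⟨h.1, h.2.2⟩, fun h => ⟨h.1, ⟨x, y, h.1⟩, h.2⟩⟩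
  simp only [BinTree.sparsify, tabulate_eq_ofTable, sizeA_encode, sizeB_encode, alphA_encode,
    alphB_encode, h]
  rfl

end LabelCover

/-! ### Random programs -/

namespace Prog

/-- `c` halts within `n` steps from `σ`; the outcome is described by a random value `b` with
distribution `μ`, in the sense that the final store satisfies `Q b`. -/
def Samples {β : Type} (c : Prog) (n : ℕ) (σ : Store) (μ : PMF β) (Q : β → Store → Prop) : Prop :=
  ∀ (K : List Prog) (m : ℕ) (ν : β → PMF Bool), (∀ b σ', Q b σ' → Yields m ⟨K, σ'⟩ (ν b)) →
    Yields (n + m) ⟨c :: K, σ⟩ (μ.bind ν)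

theorem yields_of_step_pure {n : ℕ} {γ γ' : Config} {ν : PMF Bool} (h : step γ = PMF.pure γ')
    (hγ : Yields n γ' ν) : Yields (n + 1) γ ν := by
  have := Yields.of_step (n := n) (γ := γ) (ν := fun _ => ν) fun γ'' h'' => by
    rw [h, PMF.support_pure, Set.mem_singleton_iff] at h''
    rwa [h'']
  simpa using this

namespace Samples

variable {β δ : Type} {c d : Prog} {n m : ℕ} {σ : Store}

theorem mono_time {μ : PMF β} {Q : β → Store → Prop} (h : c.Samples n σ μ Q) (hnm : n ≤ m) :
    c.Samples m σ μ Q :=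
  fun K k ν hK => (h K k ν hK).mono_time (by omega)

theorem mono {μ : PMF β} {Q R : β → Store → Prop} (h : c.Samples n σ μ Q)
    (hQ : ∀ b σ, Q b σ → R b σ) : c.Samples n σ μ R :=
  fun K k ν hK => h K k ν fun b σ' h' => hK b σ' (hQ b σ' h')

theorem of_ends {R : Store → Prop} (f : Store → β) (h : c.Ensures n σ R) :
    c.Samples n σ ((steps n ⟨[c], σ⟩).map fun γ => f γ.store) (fun b σ' => R σ' ∧ f σ' = b) :=
  fun _ _ _ hK => Yields.append f h fun σ' h' => hK _ σ' ⟨h', rfl⟩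

theorem of_ensures {R : β → Store → Prop} (b : β) (h : c.Ensures n σ (R b)) :
    c.Samples n σ (PMF.pure b) R := by
  intro K m ν hK
  rw [PMF.pure_bind]
  exact Yields.append_const (γ := ⟨[c], σ⟩) h fun σ' h' => hK b σ' h'

/-- The continuation of the first program begins with the second, so the claim is associativity of
`PMF.bind`; the extra step unfolds the sequencing. -/
theorem seq {μ : PMF β} {κ : β → PMF δ} {R : β → Store → Prop} {Q : δ → Store → Prop}
    (h : c.Samples n σ μ R) (hd : ∀ b σ', R b σ' → d.Samples m σ' (κ b) Q) :
    (Prog.seq c d).Samples (n + m + 1) σ (μ.bind κ) Q := by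
  intro K k ν hK
  have h1 := h (d :: K) (m + k) (fun b => (κ b).bind ν) fun b σ' h' => hd b σ' h' K k ν hK
  rw [PMF.bind_bind]
  exact (yields_of_step_pure rfl h1).mono_time (by omega)

theorem seq_ensures {μ : PMF β} {R : Store → Prop} {Q : β → Store → Prop} (h : c.Ensures n σ R)
    (hd : ∀ σ', R σ' → d.Samples m σ' μ Q) : (Prog.seq c d).Samples (n + m + 1) σ μ Q := by
  have := (of_ensures (R := fun _ => R) () h).seq (κ := fun _ => μ) fun _ => hd
  rwa [PMF.pure_bind] at this

theorem toss (x : ℕ) : (Prog.toss x).Samples 1 σ (PMF.uniformOfFintype Bool)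
    (fun b σ' => σ' = Function.update σ x (.ofBool b)) := by
  intro K m ν hK
  have h := Yields.of_step (n := m) (γ := ⟨Prog.toss x :: K, σ⟩)
    (ν := fun γ => (steps m γ).map fun γ => (γ.store 0).toBool) fun γ' h' => by
      rw [step, PMF.mem_support_map_iff] at h'
      obtain ⟨b, -, rfl⟩ := h'
      exact ⟨(hK b _ rfl).1, rfl⟩
  rw [step, PMF.bind_map] at h
  rw [add_comm]
  convert h using 2
  funext b
  exact (hK b _ rfl).2.symm

/-- Iteration of a random transition. -/
noncomputable def iter (κ : β → PMF β) : ℕ → β → PMF β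
  | 0, b => PMF.pure b
  | k + 1, b => (κ b).bind (iter κ k)

theorem loop {x : ℕ} (κ : β → PMF β) (I : β → BinTree → Store → Prop)
    (hx : ∀ b l σ, I b l σ → σ x = l)
    (hc : ∀ e l b σ, I b (.cons e l) σ → c.Samples n σ (κ b) (fun b' => I b' l)) (l : BinTree) :
    ∀ b σ, I b l σ → (Prog.loop x c).Samples (l.len * (n + 1) + 1) σ (iter κ l.len b)
      (fun b' => I b' .nil) := by
  induction l with
  | nil =>
    intro b σ h K m ν hK
    have h1 := hK b σ h
    simp only [BinTree.len, iter, PMF.pure_bind, zero_mul, zero_add]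
    rw [add_comm]
    refine yields_of_step_pure ?_ h1
    simp [step, hx _ _ _ h, BinTree.toBool]
  | cons e l _ ih =>
    intro b σ h K m ν hK
    have h1 := hc e l b σ h (Prog.loop x c :: K) (l.len * (n + 1) + 1 + m)
      (fun b' => (iter κ l.len b').bind ν) fun b' σ' h' => ih b' σ' h' K m ν hK
    rw [BinTree.len, iter, PMF.bind_bind]
    refine (yields_of_step_pure (γ := ⟨Prog.loop x c :: K, σ⟩) ?_ h1).mono_time
      (by ring_nf; omega)
    simp [step, hx _ _ _ h, BinTree.toBool]

theorem yields {μ : PMF Bool} (h : c.Samples n σ μ (fun b σ' => (σ' 0).toBool = b)) :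
    Yields n ⟨[c], σ⟩ μ := by
  have := h [] 0 PMF.pure fun b σ' h' => ⟨ends_zero.2 ⟨rfl, trivial⟩, by
    rw [steps, PMF.pure_map, h']⟩
  simpa using this

end Samples

/-! ### Sampling a list of biased truth values -/

/-- A fair coin, combined with a truth value. -/
noncomputable def coinAnd (b : Bool) : PMF Bool :=
  (PMF.uniformOfFintype Bool).bind fun c => PMF.pure (c && b)

/-- `true` with probability `2⁻ᵗ`, put in front of a list. -/
noncomputable def consBiased (t : ℕ) (L : List Bool) : PMF (List Bool) :=
  (Samples.iter coinAnd t true).bind fun b => PMF.pure (b :: L)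

/-- The list of the truth values. -/
def bits (L : List Bool) : BinTree := .ofList (L.map .ofBool)

theorem size_bits_le (L : List Bool) : (bits L).size ≤ 2 * L.length := by
  have := BinTree.size_ofList_le (L := L.map .ofBool) (b := 1) (by
    simp only [List.mem_map]
    rintro _ ⟨b, -, rfl⟩
    exact BinTree.size_ofBool_le b)
  rw [List.length_map] at this
  rw [bits]
  omega

/-- Sets variable `40` to a biased truth value, after as many coin tosses as there are entries in
variable `24`. -/
def sampleBit : Prog :=
  seq (setNil 40) (seq (cons 40 40 40) (seq (copy 48 24)
    (loop 48 (seq (toss 56) (seq (branch 56 (copy 40 40) (setNil 40)) (tl 48 48))))))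

/-- Sets variable `32` to a list of biased truth values with as many entries as variable `16`. -/
def sampleBits : Prog :=
  seq (setNil 32) (loop 16 (seq sampleBit (seq (cons 32 40 32) (tl 16 16))))

theorem samples_sampleBit {σ : Store} {t : ℕ} (ht : σ 24 = .ofNat t) :
    sampleBit.Samples (7 * t + 10) σ (Samples.iter coinAnd t true) (fun b σ' =>
      σ' 40 = .ofBool b ∧ ∀ i, i ≠ 40 → i ≠ 48 → i ≠ 56 → σ' i = σ i) := by
  let I : Bool → BinTree → Store → Prop := fun b l σ' => σ' 48 = l ∧ σ' 40 = .ofBool b ∧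
    ∀ i, i ≠ 40 → i ≠ 48 → i ≠ 56 → σ' i = σ i
  have hloop := Samples.loop (x := 48) (n := 6)
    (c := seq (toss 56) (seq (branch 56 (copy 40 40) (setNil 40)) (tl 48 48))) coinAnd I
    (fun b l σ' h => h.1) (fun e l b σ' h => by
      refine (Samples.seq (m := 4) (Samples.toss 56) ?_).mono_time le_rfl
      rintro c _ rfl
      refine Samples.of_ensures _ ?_
      refine Ensures.seq (n := 2) (m := 1) (R := fun σ'' => σ'' 40 = .ofBool (c && b) ∧
        ∀ i, i ≠ 40 → i ≠ 56 → σ'' i = σ' i) (ensures_branch ?_) ?_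
      · rw [Function.update_self, BinTree.toBool_ofBool]
        cases c
        · refine ensures_setNil ⟨by simp [BinTree.ofBool], fun i h1 h2 => ?_⟩
          simp [h1, h2]
        · refine ensures_copy ⟨by simp [h.2.1], fun i h1 h2 => ?_⟩
          simp [h1, h2]
      · rintro σ'' ⟨h1, h2⟩
        refine ensures_tl ⟨?_, ?_, fun i h3 h4 h5 => ?_⟩
        · rw [Function.update_self, h2 48 (by decide) (by decide), h.1]; rfl
        · simpa using h1
        · rw [Function.update_of_ne h4, h2 i h3 h5, h.2.2 i h3 h4 h5])
    (.ofNat t) true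
  rw [BinTree.len_ofNat] at hloop
  refine (Samples.seq_ensures (ensures_setNil (Q := (· = _)) rfl) (m := 1 + (1 + (t * (6 + 1) + 1) + 1)
    + 1) ?_).mono_time (by omega)
  rintro _ rfl
  refine Samples.seq_ensures (ensures_cons (Q := (· = _)) rfl) ?_
  rintro _ rfl
  refine Samples.seq_ensures (ensures_copy (Q := (· = _)) rfl) ?_
  rintro _ rfl
  refine (hloop _ ⟨?_, ?_, ?_⟩).mono fun b σ' h => h.2
  · simp [ht]
  · simp [BinTree.ofBool]
  · intro i h1 h2 h3
    simp [h1, h2]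

theorem samples_sampleBits {σ : Store} {t N : ℕ} (ht : σ 24 = .ofNat t) (hN : σ 16 = .ofNat N) :
    sampleBits.Samples (N * (7 * t + 15) + 3) σ (Samples.iter (consBiased t) N [])
      (fun L σ' => σ' 32 = bits L ∧ L.length = N ∧
        ∀ i, i ≠ 16 → i ≠ 32 → i ≠ 40 → i ≠ 48 → i ≠ 56 → σ' i = σ i) := by
  let I : List Bool → BinTree → Store → Prop := fun L l σ' => σ' 16 = l ∧ σ' 32 = bits L ∧
    L.length + l.len = N ∧ ∀ i, i ≠ 16 → i ≠ 32 → i ≠ 40 → i ≠ 48 → i ≠ 56 → σ' i = σ i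
  have hloop := Samples.loop (x := 16) (n := 7 * t + 14)
    (c := seq sampleBit (seq (cons 32 40 32) (tl 16 16))) (consBiased t) I
    (fun b l σ' h => h.1) (fun e l L σ' h => by
      obtain ⟨h1, h2, h3, h4⟩ := h
      have h24 : σ' 24 = .ofNat t := by
        rw [h4 24 (by decide) (by decide) (by decide) (by decide) (by decide), ht]
      refine (Samples.seq (m := 3) (samples_sampleBit h24) ?_).mono_time le_rfl
      rintro b σ₁ ⟨h5, h6⟩
      refine Samples.of_ensures _ ?_
      refine Ensures.seq (n := 1) (m := 1) (ensures_cons (Q := (· = _)) rfl) ?_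
      rintro _ rfl
      refine ensures_tl ⟨?_, ?_, ?_, fun i g1 g2 g3 g4 g5 => ?_⟩
      · rw [Function.update_self, Function.update_of_ne (by decide),
          h6 16 (by decide) (by decide) (by decide), h1]
        rfl
      · rw [Function.update_of_ne (by decide), Function.update_self, h5,
          h6 32 (by decide) (by decide) (by decide), h2]
        rfl
      · rw [BinTree.len] at h3
        rw [List.length_cons]
        omega
      · rw [Function.update_of_ne g1, Function.update_of_ne g2, h6 i g3 g4 g5,
          h4 i g1 g2 g3 g4 g5])
    (.ofNat N) []
  rw [BinTree.len_ofNat] at hloop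
  refine (Samples.seq_ensures (ensures_setNil (Q := (· = _)) rfl)
    (m := N * (7 * t + 14 + 1) + 1) ?_).mono_time (by ring_nf; omega)
  rintro _ rfl
  refine (hloop _ ⟨?_, ?_, ?_, ?_⟩).mono fun b σ' h => ⟨h.2.1, by simpa [BinTree.len] using h.2.2.1,
    h.2.2.2⟩
  · simp [hN]
  · simp [bits, BinTree.ofList]
  · simp
  · intro i h1 h2 h3 h4 h5
    simp [h2]

end Prog

/-! ### Values computed in polynomial time -/

/-- The height of a tree. -/
def BinTree.depth : BinTree → ℕ
  | nil => 0
  | cons l r => max l.depth r.depth + 1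

@[simp] theorem BinTree.depth_ofNat (n : ℕ) : (BinTree.ofNat n).depth = n := by
  induction n with
  | zero => rfl
  | succ n ih => rw [ofNat_succ, depth, ih]; simp [depth]

namespace Prog

/-- Height is measured instead of size because a single `cons` can double the size of a tree, but
raises the height by at most one. -/
theorem depth_step_le {γ γ' : Config} {h : ℕ} (hγ : ∀ i, (γ.store i).depth ≤ h)
    (h' : γ' ∈ (step γ).support) (i : ℕ) : (γ'.store i).depth ≤ h + 1 := by
  have key : ∀ (x : ℕ) (v : BinTree), v.depth ≤ h + 1 →
      (Function.update γ.store x v i).depth ≤ h + 1 := by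
    intro x v hv
    rw [Function.update_apply]
    split_ifs
    · exact hv
    · exact (hγ i).trans (Nat.le_succ h)
  have hsub : ∀ t : BinTree, t.depth ≤ h → t.hd.depth ≤ h + 1 ∧ t.tl.depth ≤ h + 1 := by
    intro t ht
    cases t with
    | nil => simp [BinTree.hd, BinTree.tl, BinTree.depth]
    | cons l r =>
      rw [BinTree.depth] at ht
      simp only [BinTree.hd, BinTree.tl]
      omega
  obtain ⟨L, σ⟩ := γ
  cases L with
  | nil =>
    rw [step, PMF.support_pure, Set.mem_singleton_iff] at h'
    subst h'
    exact (hγ i).trans (Nat.le_succ h)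
  | cons c L =>
    cases c <;> simp only [step, PMF.support_pure, Set.mem_singleton_iff, PMF.mem_support_map_iff]
      at h'
    case toss x =>
      obtain ⟨b, -, rfl⟩ := h'
      refine key _ _ ?_
      cases b <;> simp [BinTree.ofBool, BinTree.depth]
    all_goals subst h'
    case setNil x => exact key _ _ (Nat.zero_le _)
    case copy x y => exact key _ _ ((hγ y).trans (Nat.le_succ h))
    case cons x y z =>
      refine key _ _ ?_
      rw [BinTree.depth]
      exact Nat.succ_le_succ (max_le (hγ y) (hγ z))
    case hd x y => exact key _ _ (hsub _ (hγ y)).1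
    case tl x y => exact key _ _ (hsub _ (hγ y)).2
    all_goals exact (hγ i).trans (Nat.le_succ h)

theorem depth_steps_le {γ γ' : Config} {h : ℕ} (n : ℕ) (hγ : ∀ i, (γ.store i).depth ≤ h)
    (h' : γ' ∈ (steps n γ).support) (i : ℕ) : (γ'.store i).depth ≤ h + n := by
  induction n generalizing γ h with
  | zero =>
    rw [steps, PMF.support_pure, Set.mem_singleton_iff] at h'
    rw [h']
    exact hγ i
  | succ n ih =>
    rw [steps, PMF.mem_support_bind_iff] at h'
    obtain ⟨γ'', h1, h2⟩ := h'
    have := ih (depth_step_le hγ h1) h2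
    omega

/-- The store in which a computation starts. -/
def start (input : BinTree) : Store := Function.update (fun _ => .nil) 0 input

end Prog

/-- A unary number is as high as it is large, and the height grows by at most one per step. Hence
the output is polynomially bounded, as later stages of the reduction require. -/
theorem PolyTimeComputable.exists_program {f : ℕ → ℕ} (hf : PolyTimeComputable f) :
    ∃ (c : Prog) (p : Polynomial ℕ), ∀ n, f n ≤ n + p.eval n ∧
      c.Ensures (p.eval n) (Prog.start (.ofNat n)) (fun σ => σ 0 = .ofNat (f n)) := by
  obtain ⟨c, p, h⟩ := hf
  refine ⟨c, p, fun n => ⟨?_, fun γ hγ => ⟨(h n).1 γ hγ, (h n).2 γ hγ⟩⟩⟩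
  obtain ⟨γ, hγ⟩ := (Prog.steps (p.eval n) (c.init (.ofNat n))).support_nonempty
  have h1 := Prog.depth_steps_le (h := n) _ (fun i => ?_) hγ 0
  · rwa [(h n).2 γ hγ, BinTree.depth_ofNat] at h1
  · by_cases hi : i = 0
    · simp [Prog.init, hi]
    · simp [Prog.init, hi, BinTree.depth]

namespace Prog

/-! ### Running several programs side by side -/

/-- The variables of the program number `j`. -/
def region (j x : ℕ) : ℕ := 8 * x + j

theorem region_injective (j : ℕ) : Function.Injective (region j) := fun x y h => by
  simp only [region] at h
  omega

theorem region_zero (j : ℕ) : region j 0 = j := by simp [region]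

theorem comp_region {σ : Store} {j : ℕ} {input : BinTree} (h0 : σ j = input)
    (hσ : ∀ i, σ (region j (i + 1)) = .nil) : σ ∘ region j = start input := by
  funext i
  cases i with
  | zero => simpa [start, region_zero] using h0
  | succ i => simpa [start] using hσ i

/-- The given programs are specified only for stores that are `nil` apart from the input. Therefore
each of them needs a fresh residue class modulo 8. -/
theorem Ensures.region {c : Prog} {n j : ℕ} {σ : Store} {input : BinTree} {Q : Store → Prop}
    (h : c.Ensures n (start input) Q) (h0 : σ j = input)
    (hσ : ∀ i, σ (region j (i + 1)) = .nil) :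
    (c.rename (region j)).Ensures n σ (fun σ' => (∃ τ, Q τ ∧ σ' j = τ 0) ∧
      ∀ i, i % 8 ≠ j % 8 → σ' i = σ i) := by
  rw [← comp_region h0 hσ] at h
  refine (Ensures.rename (region_injective j) h).mono ?_
  rintro _ ⟨τ, hτ, rfl⟩
  refine ⟨⟨τ, hτ, ?_⟩, fun i hi => ?_⟩
  · have h5 := (region_injective j).extend_apply τ σ 0
    rwa [region_zero] at h5
  · rw [Function.extend_apply']
    rintro ⟨x, rfl⟩
    simp only [Prog.region] at hi
    omega

/-- The distribution of the answer of a program. -/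
noncomputable def answer (c : Prog) (input : BinTree) (n : ℕ) : PMF Bool :=
  (steps n (init c input)).map fun γ => (γ.store 0).toBool

/-- Only the distribution of the answer bit is recorded; the other classes are unaffected, so later
runs find their inputs and fresh variables intact. -/
theorem samples_region {c : Prog} {n m j : ℕ} {σ : Store} {input : BinTree}
    (h : c.HaltsWithin input n) (hnm : n ≤ m) (h0 : σ j = input)
    (hσ : ∀ i, σ (region j (i + 1)) = .nil) :
    (c.rename (region j)).Samples m σ (answer c input n)
      (fun b σ' => (σ' j).toBool = b ∧ ∀ i, i % 8 ≠ j % 8 → σ' i = σ i) := by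
  have h1 : c.Ensures n (start input) (fun _ => True) := fun γ hγ => ⟨h γ hγ, trivial⟩
  have h2 := Samples.of_ends (fun σ' => (σ' j).toBool) (h1.region h0 hσ)
  have h3 : steps n ⟨[c.rename (region j)], σ⟩ =
      (steps n (init c input)).map (Config.rename (region j) σ) := by
    rw [← steps_rename (region_injective j)]
    congr 1
    simp only [Config.rename, init, List.map_cons, List.map_nil, Config.mk.injEq, true_and]
    change σ = Function.extend (region j) (start input) σ
    rw [← comp_region h0 hσ]
    funext i
    by_cases hi : ∃ x, region j x = i
    · obtain ⟨x, rfl⟩ := hi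
      rw [(region_injective j).extend_apply, Function.comp]
    · rw [Function.extend_apply' _ _ _ hi]
  have h4 : (steps n ⟨[c.rename (region j)], σ⟩).map (fun γ => (γ.store j).toBool) =
      answer c input n := by
    rw [h3, PMF.map_comp, answer]
    congr 1
    funext γ
    have := (region_injective j).extend_apply γ.store σ 0
    rw [region_zero] at this
    simp [Config.rename, this]
  rw [h4] at h2
  exact (h2.mono fun b σ' h' => ⟨h'.2, h'.1.2⟩).mono_time hnm

/-- The majority of three answers. -/
noncomputable def majority (μ : PMF Bool) : PMF Bool :=
  μ.bind fun b₁ => μ.bind fun b₂ => μ.bind fun b₃ =>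
    PMF.pure (bif b₁ then b₂ || b₃ else b₂ && b₃)

/-- Runs `c` three times on the value of variable `4`, and takes the majority of the answers. -/
def vote (c : Prog) : Prog :=
  seq (copy 5 4) (seq (copy 6 4) (seq (copy 7 4) (seq (c.rename (region 5))
    (seq (c.rename (region 6)) (seq (c.rename (region 7))
      (branch 5 (branch 6 (copy 0 5) (copy 0 7)) (branch 6 (copy 0 7) (copy 0 5))))))))

theorem samples_vote {c : Prog} {n m : ℕ} {σ : Store} {input : BinTree}
    (h : c.HaltsWithin input n) (hnm : n ≤ m) (h4 : σ 4 = input)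
    (hσ : ∀ i, 8 ≤ i → 5 ≤ i % 8 → σ i = .nil) :
    (vote c).Samples (3 * m + 12) σ (majority (answer c input n))
      (fun b σ' => (σ' 0).toBool = b) := by
  refine (Samples.seq_ensures (ensures_copy (Q := (· = _)) rfl) (m := 1 + (1 + (m + (m + (m + 3 + 1)
    + 1) + 1) + 1) + 1) ?_).mono_time (by omega)
  rintro _ rfl
  refine Samples.seq_ensures (ensures_copy (Q := (· = _)) rfl) ?_
  rintro _ rfl
  refine Samples.seq_ensures (ensures_copy (Q := fun σ' => σ' 5 = input ∧ σ' 6 = input ∧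
    σ' 7 = input ∧ ∀ i, 8 ≤ i → 5 ≤ i % 8 → σ' i = .nil) ?_) ?_
  · refine ⟨by simp [h4], by simp [h4], by simp [h4], fun i h1 h2 => ?_⟩
    rw [Function.update_of_ne (by omega), Function.update_of_ne (by omega),
      Function.update_of_ne (by omega), hσ i h1 h2]
  rintro σ₀ ⟨a5, a6, a7, a8⟩
  refine Samples.seq (samples_region h hnm a5 fun i => a8 _ (by simp only [region]; omega)
    (by simp only [region]; omega)) ?_
  rintro b₁ σ₁ ⟨c1, f1⟩
  refine Samples.seq (samples_region h hnm (by rw [f1 6 (by decide), a6]) fun i => ?_) ?_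
  · rw [f1 _ (by simp only [region]; omega)]
    exact a8 _ (by simp only [region]; omega) (by simp only [region]; omega)
  rintro b₂ σ₂ ⟨c2, f2⟩
  refine Samples.seq (samples_region h hnm (by rw [f2 7 (by decide), f1 7 (by decide), a7])
    fun i => ?_) ?_
  · rw [f2 _ (by simp only [region]; omega), f1 _ (by simp only [region]; omega)]
    exact a8 _ (by simp only [region]; omega) (by simp only [region]; omega)
  rintro b₃ σ₃ ⟨c3, f3⟩
  refine Samples.of_ensures _ (ensures_branch (n := 2) ?_)
  have e5 : (σ₃ 5).toBool = b₁ := by rw [f3 5 (by decide), f2 5 (by decide), c1]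
  have e6 : (σ₃ 6).toBool = b₂ := by rw [f3 6 (by decide), c2]
  rw [e5]
  cases b₁
  · refine ensures_branch (n := 1) ?_
    rw [e6]
    cases b₂
    · exact ensures_copy (by simp [e5])
    · exact ensures_copy (by simp [c3])
  · refine ensures_branch (n := 1) ?_
    rw [e6]
    cases b₂
    · exact ensures_copy (by simp [c3])
    · exact ensures_copy (by simp [e5])

end Prog

/-! ### The reduction as a program -/

theorem PolyTree.program_region {f : BinTree → BinTree} (hf : PolyTree f) :
    ∃ (c : Prog) (p : Polynomial ℕ),
      (∀ j σ, (c.rename (Prog.region j)).Ensures (p.eval (σ j).size) σ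
        (fun σ' => σ' j = f (σ j) ∧ ∀ i, i % 8 ≠ j % 8 → σ' i = σ i)) ∧
      ∀ x, (f x).size ≤ p.eval x.size := by
  obtain ⟨c, p, hc, hs⟩ := hf.program
  refine ⟨c, p, fun j σ => ?_, hs⟩
  have h := hc _ (Prog.region_injective j) σ
  rw [Prog.region_zero] at h
  refine h.mono fun σ' h' => ⟨h'.1, fun i hi => h'.2 i fun x hx => hi ?_⟩
  simp only [Prog.region] at hx
  omega

namespace Prog

/-- Computes the parameters of the reduction: the approximation of `α` by `ca`, and the numbers of
random bits and of tosses per bit by `ct`. -/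
def prepare (cn ca ct : Prog) : Prog :=
  seq (copy 1 0) (seq (cn.rename (region 1)) (seq (copy 2 1) (seq (ca.rename (region 2))
    (seq (cons 8 0 2) (seq (copy 3 8) (seq (ct.rename (region 3)) (seq (hd 16 3) (tl 24 3))))))))

/-- Variable 0 keeps the instance, the residues 1, 2, 3 hold the computations of n, a, and the pair
of N and t; positive multiples of 8 store the results. The residues 5, 6, 7 stay `nil` from 8 on, as
needed for three independent runs. -/
theorem ensures_prepare {cn ca ct : Prog} {x : BinTree} {n a N t T₁ T₂ T₃ : ℕ}
    (hn : ∀ σ : Store, σ 1 = x → (cn.rename (region 1)).Ensures T₁ σ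
      (fun σ' => σ' 1 = .ofNat n ∧ ∀ i, i % 8 ≠ 1 → σ' i = σ i))
    (ha : ca.Ensures T₂ (start (.ofNat n)) (fun σ => σ 0 = .ofNat a))
    (ht : ∀ σ : Store, σ 3 = .cons x (.ofNat a) → (ct.rename (region 3)).Ensures T₃ σ
      (fun σ' => σ' 3 = .cons (.ofNat N) (.ofNat t) ∧ ∀ i, i % 8 ≠ 3 → σ' i = σ i)) :
    (prepare cn ca ct).Ensures (T₁ + T₂ + T₃ + 14) (start x) (fun σ =>
      σ 8 = .cons x (.ofNat a) ∧ σ 16 = .ofNat N ∧ σ 24 = .ofNat t ∧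
        ∀ i, 8 ≤ i → 5 ≤ i % 8 → σ i = .nil) := by
  refine (Ensures.seq (ensures_copy (Q := (· = _)) rfl) (m := T₁ + (1 + (T₂ + (1 + (1 + (T₃ +
    (1 + 1 + 1) + 1) + 1) + 1) + 1) + 1) + 1) ?_).mono_time (by omega)
  rintro _ rfl
  have s0 : start x 0 = x := by simp [start]
  have s1 : ∀ i, 2 ≤ i → Function.update (start x) 1 (start x 0) i = .nil := fun i hi => by
    rw [Function.update_of_ne (by omega), start, Function.update_of_ne (by omega)]
  refine Ensures.seq (hn _ (by simp [s0])) ?_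
  rintro σ₁ ⟨a1, f1⟩
  refine Ensures.seq (ensures_copy (Q := (· = _)) rfl) ?_
  rintro _ rfl
  refine Ensures.seq (Ensures.region (j := 2) ha (by simp [a1]) fun i => ?_) ?_
  · rw [Function.update_of_ne (by simp only [region]; omega), f1 _ (by simp only [region]; omega),
      s1 _ (by simp only [region]; omega)]
  rintro σ₂ ⟨⟨τ, hτ, a2⟩, f2⟩
  have g0 : σ₂ 0 = x := by
    rw [f2 0 (by decide), Function.update_of_ne (by decide), f1 0 (by decide)]
    simp [s0]
  have g : ∀ i, 8 ≤ i → 5 ≤ i % 8 → σ₂ i = .nil := fun i h1 h2 => by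
    rw [f2 i (by omega), Function.update_of_ne (by omega), f1 i (by omega), s1 i (by omega)]
  refine Ensures.seq (ensures_cons (Q := (· = _)) rfl) ?_
  rintro _ rfl
  refine Ensures.seq (ensures_copy (Q := (· = _)) rfl) ?_
  rintro _ rfl
  refine Ensures.seq (ht _ (by simp [g0, a2, hτ])) ?_
  rintro σ₃ ⟨a3, f3⟩
  refine Ensures.seq (n := 1) (m := 1) (ensures_hd (Q := (· = _)) rfl) ?_
  rintro _ rfl
  refine ensures_tl ⟨?_, ?_, ?_, fun i h1 h2 => ?_⟩
  · rw [Function.update_of_ne (by decide), Function.update_of_ne (by decide), f3 8 (by decide)]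
    simp [g0, a2, hτ]
  · simp [a3, BinTree.hd]
  · simp [a3, BinTree.tl]
  · rw [Function.update_of_ne (by omega), Function.update_of_ne (by omega), f3 i (by omega),
      Function.update_of_ne (by omega), Function.update_of_ne (by omega), g i h1 h2]

/-- Sparsifies the instance with random bits, by `cf`, and runs `c` three times on the result. -/
def reduce (cn ca ct cf c : Prog) : Prog :=
  seq (prepare cn ca ct) (seq sampleBits (seq (cons 64 8 32) (seq (copy 4 64)
    (seq (cf.rename (region 4)) (vote c)))))

theorem samples_reduce {cn ca ct cf c : Prog} {x y : BinTree} {N t T T' m : ℕ} {n : BinTree → ℕ}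
    {f : BinTree → BinTree}
    (hp : (prepare cn ca ct).Ensures T (start x) (fun σ =>
      σ 8 = y ∧ σ 16 = .ofNat N ∧ σ 24 = .ofNat t ∧ ∀ i, 8 ≤ i → 5 ≤ i % 8 → σ i = .nil))
    (hf : ∀ (L : List Bool) (σ : Store), L.length = N → σ 4 = .cons y (bits L) →
      (cf.rename (region 4)).Ensures T' σ (fun σ' => σ' 4 = f (bits L) ∧
        ∀ i, i % 8 ≠ 4 → σ' i = σ i))
    (hc : ∀ L : List Bool, L.length = N → c.HaltsWithin (f (bits L)) (n (bits L)) ∧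
      n (bits L) ≤ m) :
    (reduce cn ca ct cf c).Samples (T + N * (7 * t + 15) + T' + 3 * m + 22) (start x)
      ((Samples.iter (consBiased t) N []).bind fun L =>
        majority (answer c (f (bits L)) (n (bits L)))) (fun b σ => (σ 0).toBool = b) := by
  refine (Samples.seq_ensures hp (m := N * (7 * t + 15) + 3 +
    (1 + (1 + (T' + (3 * m + 12) + 1) + 1) + 1) + 1) ?_).mono_time (by omega)
  rintro σ ⟨h8, h16, h24, hσ⟩
  refine Samples.seq (samples_sampleBits h24 h16) ?_
  rintro L σ₁ ⟨b1, hL, f1⟩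
  refine Samples.seq_ensures (ensures_cons (Q := (· = _)) rfl) ?_
  rintro _ rfl
  refine Samples.seq_ensures (ensures_copy (Q := (· = _)) rfl) ?_
  rintro _ rfl
  refine Samples.seq_ensures (hf L _ hL ?_) ?_
  · simp [b1, f1 8 (by decide) (by decide) (by decide) (by decide) (by decide), h8]
  rintro σ₂ ⟨b2, f2⟩
  refine samples_vote (hc L hL).1 (hc L hL).2 b2 fun i h1 h2 => ?_
  rw [f2 i (by omega), Function.update_of_ne (by omega), Function.update_of_ne (by omega),
    f1 i (by omega) (by omega) (by omega) (by omega) (by omega), hσ i h1 h2]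

end Prog

namespace LabelCover

/-- The instance that the random bits `L` select. -/
noncomputable def sample (I : LabelCover) (a : ℕ) (L : List Bool) : LabelCover :=
  I.sparsify (I.encode.cycleBound a) (I.selected (Prog.bits L))

end LabelCover

open Prog in
/-- Sampling a sparsified instance and running an algorithm for Min-Rep on it takes polynomial time. -/
theorem exists_reduction {a : ℕ → ℕ} (ha : PolyTimeComputable a) {c : Prog} {p : Polynomial ℕ}
    (hc : ∀ I : LabelCover, c.HaltsWithin I.encode (p.eval I.encode.size)) :
    ∃ (P : Prog) (T : Polynomial ℕ), ∀ I : LabelCover,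
      P.Samples (T.eval I.encode.size) (start I.encode)
        ((Samples.iter (consBiased (I.encode.coins (a I.order))) (I.nA * I.nB) []).bind fun L =>
          majority (answer c (I.sample (a I.order) L).encode
            (p.eval (I.sample (a I.order) L).encode.size))) (fun b σ => (σ 0).toBool = b) := by
  obtain ⟨ca, pa, hca⟩ := ha.exists_program
  have e : PolyTree fun x => x := PolyTree.id
  have e1 : PolyNat fun z => z.tl.len := PolyTree.tl.len
  obtain ⟨cn, pn, hcn, hpn⟩ := PolyTree.program_region (e.sizeA.add e.sizeB)
  obtain ⟨ct, pt, hct, hpt⟩ := PolyTree.program_region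
    ((PolyTree.hd.sizeA.mul PolyTree.hd.sizeB).cons (PolyTree.hd.coins e1))
  obtain ⟨cf, pf, hcf, hpf⟩ := PolyTree.program_region
    ((PolyTree.hd.comp PolyTree.hd).sparsify PolyTree.tl
      ((PolyTree.hd.comp PolyTree.hd).cycleBound (e1.comp PolyTree.hd)))
  -- The polynomial A bounds a(n), M the numbers of bits and of tosses per bit, and H the time and
  -- output size of the sparsification.
  let A := pn + pa.comp pn
  let M := pt.comp (Polynomial.X + A + 1)
  let H := pf.comp (Polynomial.X + A + 1 + 2 * M + 1)
  refine ⟨reduce cn ca ct cf c, pn + pa.comp pn + M + 14 + M * (7 * M + 15) + H + 3 * p.comp H + 22,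
    fun I => ?_⟩
  set s := I.encode.size with hs
  have b1 : I.order ≤ pn.eval s := by simpa [LabelCover.order] using hpn I.encode
  have b2 : pa.eval I.order ≤ pa.eval (pn.eval s) := pa.eval_le_eval_nat b1
  have b3 : a I.order ≤ A.eval s := by
    have := (hca I.order).1
    simp only [A, Polynomial.eval_add, Polynomial.eval_comp]
    omega
  have b4 : (BinTree.cons I.encode (.ofNat (a I.order))).size ≤
      (Polynomial.X + A + 1 : Polynomial ℕ).eval s := by
    simp only [BinTree.size, BinTree.size_ofNat, Polynomial.eval_add, Polynomial.eval_X,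
      Polynomial.eval_one]
    omega
  have b5 := hpt (.cons I.encode (.ofNat (a I.order)))
  have b6 : pt.eval (BinTree.cons I.encode (.ofNat (a I.order))).size ≤ M.eval s := by
    simp only [M, Polynomial.eval_comp]
    exact pt.eval_le_eval_nat b4
  simp only [BinTree.size, BinTree.size_ofNat, BinTree.hd, BinTree.tl, BinTree.len_ofNat,
    LabelCover.sizeA_encode, LabelCover.sizeB_encode] at b5
  simp only [BinTree.size, BinTree.size_ofNat] at b6
  have hN : I.nA * I.nB ≤ M.eval s := by omega
  have ht : I.encode.coins (a I.order) ≤ M.eval s := by omega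
  have b7 : ∀ L : List Bool, L.length = I.nA * I.nB →
      pf.eval (BinTree.cons (.cons I.encode (.ofNat (a I.order))) (bits L)).size ≤ H.eval s := by
    intro L hL
    have := size_bits_le L
    simp only [H, Polynomial.eval_comp]
    refine pf.eval_le_eval_nat ?_
    rw [BinTree.size]
    simp only [Polynomial.eval_add, Polynomial.eval_mul, Polynomial.eval_X, Polynomial.eval_one,
      Polynomial.eval_ofNat] at b4 ⊢
    omega
  have hf : ∀ L : List Bool,
      (BinTree.cons (.cons I.encode (.ofNat (a I.order))) (bits L)).hd.hd.sparsify
        (BinTree.cons (.cons I.encode (.ofNat (a I.order))) (bits L)).tl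
        ((BinTree.cons (.cons I.encode (.ofNat (a I.order))) (bits L)).hd.hd.cycleBound
          (BinTree.cons (.cons I.encode (.ofNat (a I.order))) (bits L)).hd.tl.len) =
      (I.sample (a I.order) L).encode := by
    intro L
    simp only [BinTree.hd, BinTree.tl, BinTree.len_ofNat]
    exact LabelCover.sparsify_encode _ _
  have key := samples_reduce (cn := cn) (ca := ca) (ct := ct) (cf := cf) (c := c) (x := I.encode)
    (y := .cons I.encode (.ofNat (a I.order))) (N := I.nA * I.nB)
    (t := I.encode.coins (a I.order)) (T := pn.eval s + pa.eval (pn.eval s) + M.eval s + 14)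
    (T' := H.eval s) (m := p.eval (H.eval s))
    (f := fun w => I.encode.sparsify w (I.encode.cycleBound (a I.order)))
    (n := fun w => p.eval (I.encode.sparsify w (I.encode.cycleBound (a I.order))).size) ?_ ?_ ?_
  · simp only [LabelCover.sparsify_encode] at key
    refine key.mono_time ?_
    simp only [Polynomial.eval_add, Polynomial.eval_mul, Polynomial.eval_comp, Polynomial.eval_ofNat]
    gcongr
  · refine (ensures_prepare (n := I.order) (T₁ := pn.eval s) (T₂ := pa.eval I.order)
      (T₃ := M.eval s) ?_ (hca I.order).2 ?_).mono_time (by omega)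
    · intro σ h
      have := hcn 1 σ
      rw [h] at this
      simpa [LabelCover.order] using this
    · intro σ h
      have := hct 3 σ
      rw [h] at this
      refine (this.mono_time (by simpa [BinTree.size] using b6)).mono fun σ' h' => ⟨h'.1.trans ?_, h'.2⟩
      simp [BinTree.hd, BinTree.tl]
  · intro L σ hL h
    have := hcf 4 σ
    rw [h] at this
    refine (this.mono_time (b7 L hL)).mono fun σ' h' => ⟨h'.1.trans ?_, h'.2⟩
    simp [BinTree.hd, BinTree.tl]
  · intro L hL
    rw [LabelCover.sparsify_encode]
    refine ⟨hc _, p.eval_le_eval_nat ?_⟩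
    have h1 := hpf (.cons (.cons I.encode (.ofNat (a I.order))) (bits L))
    rw [hf L] at h1
    exact h1.trans (b7 L hL)

/-! ### The distribution of the sample -/

/-- Conditioning on whether e is chosen; this matches the recursion by which the list of bits is
produced. -/
theorem subsampleExp_insert {V : Type*} [DecidableEq V] {F : Finset V} {p : ℝ} {e : V} (he : e ∉ F)
    (f : Finset V → ℝ) : subsampleExp (insert e F) p f =
      p * subsampleExp F p (fun S => f (insert e S)) + (1 - p) * subsampleExp F p f := by
  rw [subsampleExp, Finset.sum_powerset_insert he, add_comm, subsampleExp, subsampleExp,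
    Finset.mul_sum, Finset.mul_sum]
  congr 1 <;> refine Finset.sum_congr rfl fun S hS => ?_
  · have hS' := Finset.mem_powerset.1 hS
    rw [Finset.card_insert_of_notMem fun h => he (hS' h), Finset.insert_sdiff_insert,
      Finset.sdiff_insert_of_notMem he]
    ring
  · have hS' := Finset.mem_powerset.1 hS
    rw [Finset.insert_sdiff_of_notMem _ fun h => he (hS' h), Finset.card_insert_of_notMem
      fun h => he (Finset.mem_sdiff.1 h).1]
    ring

theorem subsampleExp_image {V W : Type*} [DecidableEq V] [DecidableEq W] {F : Finset V} {p : ℝ}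
    {g : V → W} (hg : Function.Injective g) (f : Finset W → ℝ) :
    subsampleExp (F.image g) p f = subsampleExp F p (fun S => f (S.image g)) := by
  rw [subsampleExp, Finset.powerset_image, Finset.sum_image (Finset.image_injective hg).injOn]
  refine Finset.sum_congr rfl fun S _ => ?_
  rw [← Finset.image_sdiff _ _ hg, Finset.card_image_of_injective _ hg,
    Finset.card_image_of_injective _ hg]

theorem subsampleExp_nonneg {V : Type*} [DecidableEq V] {F : Finset V} {p : ℝ} (h0 : 0 ≤ p)
    (h1 : p ≤ 1) {f : Finset V → ℝ} (hf : ∀ S, 0 ≤ f S) : 0 ≤ subsampleExp F p f :=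
  Finset.sum_nonneg fun S _ => mul_nonneg
    (mul_nonneg (pow_nonneg h0 _) (pow_nonneg (sub_nonneg.2 h1) _)) (hf S)

namespace Prog

open Samples

theorem iter_coinAnd_false (t : ℕ) : iter coinAnd t false = PMF.pure false := by
  induction t with
  | zero => rfl
  | succ t ih => simp [iter, coinAnd, ih]

theorem iter_coinAnd_true (t : ℕ) :
    iter coinAnd t true true = ENNReal.ofReal ((1 / 2) ^ t) ∧
    iter coinAnd t true false = ENNReal.ofReal (1 - (1 / 2) ^ t) := by
  induction t with
  | zero => simp [iter]
  | succ t ih =>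
    have h2 : (2 : ENNReal)⁻¹ = ENNReal.ofReal (1 / 2) := by
      rw [one_div, ENNReal.ofReal_inv_of_pos (by norm_num)]
      simp
    have h3 : (0 : ℝ) ≤ (1 / 2) ^ t := by positivity
    have h4 : ((1 : ℝ) / 2) ^ t ≤ 1 := pow_le_one₀ (by norm_num) (by norm_num)
    have h : ∀ b, iter coinAnd (t + 1) true b =
        2⁻¹ * iter coinAnd t true b + 2⁻¹ * iter coinAnd t false b := by
      intro b
      rw [iter, coinAnd, PMF.bind_bind, PMF.bind_apply, tsum_bool]
      simp [PMF.uniformOfFintype_apply, add_comm]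
    rw [h, h, ih.1, ih.2, iter_coinAnd_false, h2]
    simp only [PMF.pure_apply, reduceCtorEq, if_false, mul_zero, add_zero, if_true, mul_one]
    rw [← ENNReal.ofReal_mul (by norm_num), ← ENNReal.ofReal_mul (by norm_num),
      ← ENNReal.ofReal_add (by nlinarith) (by norm_num)]
    constructor <;> congr 1 <;> ring

theorem toOuterMeasure_consBiased_bind {δ : Type} (t : ℕ) (L : List Bool) (κ : List Bool → PMF δ)
    (B : Set δ) : ((consBiased t L).bind κ).toOuterMeasure B =
      ENNReal.ofReal ((1 / 2) ^ t) * (κ (true :: L)).toOuterMeasure B +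
      ENNReal.ofReal (1 - (1 / 2) ^ t) * (κ (false :: L)).toOuterMeasure B := by
  have h : (consBiased t L).bind κ = (iter coinAnd t true).bind fun b => κ (b :: L) := by
    rw [consBiased, PMF.bind_bind]
    simp only [PMF.pure_bind]
  rw [h, PMF.toOuterMeasure_bind_apply, tsum_bool, (iter_coinAnd_true t).1,
    (iter_coinAnd_true t).2, add_comm]

/-- The positions of the entries `true`, counted from `k`. -/
def marks : ℕ → List Bool → Finset ℕ
  | _, [] => ∅
  | k, b :: L => if b then insert k (marks (k + 1) L) else marks (k + 1) L

theorem mem_marks {k i : ℕ} {L : List Bool} :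
    i ∈ marks k L ↔ k ≤ i ∧ L.getD (i - k) false = true := by
  induction L generalizing k with
  | nil => simp [marks]
  | cons b L ih =>
    rcases lt_trichotomy i k with h | rfl | h
    · have : i ∉ marks (k + 1) L := fun h' => by have := (ih.1 h').1; omega
      cases b <;> simp [marks, this] <;> omega
    · have : i ∉ marks (i + 1) L := fun h' => by have := (ih.1 h').1; omega
      cases b <;> simp [marks, this]
    · obtain ⟨j, rfl⟩ := Nat.exists_eq_add_of_lt h
      have h1 : k + j + 1 - k = j + 1 := by omega
      have h2 : k + j + 1 - (k + 1) = j := by omega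
      have h3 : k + j + 1 ≠ k := by omega
      have h4 := ih (k := k + 1)
      rw [h2] at h4
      have h5 : k + j + 1 ∈ marks k (b :: L) ↔ k + j + 1 ∈ marks (k + 1) L := by
        cases b <;> simp [marks, h3]
      rw [h5, h4, h1, List.getD_cons_succ]
      exact and_congr_left fun _ => by omega

-- Bits are put in front, so with k more to come an existing list occupies the positions from k on.
-- The bit drawn next lands at position k, which is the element split off from `range (k + 1)`.
open Classical in
theorem toOuterMeasure_iter_consBiased (t k : ℕ) (L : List Bool) (B : Set (Finset ℕ)) :
    (iter (consBiased t) k L).toOuterMeasure {L' | marks 0 L' ∈ B} =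
      ENNReal.ofReal (subsampleExp (Finset.range k) ((1 / 2) ^ t)
        (fun S => if S ∪ marks k L ∈ B then 1 else 0)) := by
  induction k generalizing L with
  | zero =>
    rw [iter, PMF.toOuterMeasure_pure_apply]
    simp only [subsampleExp, Finset.range_zero, Finset.powerset_empty, Finset.sum_singleton,
      Finset.card_empty, pow_zero, Finset.sdiff_self, mul_one, one_mul, Finset.empty_union,
      Set.mem_ofPred_eq]
    split_ifs <;> simp
  | succ k ih =>
    have h3 : (0 : ℝ) ≤ (1 / 2) ^ t := by positivity
    have h4 : ((1 : ℝ) / 2) ^ t ≤ 1 := pow_le_one₀ (by norm_num) (by norm_num)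
    have h5 : ∀ M : Finset ℕ, 0 ≤ subsampleExp (Finset.range k) ((1 / 2) ^ t)
        (fun S => if S ∪ M ∈ B then 1 else 0) :=
      fun M => subsampleExp_nonneg h3 h4 fun S => by split_ifs <;> norm_num
    rw [iter, toOuterMeasure_consBiased_bind, ih, ih, ← ENNReal.ofReal_mul h3,
      ← ENNReal.ofReal_mul (sub_nonneg.2 h4), ← ENNReal.ofReal_add (mul_nonneg h3 (h5 _))
      (mul_nonneg (sub_nonneg.2 h4) (h5 _)), Finset.range_add_one,
      subsampleExp_insert Finset.notMem_range_self]
    simp [marks, Finset.insert_union, Finset.union_insert]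

end Prog

namespace LabelCover

open Prog Samples

variable (I : LabelCover)

theorem mem_selected_bits {L : List Bool} {e : Fin I.nA × Fin I.nB} :
    e ∈ I.selected (bits L) ↔ (finProdFinEquiv e : ℕ) ∈ marks 0 L := by
  rw [selected, Finset.mem_filter, mem_marks, bits, BinTree.get_ofList, finProdFinEquiv_apply_val]
  have h : ∀ i, ((L.map BinTree.ofBool).getD i .nil).toBool = L.getD i false := by
    intro i
    rw [show (BinTree.nil) = BinTree.ofBool false from rfl, List.getD_map, BinTree.toBool_ofBool]
  rw [h]
  simp

/-- A bit is drawn for every pair in A × B, in the numbering of `finProdFinEquiv`. Pairs that are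
not edges are harmless, because `restrict` has no use for them. -/
theorem toOuterMeasure_selected (t : ℕ) (P : Finset (Fin I.nA × Fin I.nB) → Prop) :
    (iter (consBiased t) (I.nA * I.nB) []).toOuterMeasure {L | ¬ P (I.selected (bits L))} =
      ENNReal.ofReal (1 - subsampleProb Finset.univ ((1 / 2) ^ t) P) := by
  classical
  let g : Fin I.nA × Fin I.nB → ℕ := fun e => (finProdFinEquiv e : ℕ)
  have hg : Function.Injective g := Fin.val_injective.comp finProdFinEquiv.injective
  let D : Finset ℕ → Finset (Fin I.nA × Fin I.nB) := fun M => Finset.univ.filter fun e => g e ∈ M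
  have h1 : ∀ L, I.selected (bits L) = D (marks 0 L) := fun L => by
    ext e
    simp [D, mem_selected_bits, g]
  have h2 : Finset.range (I.nA * I.nB) = Finset.univ.image g := by
    ext i
    simp only [Finset.mem_range, Finset.mem_image, Finset.mem_univ, true_and]
    refine ⟨fun hi => ⟨finProdFinEquiv.symm ⟨i, hi⟩, by
      simp only [g, Equiv.apply_symm_apply]⟩, ?_⟩
    rintro ⟨e, rfl⟩
    exact (finProdFinEquiv e).2
  have h3 : ∀ S, D (S.image g) = S := fun S => by
    ext e
    simp [D, hg.eq_iff]
  have h4 := toOuterMeasure_iter_consBiased t (I.nA * I.nB) [] {M | ¬ P (D M)}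
  simp only [Set.mem_ofPred_eq, ← h1] at h4
  rw [h4, h2, subsampleExp_image hg]
  congr 1
  rw [eq_sub_iff_add_eq, subsampleProb_eq_exp, ← subsampleExp_add]
  refine Eq.trans ?_ (subsampleExp_one (Finset.univ : Finset (Fin I.nA × Fin I.nB)) ((1 / 2) ^ t))
  congr 1
  funext S
  simp only [marks, Finset.union_empty, h3]
  by_cases h : P S <;> simp [h]

end LabelCover

/-! ### Error probabilities and majority votes -/

theorem PMF.le_bind_apply {β δ : Type*} (μ : PMF β) {κ : β → PMF δ} {x : δ} {r : ENNReal}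
    (h : ∀ b, r ≤ κ b x) : r ≤ μ.bind κ x := by
  rw [PMF.bind_apply]
  calc r = ∑' b, μ b * r := by rw [ENNReal.tsum_mul_right, μ.tsum_coe, one_mul]
    _ ≤ _ := ENNReal.tsum_le_tsum fun b => by gcongr; exact h b

/-- Union bound: `B` is the set of bad samples, about which nothing is assumed. -/
theorem PMF.bind_apply_le {β δ : Type*} (μ : PMF β) {κ : β → PMF δ} {x : δ} {r : ENNReal}
    {B : Set β} (h : ∀ b ∉ B, κ b x ≤ r) : μ.bind κ x ≤ μ.toOuterMeasure B + r := by
  classical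
  rw [PMF.bind_apply, PMF.toOuterMeasure_apply]
  calc ∑' b, μ b * κ b x ≤ ∑' b, (B.indicator μ b + μ b * r) := by
        refine ENNReal.tsum_le_tsum fun b => ?_
        by_cases hb : b ∈ B
        · rw [Set.indicator_of_mem hb]
          exact (mul_le_of_le_one_right' (PMF.coe_le_one _ _)).trans le_self_add
        · rw [Set.indicator_of_notMem hb, zero_add]
          gcongr
          exact h b hb
    _ = _ := by rw [ENNReal.tsum_add, ENNReal.tsum_mul_right, μ.tsum_coe, one_mul]

namespace Prog

/-- For success probability q the polynomial is q³ + 3q²(1 - q). -/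
theorem majority_apply (μ : PMF Bool) : majority μ true =
    ENNReal.ofReal ((μ true).toReal ^ 2 * (3 - 2 * (μ true).toReal)) := by
  have h1 : μ true = ENNReal.ofReal (μ true).toReal :=
    (ENNReal.ofReal_toReal (PMF.apply_ne_top _ _)).symm
  have h2 : μ false = ENNReal.ofReal (1 - (μ true).toReal) := by
    have h3 := μ.tsum_coe
    rw [tsum_bool] at h3
    rw [ENNReal.ofReal_sub _ ENNReal.toReal_nonneg, ← h1, ENNReal.ofReal_one, ← h3]
    exact (ENNReal.add_sub_cancel_right (PMF.apply_ne_top _ _)).symm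
  have h3 : (μ true).toReal ≤ 1 := ENNReal.toReal_le_of_le_ofReal zero_le_one (by
    simpa using PMF.coe_le_one μ true)
  have h4 : 0 ≤ (μ true).toReal := ENNReal.toReal_nonneg
  set q := (μ true).toReal with hq
  have h5 : 0 ≤ 1 - q := sub_nonneg.2 h3
  simp only [majority, PMF.bind_apply, tsum_bool, PMF.pure_apply, Bool.cond_true, Bool.cond_false,
    Bool.or_true, Bool.or_false, Bool.and_true, Bool.and_false, if_true, reduceCtorEq, if_false,
    mul_one, mul_zero, add_zero, zero_add]
  rw [h1, h2, ← ENNReal.ofReal_add h5 h4, ← ENNReal.ofReal_mul h4, ← ENNReal.ofReal_mul h5]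
  rw [← ENNReal.ofReal_mul h5, ← ENNReal.ofReal_mul h4, ← ENNReal.ofReal_add (by positivity)
    (by positivity), ← ENNReal.ofReal_mul h4, ← ENNReal.ofReal_add (by positivity) (by positivity)]
  congr 1
  ring

theorem le_majority {μ : PMF Bool} (h : 2 / 3 ≤ μ true) : 2 / 3 ≤ majority μ true := by
  have h1 : (2 / 3 : ℝ) ≤ (μ true).toReal := by
    simpa using ENNReal.toReal_mono (PMF.apply_ne_top _ _) h
  have h3 : (μ true).toReal ≤ 1 := ENNReal.toReal_le_of_le_ofReal zero_le_one (by
    simpa using PMF.coe_le_one μ true)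
  have h4 : (2 / 3 : ℝ) ≤ (μ true).toReal ^ 2 * (3 - 2 * (μ true).toReal) := by
    nlinarith [mul_nonneg (sub_nonneg.2 h1) (sub_nonneg.2 h3)]
  rw [majority_apply, ENNReal.le_ofReal_iff_toReal_le (by finiteness) (by linarith)]
  simpa using h4

/-- At q = 1/3 the polynomial equals 7/27. The gap to 1/3 pays for bad samples. -/
theorem majority_le {μ : PMF Bool} (h : μ true ≤ 1 / 3) :
    majority μ true ≤ ENNReal.ofReal (7 / 27) := by
  have h1 : (μ true).toReal ≤ 1 / 3 := by
    simpa using ENNReal.toReal_mono (by finiteness) h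
  have h4 : 0 ≤ (μ true).toReal := ENNReal.toReal_nonneg
  rw [majority_apply]
  refine ENNReal.ofReal_le_ofReal ?_
  nlinarith [mul_nonneg h4 (sub_nonneg.2 h1), mul_nonneg (mul_nonneg h4 (sub_nonneg.2 h1)) h4,
    mul_nonneg (sub_nonneg.2 h1) (sub_nonneg.2 h1)]

end Prog

/-! ### The parameters -/

theorem BinTree.log_eq {b n : ℕ} (hb : 2 ≤ b) (hn : 1 ≤ n) : BinTree.log b n = Nat.log b n :=
  logState_snd hb hn

namespace AdmissibleParams

variable {n d qA qB k : ℕ} {s α : ℝ}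

theorem one_le_logb (h : AdmissibleParams n d qA qB k s α) : 1 ≤ Real.logb 2 qA := by
  have h1 : (2 : ℝ) ≤ qA := by exact_mod_cast h.two_le_qA
  rw [Real.le_logb_iff_rpow_le (by norm_num) (by linarith), Real.rpow_one]
  exact h1

/-- The bound on α by the k-th root of d in its usable form: the expected degree of the sample,
raised to the power k, is at most d. -/
theorem pow_le (h : AdmissibleParams n d qA qB k s α) (hα : 0 ≤ α) :
    (α * Real.logb 2 qA) ^ k ≤ d := by
  have h1 := h.one_le_logb
  have h2 := (le_div_iff₀ (by linarith)).1 h.le_root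
  calc (α * Real.logb 2 qA) ^ k ≤ ((d : ℝ) ^ ((1 : ℝ) / k)) ^ k :=
        pow_le_pow_left₀ (by positivity) h2 k
    _ = d := by
        rw [one_div, Real.rpow_inv_natCast_pow (by positivity) (by have := h.one_le_k; omega)]

theorem le_degree (h : AdmissibleParams n d qA qB k s α) (hα : 1 ≤ α) :
    α * Real.logb 2 qA ≤ d := by
  have h1 := h.one_le_logb
  refine (le_self_pow₀ ?_ (by have := h.one_le_k; omega)).trans (h.pow_le (by linarith))
  nlinarith

end AdmissibleParams

theorem six_hundred_le_logb {n : ℕ} (h : 2 ^ 600 ≤ n) : 600 ≤ Real.logb 2 n := by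
  have h1 : (2 : ℝ) ^ 600 ≤ n := by exact_mod_cast h
  rw [Real.le_logb_iff_rpow_le (by norm_num) (lt_of_lt_of_le (by positivity) h1)]
  exact_mod_cast h1

theorem LabelCover.IsRegular.order_eq {I : LabelCover} {n d qA qB : ℕ}
    (h : I.IsRegular n d qA qB) : I.order = n := by
  have h1 := h.sizeA
  have h2 := h.sizeB
  rw [LabelCover.order]
  omega

/-- The parameters that the reduction uses are good approximations. -/
theorem coins_cycleBound {I : LabelCover} {n d qA qB k a : ℕ} {s α : ℝ}
    (hn : 2 ^ 600 ≤ n) (hI : I.IsRegular n d qA qB) (h : AdmissibleParams n d qA qB k s α)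
    (ha : |α - a| ≤ 1) :
    k ≤ I.encode.cycleBound a ∧
    α * Real.logb 2 qA / 16 ≤ (1 / 2) ^ I.encode.coins a * d ∧
    ((1 / 2 : ℝ) ^ I.encode.coins a * d) ^ I.encode.cycleBound a ≤ d := by
  have hl := six_hundred_le_logb hn
  have hα : 10800 ≤ α := by have := h.log_le; linarith
  have hq := h.one_le_logb
  have hd := h.le_degree (by linarith)
  have hd1 : 1 ≤ d := by
    have : (1 : ℝ) ≤ d := by nlinarith
    exact_mod_cast this
  have hqA := h.two_le_qA
  obtain ⟨ha1, ha2⟩ := abs_le.1 ha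
  set l := Nat.log 2 qA with hldef
  have hl1 : 1 ≤ l := Nat.log_pos (by norm_num) hqA
  have hl1' : (1 : ℝ) ≤ l := by exact_mod_cast hl1
  have hl2 : (l : ℝ) ≤ Real.logb 2 qA := by
    exact_mod_cast Real.natLog_le_logb qA 2
  have hl3 : Real.logb 2 qA ≤ 2 * l := by
    have h1 : Real.logb 2 qA < l + 1 := by
      have h2 : qA < 2 ^ (l + 1) := Nat.lt_pow_succ_log_self (by norm_num) qA
      rw [Real.logb_lt_iff_lt_rpow (by norm_num) (by exact_mod_cast (by omega : 0 < qA))]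
      exact_mod_cast h2
    linarith
  have ha3 : 1 ≤ a := by
    have : (1 : ℝ) ≤ a := by linarith
    exact_mod_cast this
  have ha4 : ((a - 1 : ℕ) : ℝ) = a - 1 := by push_cast [ha3]; ring
  -- Subtracting 1 and rounding the logarithm down make D a lower approximation of α log |Σ_A|. It
  -- loses at most a factor 4, since a - 1 ≥ α/2 and the logarithm is at most 2l.
  set D := (a - 1) * l with hD
  have hDr : (D : ℝ) = (a - 1) * l := by rw [hD, Nat.cast_mul, ha4]
  have hD1 : (D : ℝ) ≤ α * Real.logb 2 qA := by
    rw [hDr]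
    exact mul_le_mul (by linarith) hl2 (by positivity) (by linarith)
  have hD2 : α * Real.logb 2 qA / 4 ≤ D := by
    rw [hDr]
    nlinarith [mul_nonneg (by linarith : (0 : ℝ) ≤ α) (sub_nonneg.2 hl3),
      mul_nonneg (by linarith : (0 : ℝ) ≤ (a : ℝ) - 1 - α / 2) (by linarith : (0 : ℝ) ≤ l)]
  have hD3 : 2 ≤ D := by
    have : (2 : ℝ) ≤ D := by nlinarith
    exact_mod_cast this
  have hDd : D ≤ d := by exact_mod_cast hD1.trans hd
  have hbase : I.encode.base a = D := by
    rw [BinTree.base, LabelCover.alphA_encode, hI.alphabetA, BinTree.log_eq le_rfl (by omega)]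
  have hdeg : I.encode.deg = d := I.deg_encode hI.degree (by
    have := hI.sizeA
    by_contra h0
    rw [show n = 0 by omega] at hn
    norm_num at hn)
  have hc : I.encode.cycleBound a = Nat.log D d := by
    rw [BinTree.cycleBound, hbase, hdeg, BinTree.log_eq hD3 hd1]
  have ht : I.encode.coins a = Nat.log 2 d - Nat.log 2 D + 1 := by
    rw [BinTree.coins, hbase, hdeg, BinTree.log_eq le_rfl hd1, BinTree.log_eq le_rfl (by omega)]
  set t := I.encode.coins a
  set u := Nat.log 2 d
  set v := Nat.log 2 D
  have huv : v ≤ u := Nat.log_mono_right hDd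
  have hp : (1 / 2 : ℝ) ^ t * 2 ^ t = 1 := by rw [← mul_pow]; norm_num
  have hp0 : (0 : ℝ) < (1 / 2) ^ t := by positivity
  -- The additional toss in t = u - v + 1 compensates for rounding log d down, so that 2⁻ᵗd ≤ D;
  -- rounding costs at most a factor 4 in the other direction.
  have htv : (2 : ℝ) ^ t * 2 ^ v = 2 * 2 ^ u := by
    rw [← pow_add, show t + v = u + 1 by omega, pow_succ']
  have u1 : (2 : ℝ) ^ u ≤ d := by exact_mod_cast Nat.pow_log_le_self 2 (by omega : d ≠ 0)
  have u2 : (d : ℝ) ≤ 2 * 2 ^ u := by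
    have := (Nat.lt_pow_succ_log_self (b := 2) (by norm_num) d).le
    rw [pow_succ'] at this
    exact_mod_cast this
  have v1 : (2 : ℝ) ^ v ≤ D := by exact_mod_cast Nat.pow_log_le_self 2 (by omega : D ≠ 0)
  have v2 : (D : ℝ) ≤ 2 * 2 ^ v := by
    have := (Nat.lt_pow_succ_log_self (b := 2) (by norm_num) D).le
    rw [pow_succ'] at this
    exact_mod_cast this
  have hpv : (1 / 2 : ℝ) ^ t * (2 * 2 ^ u) = 2 ^ v := by rw [← htv, ← mul_assoc, hp, one_mul]
  have p1 : (1 / 2 : ℝ) ^ t * d ≤ D := by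
    have := mul_le_mul_of_nonneg_left u2 hp0.le
    linarith
  have p2 : (D : ℝ) / 4 ≤ (1 / 2 : ℝ) ^ t * d := by
    have := mul_le_mul_of_nonneg_left u1 hp0.le
    linarith
  refine ⟨?_, by linarith, ?_⟩
  · rw [hc]
    refine Nat.le_log_of_pow_le (by omega) ?_
    -- This makes k at most the integer logarithm of d to base D, so the program removes enough
    -- cycles without knowing k.
    have : (D : ℝ) ^ k ≤ d :=
      (pow_le_pow_left₀ (by positivity) hD1 k).trans (h.pow_le (by linarith))
    exact_mod_cast this
  · rw [hc]
    refine (pow_le_pow_left₀ (by positivity) p1 _).trans ?_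
    exact_mod_cast Nat.pow_log_le_self D (by omega : d ≠ 0)

/-! ### The main theorem -/

/-- The sample is the sparsification for k of its own edge set, although the program removed cycles
up to a possibly larger length. -/
theorem LabelCover.sample_mem_sparsified {I : LabelCover} {X : Set LabelCover} (hI : I ∈ X)
    {k : ℕ → ℕ} {a : ℕ} (hk : k I.order ≤ I.encode.cycleBound a) (L : List Bool) :
    I.sample a L ∈ sparsified k X :=
  ⟨I, hI, (I.sample a L).edges, I.sparsify_edges_subset _ _, sparsify_eq_sparsify hk _⟩

theorem LabelCover.lt_supergirth_sample {I : LabelCover} {k a : ℕ}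
    (hk : k ≤ I.encode.cycleBound a) (L : List Bool) : (k : ℕ∞) < (I.sample a L).supergirth :=
  lt_of_le_of_lt (by exact_mod_cast hk) (I.lt_supergirth_sparsify _ _)

theorem mainTheorem4 :
    ∃ c : ℝ, 0 < c ∧
      -- the sparsified instances, for all large n
      (∃ n₀ : ℕ, ∀ (n d qA qB k : ℕ) (s α : ℝ) (G : LabelCover), n₀ ≤ n →
        AdmissibleParams n d qA qB k s α → G.IsRegular n d qA qB →
          (∀ S ⊆ G.edges, (k : ℕ∞) < (G.sparsify k S).supergirth) ∧
          (G.FullySatisfiable → ∀ S ⊆ G.edges, (G.sparsify k S).RepCoverAtMost n) ∧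
          (G.AtMostSatisfiable s →
            2 / 3 ≤ subsampleProb G.edges (α * Real.logb 2 qA / d) fun S =>
              (G.sparsify k S).RepCoverAtLeast (n * Real.sqrt α / c))) ∧
      -- the hardness
      (∀ (d qA qB k : ℕ → ℕ) (s α : ℕ → ℝ),
        (∀ᶠ n in atTop, Even n → AdmissibleParams n (d n) (qA n) (qB n) (k n) (s n) (α n)) →
        (∃ a : ℕ → ℕ, PolyTimeComputable a ∧ ∀ᶠ n in atTop, Even n → |α n - a n| ≤ 1) →
        ¬ RandPolyDistinguishable (labelCoverYes d qA qB) (labelCoverNo d qA qB s) →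
        ¬ RandPolyDistinguishable
            (minRepYes k ∩ sparsified k (labelCoverYes d qA qB))
            (minRepNo k α c ∩ sparsified k (labelCoverNo d qA qB s))) := by
  -- The size 2^600 makes log n ≥ 600 and hence α ≥ 10800.
  refine ⟨1024, by norm_num, ⟨2 ^ 600, ?_⟩, ?_⟩
  · intro n d qA qB k s α G hn h hG
    refine ⟨fun S _ => G.lt_supergirth_sparsify k S, fun hs S _ => ?_, fun hs => ?_⟩
    · rw [← hG.order_eq]
      exact hs.repCoverAtMost k S
    · have hl := six_hundred_le_logb hn
      have hα : 10800 ≤ α := by have := h.log_le; linarith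
      have hq := h.one_le_logb
      have hd := h.le_degree (by linarith)
      have h1 : 0 < α * Real.logb 2 qA := by positivity
      have h2 : α * Real.logb 2 qA / d * d = α * Real.logb 2 qA :=
        div_mul_cancel₀ _ (by linarith)
      refine le_trans (by norm_num) (LabelCover.le_subsampleProb_repCoverAtLeast hl hG h.two_le_qA
        h.qB_le_qA h.log_le h.s_pos h.le_inv (by positivity) (div_le_one_of_le₀ hd (by positivity))
        ?_ ?_ hs subset_rfl)
      · rw [h2]
        linarith
      · rw [h2]
        exact h.pow_le (by linarith)
  · rintro d qA qB k s α hadm ⟨a, ha, haα⟩ hhard ⟨c, p, n₁, hc⟩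
    refine hhard ?_
    obtain ⟨n₂, hn₂⟩ := eventually_atTop.1 (hadm.and haα)
    obtain ⟨P, T, hP⟩ := exists_reduction ha fun I => (hc I).1
    refine ⟨P, T, max (max n₁ n₂) (2 ^ 600), fun I => ?_⟩
    obtain ⟨y1, y2⟩ := (hP I).yields
    have hacc : ∀ L, Prog.answer c (I.sample (a I.order) L).encode
        (p.eval (I.sample (a I.order) L).encode.size) true =
        c.acceptProb (I.sample (a I.order) L).encode
          (p.eval (I.sample (a I.order) L).encode.size) := fun L => rfl
    refine ⟨fun γ hγ => (y1 γ hγ).1, fun hn hI => ?_, fun hn hI => ?_⟩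
    all_goals
      have hn1 : n₁ ≤ I.order := (le_max_left _ _).trans ((le_max_left _ _).trans hn)
      have hn2 : n₂ ≤ I.order := (le_max_right _ _).trans ((le_max_left _ _).trans hn)
      have hn3 : 2 ^ 600 ≤ I.order := (le_max_right _ _).trans hn
      have heven : Even I.order := ⟨I.nA, by have := hI.1.sizeA; omega⟩
      have had := (hn₂ _ hn2).1 heven
      obtain ⟨k1, k2, k3⟩ := coins_cycleBound hn3 hI.1 had ((hn₂ _ hn2).2 heven)
    · refine le_of_le_of_eq ?_ (congrArg (fun μ : PMF Bool => μ true) y2).symm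
      -- Every sample of a satisfiable instance is a yes-instance, so sampling adds no error on this
      -- side.
      refine PMF.le_bind_apply _ fun L => Prog.le_majority ?_
      rw [hacc]
      exact (hc _).2.1 hn1 ⟨⟨LabelCover.lt_supergirth_sample k1 L, hI.2.repCoverAtMost _ _⟩,
        LabelCover.sample_mem_sparsified hI k1 L⟩
    · refine le_of_eq_of_le (congrArg (fun μ : PMF Bool => μ true) y2) ?_
      -- Bad samples are those with a small REP-cover. They have probability at most 1/20, and 1/20
      -- + 7/27 ≤ 1/3.
      refine (PMF.bind_apply_le (B := {L | ¬ (I.sample (a I.order) L).RepCoverAtLeast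
        (I.order * √(α I.order) / 1024)}) _ fun L hL => Prog.majority_le ?_).trans ?_
      · rw [hacc]
        exact (hc _).2.2 hn1 ⟨⟨LabelCover.lt_supergirth_sample k1 L, not_not.1 hL⟩,
          LabelCover.sample_mem_sparsified hI k1 L⟩
      · have h1 := I.toOuterMeasure_selected (I.encode.coins (a I.order)) fun S =>
          (I.sparsify (I.encode.cycleBound (a I.order)) S).RepCoverAtLeast
            (I.order * √(α I.order) / 1024)
        have h2 := LabelCover.le_subsampleProb_repCoverAtLeast (six_hundred_le_logb hn3) hI.1
          had.two_le_qA had.qB_le_qA had.log_le had.s_pos had.le_inv (by positivity)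
          (pow_le_one₀ (by norm_num) (by norm_num)) k2 k3 hI.2 (Finset.subset_univ _)
        refine (add_le_add_left h1.le _).trans ?_
        have h3 : (1 / 3 : ENNReal) = ENNReal.ofReal (1 / 3) := by
          rw [ENNReal.ofReal_div_of_pos (by norm_num)]
          simp
        rw [h3]
        refine (add_le_add_left (ENNReal.ofReal_le_ofReal (sub_le_sub_left h2 1)) _).trans ?_
        rw [← ENNReal.ofReal_add (by norm_num) (by norm_num)]
        exact ENNReal.ofReal_le_ofReal (by norm_num)
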